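/- **Conventions.** Let $\overline{\mathcal H}=\{z\in\mathbb C:\operatorname{Im}z\ge 0\}$. A function $f:U\to\mathbb C$ on an open subset $U\subset\overline{\mathcal H}$ is *dianalytic* if it is continuous, maps $U\cap\mathbb R$ to $\mathbb R$, and is holomorphic or anti-holomorphic on each connected component of $U\setminus\mathbb R$. A *Klein surface* $S$ is a Hausdorff space with an atlas of charts $\varphi_\tau:U_\tau\to V_\tau$ onto open subsets $V_\tau\subset\overline{\mathcal H}$ whose changes of coordinates are dianalytic. A *complex cover* $(M,\sigma,p)$ of $S$ is a (not necessarily connected) Riemann surface $M$ with an anti-holomorphic involution $\sigma$ and a map $p:M\to S$ inducing an isomorphism of Klein surfaces $M/\sigma\to S$; that is, $p$ is a quotient map whose fibres are the orbits of $\sigma$, and locally, in a holomorphic chart of $M$ and a dianalytic chart of $S$, $p$ is $a+ib\mapsto a+i|b|$. For a dianalytic chart $\varphi_\tau$ let $z_\tau:p^{-1}(U_\tau)\to\mathbb C$ be the holomorphic map lifting $\varphi_\tau\circ p$ through $a+ib\mapsto a+i|b|$. A *dianalytic vector bundle* $Q$ of rank $r$ over $S$ is a topological (real) vector bundle with fibre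 $\mathbb C^r$, with a family of local trivialisations $\psi_\tau$ over domains $U_\tau$ of dianalytic charts $\varphi_\tau$ covering $S$, whose transition maps are dianalytic in the following sense: on $U_\tau\cap U_{\tau'}$, $$\psi_\tau\circ\psi_{\tau'}^{-1}(x,\eta)=\begin{cases}(x,\;h_{\tau\tau'}(x)\,\eta) & \text{where }\varphi_\tau\circ\varphi_{\tau'}^{-1}\text{ is holomorphic},\\ (x,\;h_{\tau\tau'}(x)\,\overline{\eta}) & \text{where }\varphi_\tau\circ\varphi_{\tau'}^{-1}\text{ is anti-holomorphic},\end{cases}$$ with $h_{\tau\tau'}\circ\varphi_{\tau'}^{-1}$ continuous, respectively holomorphic or anti-holomorphic off $\mathbb R$, and with values in $\mathrm{GL}_r(\mathbb R)$ over $\partial S$. A homomorphism $f:Q\to Q'$ is a fibrewise linear map over $\mathrm{id}_S$ which in local charts and trivialisations has the same form, with a matrix function $k$ (of size $r'\times r$, real over $\partial S$) in place of $h_{\tau\tau'}$. A *real holomorphic vector bundle* over $(M,\sigma)$ is a holomorphic vector bundle $\mathcal E\to M$ with an anti-holomorphic involution $\widetilde\sigma:\mathcal E\to\mathcal E$ which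 covers $\sigma$ and is $\mathbb C$-antilinear in the fibres. A homomorphism $(\mathcal E,\widetilde\sigma)\to(\mathcal E',\widetilde\sigma')$ is a homomorphism $f$ of holomorphic vector bundles over $M$ with $f\circ\widetilde\sigma=\widetilde\sigma'\circ f$. For a dianalytic bundle $Q$, the pulled back bundle $p^*Q$ is the real holomorphic bundle with holomorphic trivialisations over the sets $p^{-1}(U_\tau)$ in which $\widetilde\sigma$ is $\eta\mapsto\overline\eta$ and whose transition functions are $$g_{\tau\tau'}(y)=\begin{cases}h_{\tau\tau'}(p(y)) & \text{if } \operatorname{Im}z_\tau(y)>0,\\ \overline{h_{\tau\tau'}(p(y))} & \text{if }\operatorname{Im}z_\tau(y)\le 0.\end{cases}$$ For a homomorphism $f$, the matrices of $p^*f$ are obtained from those of $f$ in the same way (with $z_\tau$ belonging to the trivialisation of the target of $f$). **Lemma.** Let $S$ be a Klein surface and let $(M,\sigma,p)$ be a complex cover of $S$. Then the pull-back functor $p^*$ exists and is an equivalence of categories from the category of dianalytic vector bundles over $S$ to the category of real holomorphic vector bundles over $(M,\sigma)$. -/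

import Mathlib

open CategoryTheory Topology Bundle Filter
open scoped Manifold ContDiff ComplexConjugate

noncomputable section

namespace Klein

/-! ## Dianalytic functions on the closed upper half-plane -/

/-- The closed upper half-plane `{z ∈ ℂ | Im z ≥ 0}` with the induced topology. -/
abbrev ClosedHalfPlane : Type := {z : ℂ // 0 ≤ z.im}

/-- The folding map `a + i b ↦ a + i |b|` from `ℂ` to the closed upper half-plane. -/
def fold (z : ℂ) : ClosedHalfPlane := ⟨⟨z.re, |z.im|⟩, abs_nonneg _⟩

/-- `f` is holomorphic near the point `w` of the closed upper half-plane: on a neighbourhood of `w`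
it is continuous, real on the real axis, and complex differentiable in the open upper half-plane.
(Near a point of the open upper half-plane, `f ∘ fold` is just `f`.) -/
def HoloAt (f : ClosedHalfPlane → ℂ) (w : ClosedHalfPlane) : Prop :=
  ∀ᶠ v in 𝓝 w, ContinuousAt f v ∧ (v.1.im = 0 → (f v).im = 0) ∧
    (0 < v.1.im → DifferentiableAt ℂ (fun z : ℂ => f (fold z)) v.1)

/-- `f` is anti-holomorphic near `w`: its complex conjugate is holomorphic near `w`. -/
def AntiAt (f : ClosedHalfPlane → ℂ) (w : ClosedHalfPlane) : Prop :=
  HoloAt (fun v => conj (f v)) w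

/-- `f` is dianalytic near `w`. By the identity theorem, a function on an open set `U` of the closed
upper half-plane is dianalytic near every point of `U` if and only if it is continuous on `U`, real
on `U ∩ ℝ`, and on each connected component of the set of non-real points of `U` either holomorphic
or anti-holomorphic. -/
def DianalyticAt (f : ClosedHalfPlane → ℂ) (w : ClosedHalfPlane) : Prop :=
  HoloAt f w ∨ AntiAt f w

theorem fold_coe (w : ClosedHalfPlane) : fold w.1 = w := by
  apply Subtype.ext
  apply Complex.ext
  · rfl
  · exact abs_of_nonneg w.2

theorem continuous_fold : Continuous fold := by
  have h : Continuous (fun z : ℂ => ((z.re : ℂ) + (|z.im| : ℝ) * Complex.I)) := by fun_prop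
  refine Continuous.subtype_mk (h.congr fun z => ?_) _
  apply Complex.ext <;> simp

theorem HoloAt.congr {f g : ClosedHalfPlane → ℂ} {w : ClosedHalfPlane} (hf : HoloAt f w)
    (h : f =ᶠ[𝓝 w] g) : HoloAt g w := by
  filter_upwards [hf, h.eventually_nhds] with v ⟨h1, h2, h3⟩ hv
  refine ⟨h1.congr hv, fun h0 => ?_, fun h0 => (h3 h0).congr_of_eventuallyEq ?_⟩
  · rw [← hv.self_of_nhds]; exact h2 h0
  · have hc : Tendsto fold (𝓝 v.1) (𝓝 v) := by
      have := continuous_fold.tendsto v.1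
      rwa [fold_coe] at this
    exact (hc.eventually hv).mono fun z hz => hz.symm

theorem AntiAt.congr {f g : ClosedHalfPlane → ℂ} {w : ClosedHalfPlane} (hf : AntiAt f w)
    (h : f =ᶠ[𝓝 w] g) : AntiAt g w :=
  HoloAt.congr hf (h.fun_comp conj)

theorem DianalyticAt.congr {f g : ClosedHalfPlane → ℂ} {w : ClosedHalfPlane}
    (hf : DianalyticAt f w) (h : f =ᶠ[𝓝 w] g) : DianalyticAt g w :=
  hf.imp (fun h' => h'.congr h) (fun h' => h'.congr h)

theorem HoloAt.eventually {f : ClosedHalfPlane → ℂ} {w : ClosedHalfPlane} (hf : HoloAt f w) :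
    ∀ᶠ v in 𝓝 w, HoloAt f v := eventually_eventually_nhds.mpr hf

theorem DianalyticAt.im_eq_zero {f : ClosedHalfPlane → ℂ} {w : ClosedHalfPlane}
    (hf : DianalyticAt f w) (hw : w.1.im = 0) : (f w).im = 0 := by
  rcases hf with h | h
  · exact h.self_of_nhds.2.1 hw
  · simpa using h.self_of_nhds.2.1 hw

theorem holoAt_coe (w : ClosedHalfPlane) : HoloAt (fun v => v.1) w := by
  refine Eventually.of_forall fun v => ⟨continuous_subtype_val.continuousAt, fun h => h, fun h => ?_⟩
  refine differentiableAt_id.congr_of_eventuallyEq ?_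
  filter_upwards [(isOpen_lt continuous_const Complex.continuous_im).mem_nhds h] with z hz
  exact congrArg Subtype.val (fold_coe ⟨z, le_of_lt hz⟩)

theorem HoloAt.comp {f : ClosedHalfPlane → ℂ} {e : ClosedHalfPlane → ClosedHalfPlane}
    {w : ClosedHalfPlane} (hf : HoloAt f (e w)) (hc : ContinuousAt e w)
    (he : HoloAt (fun v => (e v).1) w) (hi : ∀ᶠ v in 𝓝 w, 0 < v.1.im → 0 < (e v).1.im) :
    HoloAt (fun v => f (e v)) w := by
  filter_upwards [hc.eventually hf, he, hi] with v ⟨h1, h2, h3⟩ ⟨k1, k2, k3⟩ hv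
  refine ⟨ContinuousAt.comp h1 (IsInducing.subtypeVal.continuousAt_iff.mpr k1), fun h0 => h2 (k2 h0),
    fun h0 => ?_⟩
  have h4 := h3 (hv h0)
  have h5 : DifferentiableAt ℂ (fun z : ℂ => f (fold z)) ((fun z : ℂ => (e (fold z)).1) v.1) := by
    simpa only [fold_coe] using h4
  simpa only [Function.comp_def, fold_coe] using h5.comp v.1 (k3 h0)

theorem HoloAt.comp_anti {f : ClosedHalfPlane → ℂ} {e : ClosedHalfPlane → ClosedHalfPlane}
    {w : ClosedHalfPlane} (hf : HoloAt f (e w)) (hc : ContinuousAt e w)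
    (he : AntiAt (fun v => (e v).1) w) (hi : ∀ᶠ v in 𝓝 w, 0 < v.1.im → 0 < (e v).1.im) :
    AntiAt (fun v => f (e v)) w := by
  filter_upwards [hc.eventually hf, he, hi] with v ⟨h1, h2, h3⟩ ⟨k1, k2, k3⟩ hv
  have k1' : ContinuousAt (fun v => (e v).1) v := by
    simpa [Function.comp_def] using Complex.continuous_conj.continuousAt.comp k1
  refine ⟨Complex.continuous_conj.continuousAt.comp
    (ContinuousAt.comp h1 (IsInducing.subtypeVal.continuousAt_iff.mpr k1')), fun h0 => ?_, fun h0 => ?_⟩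
  · have := k2 h0
    simp only [Complex.conj_im, neg_eq_zero] at this ⊢
    exact h2 this
  have h5 := (h3 (hv h0)).conj_conj
  have h6 : DifferentiableAt ℂ (conj ∘ (fun z : ℂ => f (fold z)) ∘ conj)
      ((fun z : ℂ => conj (e (fold z)).1) v.1) := by
    simpa only [fold_coe] using h5
  simpa only [Function.comp_def, fold_coe, Complex.conj_conj] using h6.comp v.1 (k3 h0)

theorem AntiAt.comp {f : ClosedHalfPlane → ℂ} {e : ClosedHalfPlane → ClosedHalfPlane}
    {w : ClosedHalfPlane} (hf : AntiAt f (e w)) (hc : ContinuousAt e w)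
    (he : HoloAt (fun v => (e v).1) w) (hi : ∀ᶠ v in 𝓝 w, 0 < v.1.im → 0 < (e v).1.im) :
    AntiAt (fun v => f (e v)) w :=
  HoloAt.comp (f := fun v => conj (f v)) hf hc he hi

theorem AntiAt.comp_anti {f : ClosedHalfPlane → ℂ} {e : ClosedHalfPlane → ClosedHalfPlane}
    {w : ClosedHalfPlane} (hf : AntiAt f (e w)) (hc : ContinuousAt e w)
    (he : AntiAt (fun v => (e v).1) w) (hi : ∀ᶠ v in 𝓝 w, 0 < v.1.im → 0 < (e v).1.im) :
    HoloAt (fun v => f (e v)) w := by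
  simpa only [AntiAt, Complex.conj_conj] using
    HoloAt.comp_anti (f := fun v => conj (f v)) hf hc he hi

theorem DianalyticAt.comp {f : ClosedHalfPlane → ℂ} {e : ClosedHalfPlane → ClosedHalfPlane}
    {w : ClosedHalfPlane} (hf : DianalyticAt f (e w)) (hc : ContinuousAt e w)
    (he : DianalyticAt (fun v => (e v).1) w) (hi : ∀ᶠ v in 𝓝 w, 0 < v.1.im → 0 < (e v).1.im) :
    DianalyticAt (fun v => f (e v)) w := by
  rcases hf with hf | hf <;> rcases he with he | he
  · exact Or.inl (hf.comp hc he hi)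
  · exact Or.inr (hf.comp_anti hc he hi)
  · exact Or.inr (hf.comp hc he hi)
  · exact Or.inl (hf.comp_anti hc he hi)

theorem HoloAt.add {f g : ClosedHalfPlane → ℂ} {w : ClosedHalfPlane} (hf : HoloAt f w)
    (hg : HoloAt g w) : HoloAt (fun v => f v + g v) w := by
  filter_upwards [hf, hg] with v ⟨h1, h2, h3⟩ ⟨k1, k2, k3⟩
  exact ⟨h1.add k1, fun h => by simp [h2 h, k2 h], fun h => (h3 h).add (k3 h)⟩

theorem HoloAt.mul {f g : ClosedHalfPlane → ℂ} {w : ClosedHalfPlane} (hf : HoloAt f w)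
    (hg : HoloAt g w) : HoloAt (fun v => f v * g v) w := by
  filter_upwards [hf, hg] with v ⟨h1, h2, h3⟩ ⟨k1, k2, k3⟩
  exact ⟨h1.mul k1, fun h => by simp [h2 h, k2 h], fun h => (h3 h).mul (k3 h)⟩

theorem holoAt_zero (w : ClosedHalfPlane) : HoloAt (fun _ => 0) w :=
  Eventually.of_forall fun _ => ⟨continuousAt_const, fun _ => rfl, fun _ => differentiableAt_const _⟩

theorem HoloAt.sum {ι : Type*} {s : Finset ι} {f : ι → ClosedHalfPlane → ℂ} {w : ClosedHalfPlane}
    (hf : ∀ i ∈ s, HoloAt (f i) w) : HoloAt (fun v => ∑ i ∈ s, f i v) w := by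
  classical
  induction s using Finset.induction_on with
  | empty => simpa using holoAt_zero w
  | insert a t ha ih =>
    simp only [Finset.sum_insert ha]
    exact (hf a (Finset.mem_insert_self a t)).add
      (ih fun i hi => hf i (Finset.mem_insert_of_mem hi))

theorem HoloAt.matrix_mul {r s t : ℕ} {A : ClosedHalfPlane → Matrix (Fin t) (Fin s) ℂ}
    {B : ClosedHalfPlane → Matrix (Fin s) (Fin r) ℂ} {w : ClosedHalfPlane}
    (hA : ∀ i j, HoloAt (fun v => A v i j) w) (hB : ∀ i j, HoloAt (fun v => B v i j) w)
    (i : Fin t) (j : Fin r) : HoloAt (fun v => (A v * B v) i j) w := by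
  simp only [Matrix.mul_apply]
  exact HoloAt.sum fun l _ => (hA i l).mul (hB l j)

/-! ## Klein surfaces -/

/-- A partial homeomorphism of the closed upper half-plane is bidianalytic if it and its inverse are
dianalytic. -/
def Bidianalytic (e : OpenPartialHomeomorph ClosedHalfPlane ClosedHalfPlane) : Prop :=
  (∀ w ∈ e.source, DianalyticAt (fun v => (e v).1) w) ∧
    ∀ w ∈ e.target, DianalyticAt (fun v => (e.symm v).1) w

theorem Bidianalytic.im_pos {e : OpenPartialHomeomorph ClosedHalfPlane ClosedHalfPlane}
    (he : Bidianalytic e) {w : ClosedHalfPlane} (hw : w ∈ e.source) :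
    ∀ᶠ v in 𝓝 w, 0 < v.1.im → 0 < (e v).1.im := by
  filter_upwards [e.open_source.mem_nhds hw] with v hv h0
  refine lt_of_le_of_ne (e v).2 fun h => h0.ne' ?_
  simpa only [e.left_inv hv] using (he.2 _ (e.map_source hv)).im_eq_zero h.symm

theorem Bidianalytic.symm {e : OpenPartialHomeomorph ClosedHalfPlane ClosedHalfPlane}
    (he : Bidianalytic e) : Bidianalytic e.symm := ⟨he.2, he.1⟩

theorem Bidianalytic.trans {e e' : OpenPartialHomeomorph ClosedHalfPlane ClosedHalfPlane}
    (he : Bidianalytic e) (he' : Bidianalytic e') : Bidianalytic (e.trans e') := by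
  have key : ∀ {e e' : OpenPartialHomeomorph ClosedHalfPlane ClosedHalfPlane},
      Bidianalytic e → Bidianalytic e' → ∀ w ∈ (e.trans e').source,
        DianalyticAt (fun v => ((e.trans e') v).1) w := by
    intro e e' he he' w hw
    rw [OpenPartialHomeomorph.trans_source] at hw
    exact (he'.1 _ hw.2).comp (e.continuousAt hw.1) (he.1 _ hw.1) (he.im_pos hw.1)
  refine ⟨key he he', fun w hw => ?_⟩
  have := key he'.symm he.symm w
  rw [← OpenPartialHomeomorph.trans_symm_eq_symm_trans_symm] at this
  exact this hw

/-- The groupoid of dianalytic changes of coordinates of the closed upper half-plane. -/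
def dianalyticGroupoid : StructureGroupoid ClosedHalfPlane where
  members := {e | Bidianalytic e}
  trans' _ _ he he' := he.trans he'
  symm' _ he := he.symm
  id_mem' := ⟨fun w _ => Or.inl (holoAt_coe w), fun w _ => Or.inl (holoAt_coe w)⟩
  locality' e h := by
    refine ⟨fun w hw => ?_, fun w hw => ?_⟩
    · obtain ⟨s, hs, hws, hm⟩ := h w hw
      exact hm.1 w (by rw [e.restr_source' s hs]; exact ⟨hw, hws⟩)
    · obtain ⟨s, hs, hws, hm⟩ := h _ (e.map_target hw)
      refine hm.2 w ?_
      rw [← (e.restr s).image_source_eq_target, e.restr_source' s hs]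
      exact ⟨e.symm w, ⟨e.map_target hw, hws⟩, e.right_inv hw⟩
  mem_of_eqOnSource' e e' he h := by
    refine ⟨fun w hw => ?_, fun w hw => ?_⟩
    · refine (he.1 w (h.1 ▸ hw)).congr ?_
      filter_upwards [e'.open_source.mem_nhds hw] with v hv
      exact congrArg Subtype.val (h.2 hv).symm
    · refine (he.2 w (h.symm'.1.subset hw)).congr ?_
      filter_upwards [e'.open_target.mem_nhds hw] with v hv
      exact congrArg Subtype.val (h.symm'.2 hv).symm

/-- A Klein surface: a Hausdorff space with an atlas of charts with values in the closed upper
half-plane whose changes of coordinates are dianalytic. -/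
class KleinSurface (S : Type*) [TopologicalSpace S] [ChartedSpace ClosedHalfPlane S] : Prop extends
  T2Space S, HasGroupoid S dianalyticGroupoid

/-- A Riemann surface: a Hausdorff space with an atlas of charts with values in `ℂ` whose changes of
coordinates are holomorphic (that is, complex analytic). It need not be connected. -/
class RiemannSurface (M : Type*) [TopologicalSpace M] [ChartedSpace ℂ M] : Prop extends
  T2Space M, IsManifold 𝓘(ℂ, ℂ) ω M

/-- A dianalytic chart of the Klein surface `S`, that is, a member of the maximal atlas. -/
def IsDianalyticChart {S : Type*} [TopologicalSpace S] [ChartedSpace ClosedHalfPlane S]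
    (φ : OpenPartialHomeomorph S ClosedHalfPlane) : Prop :=
  φ ∈ dianalyticGroupoid.maximalAtlas S

/-- An anti-holomorphic map between Riemann surfaces: it is continuous, and in local charts its
complex conjugate is holomorphic. -/
def IsAntiholomorphic {M N : Type*} [TopologicalSpace M] [ChartedSpace ℂ M] [TopologicalSpace N]
    [ChartedSpace ℂ N] (f : M → N) : Prop :=
  Continuous f ∧
    ∀ x, ContMDiffAt 𝓘(ℂ, ℂ) 𝓘(ℂ, ℂ) ω (fun y => conj (chartAt ℂ (f x) (f y))) x

/-- `(M, σ, p)` is a complex cover of the Klein surface `S`: `σ` is an anti-holomorphic involution of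
the Riemann surface `M` and `p : M → S` induces an isomorphism of Klein surfaces from `M / σ` to `S`.
The last condition means that `p` is a quotient map whose fibres are the orbits of `σ`, and that
locally, in a holomorphic chart of `M` and a dianalytic chart of `S`, the map `p` is
`a + i b ↦ a + i |b|`. -/
structure IsComplexCover {S M : Type*} [TopologicalSpace S] [ChartedSpace ClosedHalfPlane S]
    [TopologicalSpace M] [ChartedSpace ℂ M] (σ : M → M) (p : M → S) : Prop where
  involutive : Function.Involutive σ
  antiholomorphic : IsAntiholomorphic σ
  isQuotientMap : IsQuotientMap p
  fiber : ∀ x y, p x = p y ↔ x = y ∨ x = σ y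
  chart : ∀ x, ∃ z ∈ IsManifold.maximalAtlas 𝓘(ℂ, ℂ) ω M, ∃ φ : OpenPartialHomeomorph S _,
    IsDianalyticChart φ ∧ x ∈ z.source ∧ ∀ y ∈ z.source, p y ∈ φ.source ∧ φ (p y) = fold (z y)

/-! ## Dianalytic vector bundles -/

section Dianalytic

variable {S : Type*} [TopologicalSpace S]

/-- Let `T` be a map from the trivial bundle with fibre `ℂ^r` to the trivial bundle with fibre `ℂ^s`,
covering the identity of `S`. Read in the charts `φ` and `φ'` of `S` near `x`, it is a map
`(v, η) ↦ (φ' (φ⁻¹ v), T (φ⁻¹ v) η)`. This map is called dianalytic near `x` if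
* either `φ' ∘ φ⁻¹` is holomorphic and `T y η = k y • η`, where the entries of the matrix `k` are
  holomorphic in the chart `φ`,
* or `φ' ∘ φ⁻¹` is anti-holomorphic and `T y η = k y • conj η`, where the entries of the matrix `k`
  are anti-holomorphic in the chart `φ`.
In both cases `k` is real at the boundary points. -/
def DianalyticMapAt {r s : ℕ} (φ φ' : OpenPartialHomeomorph S ClosedHalfPlane)
    (T : S → (Fin r → ℂ) → (Fin s → ℂ)) (x : S) : Prop :=
  ∃ k : S → Matrix (Fin s) (Fin r) ℂ,
    (HoloAt (fun w => (φ' (φ.symm w)).1) (φ x) ∧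
      (∀ i j, HoloAt (fun w => k (φ.symm w) i j) (φ x)) ∧
      ∀ᶠ y in 𝓝 x, ∀ η, T y η = (k y).mulVec η) ∨
    (AntiAt (fun w => (φ' (φ.symm w)).1) (φ x) ∧
      (∀ i j, AntiAt (fun w => k (φ.symm w) i j) (φ x)) ∧
      ∀ᶠ y in 𝓝 x, ∀ η, T y η = (k y).mulVec (star η))

theorem map_conj_mulVec {r s : ℕ} (A : Matrix (Fin s) (Fin r) ℂ) (η : Fin r → ℂ) :
    (A.map conj).mulVec (star η) = star (A.mulVec η) := by
  ext i
  simp [Matrix.mulVec, dotProduct]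

theorem DianalyticMapAt.comp {r s t : ℕ} [ChartedSpace ClosedHalfPlane S]
    {φ₁ φ₂ φ₃ : OpenPartialHomeomorph S ClosedHalfPlane} (h₁ : IsDianalyticChart φ₁)
    (h₂ : IsDianalyticChart φ₂)
    {T : S → (Fin r → ℂ) → (Fin s → ℂ)} {T' : S → (Fin s → ℂ) → (Fin t → ℂ)} {x : S}
    (hx₁ : x ∈ φ₁.source) (hx₂ : x ∈ φ₂.source)
    (hT : DianalyticMapAt φ₁ φ₂ T x) (hT' : DianalyticMapAt φ₂ φ₃ T' x) :
    DianalyticMapAt φ₁ φ₃ (fun y η => T' y (T y η)) x := by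
  have hg : Bidianalytic (φ₁.symm.trans φ₂) :=
    dianalyticGroupoid.compatible_of_mem_maximalAtlas h₁ h₂
  have hw : φ₁ x ∈ (φ₁.symm.trans φ₂).source := by
    simp [hx₁, hx₂]
  have hi : ∀ᶠ v in 𝓝 (φ₁ x), 0 < v.1.im → 0 < (φ₂ (φ₁.symm v)).1.im := hg.im_pos hw
  have hc : ContinuousAt (fun v => φ₂ (φ₁.symm v)) (φ₁ x) := (φ₁.symm.trans φ₂).continuousAt hw
  have he : ∀ᶠ v in 𝓝 (φ₁ x), φ₂.symm (φ₂ (φ₁.symm v)) = φ₁.symm v := by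
    filter_upwards [(φ₁.symm.trans φ₂).open_source.mem_nhds hw] with v hv
    rw [OpenPartialHomeomorph.trans_source] at hv
    exact φ₂.left_inv hv.2
  have hx : φ₂ (φ₁.symm (φ₁ x)) = φ₂ x := by rw [φ₁.left_inv hx₁]
  have hcongr : ∀ g : S → ℂ, (fun v => g (φ₂.symm (φ₂ (φ₁.symm v)))) =ᶠ[𝓝 (φ₁ x)]
      fun v => g (φ₁.symm v) := fun g => he.mono fun v hv => congrArg g hv
  obtain ⟨k, hk⟩ := hT
  obtain ⟨l, hl⟩ := hT'
  have hconj : ∀ y i j, (fun y => (k y).map conj) y i j = conj (k y i j) := fun _ _ _ => rfl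
  rcases hk with ⟨a, b, c⟩ | ⟨a, b, c⟩ <;> rcases hl with ⟨a', b', c'⟩ | ⟨a', b', c'⟩ <;>
    rw [← hx] at a' b'
  · refine ⟨fun y => l y * k y, Or.inl ⟨(a'.comp hc a hi).congr (hcongr fun y => (φ₃ y).1),
      HoloAt.matrix_mul (fun i j => ((b' i j).comp hc a hi).congr (hcongr fun y => l y i j)) b, ?_⟩⟩
    filter_upwards [c, c'] with y h h' η
    rw [h, h', Matrix.mulVec_mulVec]
  · refine ⟨fun y => l y * (k y).map conj, Or.inr
      ⟨(a'.comp hc a hi).congr (hcongr fun y => (φ₃ y).1), fun i j => ?_, ?_⟩⟩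
    · have hB : ∀ i j, HoloAt (fun v => ((l (φ₁.symm v)).map conj) i j) (φ₁ x) := fun i j =>
        ((b' i j).comp hc a hi).congr (hcongr fun y => l y i j)
      refine (HoloAt.matrix_mul hB b i j).congr (Eventually.of_forall fun v => ?_)
      simp [Matrix.mul_apply]
    · filter_upwards [c, c'] with y h h' η
      rw [h, h', ← map_conj_mulVec, Matrix.mulVec_mulVec]
  · refine ⟨fun y => l y * k y, Or.inr
      ⟨(a'.comp_anti hc a hi).congr (hcongr fun y => (φ₃ y).1), fun i j => ?_, ?_⟩⟩
    · have hB : ∀ i j, HoloAt (fun v => ((l (φ₁.symm v)).map conj) i j) (φ₁ x) := fun i j =>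
        ((b' i j).comp_anti hc a hi).congr (hcongr fun y => l y i j)
      have hA : ∀ i j, HoloAt (fun v => ((k (φ₁.symm v)).map conj) i j) (φ₁ x) := b
      refine (HoloAt.matrix_mul hB hA i j).congr (Eventually.of_forall fun v => ?_)
      simp [Matrix.mul_apply]
    · filter_upwards [c, c'] with y h h' η
      rw [h, h', Matrix.mulVec_mulVec]
  · refine ⟨fun y => l y * (k y).map conj, Or.inl
      ⟨(a'.comp_anti hc a hi).congr (hcongr fun y => (φ₃ y).1), HoloAt.matrix_mul (fun i j =>
        ((b' i j).comp_anti hc a hi).congr (hcongr fun y => l y i j)) b, ?_⟩⟩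
    filter_upwards [c, c'] with y h h' η
    rw [h, h', ← map_conj_mulVec, star_star, Matrix.mulVec_mulVec]

theorem DianalyticMapAt.congr {r s : ℕ} {φ φ' : OpenPartialHomeomorph S ClosedHalfPlane}
    {T T' : S → (Fin r → ℂ) → (Fin s → ℂ)} {x : S} (hT : DianalyticMapAt φ φ' T x)
    (h : ∀ᶠ y in 𝓝 x, T y = T' y) : DianalyticMapAt φ φ' T' x := by
  obtain ⟨k, hk⟩ := hT
  refine ⟨k, hk.imp (fun ⟨a, b, c⟩ => ⟨a, b, ?_⟩) (fun ⟨a, b, c⟩ => ⟨a, b, ?_⟩)⟩ <;>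
  · filter_upwards [c, h] with y h1 h2 η
    rw [← h2, h1]

end Dianalytic

/-- A dianalytic vector bundle over the Klein surface `S`: a topological vector bundle with typical
fibre `ℂ^r`, with a family of local trivialisations over domains of dianalytic charts whose transition
maps are dianalytic: where the change of charts is holomorphic, the transition map is
`(x, η) ↦ (x, h x • η)` with `h` holomorphic, and where the change of charts is anti-holomorphic, it
is `(x, η) ↦ (x, h x • conj η)` with `h` anti-holomorphic. (The fibres are therefore real vector
spaces, which a local trivialisation makes complex.) -/
structure DianalyticBundle (S : Type*) [TopologicalSpace S] [ChartedSpace ClosedHalfPlane S] where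
  /-- the (complex) rank -/
  rank : ℕ
  /-- the fibres -/
  Fiber : S → Type
  [addCommGroup : ∀ x, AddCommGroup (Fiber x)]
  [module : ∀ x, Module ℝ (Fiber x)]
  [topologicalSpaceFiber : ∀ x, TopologicalSpace (Fiber x)]
  [topologicalSpace : TopologicalSpace (TotalSpace (Fin rank → ℂ) Fiber)]
  [fiberBundle : FiberBundle (Fin rank → ℂ) Fiber]
  [vectorBundle : VectorBundle ℝ (Fin rank → ℂ) Fiber]
  /-- the family of pairs of a chart and a local trivialisation over its domain -/
  atlas : Set (OpenPartialHomeomorph S ClosedHalfPlane ×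
    Trivialization (Fin rank → ℂ) (π (Fin rank → ℂ) Fiber))
  isDianalyticChart : ∀ a ∈ atlas, IsDianalyticChart a.1
  baseSet_eq : ∀ a ∈ atlas, a.2.baseSet = a.1.source
  isLinear : ∀ a ∈ atlas, a.2.IsLinear ℝ
  exists_mem : ∀ x, ∃ a ∈ atlas, x ∈ a.1.source
  dianalytic : ∀ a ∈ atlas, ∀ b ∈ atlas, ∀ x ∈ a.1.source ∩ b.1.source,
    DianalyticMapAt a.1 b.1 (fun y η => (b.2 ⟨y, a.2.symm y η⟩).2) x

namespace DianalyticBundle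

attribute [instance] addCommGroup module topologicalSpaceFiber topologicalSpace fiberBundle
  vectorBundle

variable {S : Type*} [TopologicalSpace S] [ChartedSpace ClosedHalfPlane S]

/-- A family of maps between the fibres of two dianalytic bundles, read in two local
trivialisations. -/
def localExpr (Q Q' : DianalyticBundle S) (f : ∀ x, Q.Fiber x →ₗ[ℝ] Q'.Fiber x)
    (ψ : Trivialization (Fin Q.rank → ℂ) (π (Fin Q.rank → ℂ) Q.Fiber))
    (ψ' : Trivialization (Fin Q'.rank → ℂ) (π (Fin Q'.rank → ℂ) Q'.Fiber)) (x : S)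
    (η : Fin Q.rank → ℂ) : Fin Q'.rank → ℂ :=
  (ψ' ⟨x, f x (ψ.symm x η)⟩).2

/-- A homomorphism of dianalytic bundles over `S`: a fibrewise linear map which is dianalytic in local
charts. -/
@[ext]
structure Hom (Q Q' : DianalyticBundle S) where
  /-- the maps between the fibres -/
  toFun : ∀ x, Q.Fiber x →ₗ[ℝ] Q'.Fiber x
  dianalytic : ∀ a ∈ Q.atlas, ∀ b ∈ Q'.atlas, ∀ x ∈ a.1.source ∩ b.1.source,
    DianalyticMapAt a.1 b.1 (localExpr Q Q' toFun a.2 b.2) x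

/-- The category of dianalytic vector bundles over `S`. -/
instance : Category (DianalyticBundle S) where
  Hom Q Q' := Hom Q Q'
  id Q := ⟨fun _ => LinearMap.id, Q.dianalytic⟩
  comp {Q Q' Q''} f g := ⟨fun x => (g.toFun x).comp (f.toFun x), fun a ha c hc x hx => by
    obtain ⟨b, hb, hxb⟩ := Q'.exists_mem x
    refine (DianalyticMapAt.comp (Q.isDianalyticChart a ha) (Q'.isDianalyticChart b hb) hx.1 hxb
      (f.dianalytic a ha b hb x ⟨hx.1, hxb⟩) (g.dianalytic b hb c hc x ⟨hxb, hx.2⟩)).congr ?_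
    filter_upwards [b.1.open_source.mem_nhds hxb] with y hy
    funext η
    rw [← Q'.baseSet_eq b hb] at hy
    simp only [localExpr, b.2.symm_apply_apply_mk hy, LinearMap.comp_apply]⟩

end DianalyticBundle

/-! ## Real holomorphic vector bundles -/

/-- A real holomorphic vector bundle over `(M, σ)`: a holomorphic vector bundle over `M` with an
(anti-holomorphic) involution of its total space which covers `σ` and is `ℂ`-antilinear in the
fibres. -/
structure RealBundle {M : Type*} [TopologicalSpace M] [ChartedSpace ℂ M] (σ : M → M) where
  /-- the rank -/
  rank : ℕ
  /-- the fibres -/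
  Fiber : M → Type
  [addCommGroup : ∀ x, AddCommGroup (Fiber x)]
  [module : ∀ x, Module ℂ (Fiber x)]
  [topologicalSpaceFiber : ∀ x, TopologicalSpace (Fiber x)]
  [topologicalSpace : TopologicalSpace (TotalSpace (Fin rank → ℂ) Fiber)]
  [fiberBundle : FiberBundle (Fin rank → ℂ) Fiber]
  [vectorBundle : VectorBundle ℂ (Fin rank → ℂ) Fiber]
  [holomorphic : ContMDiffVectorBundle ω (Fin rank → ℂ) Fiber 𝓘(ℂ, ℂ)]
  /-- the real structure, as a family of antilinear maps between the fibres -/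
  realStr : ∀ x, Fiber x →ₛₗ[starRingEnd ℂ] Fiber (σ x)
  involutive : Function.Involutive
    (fun v : TotalSpace (Fin rank → ℂ) Fiber =>
      (⟨σ v.1, realStr v.1 v.2⟩ : TotalSpace (Fin rank → ℂ) Fiber))
  antiholomorphic : ∀ v : TotalSpace (Fin rank → ℂ) Fiber,
    ContMDiffAt (𝓘(ℂ, ℂ).prod 𝓘(ℂ, Fin rank → ℂ)) 𝓘(ℂ, Fin rank → ℂ) ω
      (fun u : TotalSpace (Fin rank → ℂ) Fiber =>
        star (trivializationAt (Fin rank → ℂ) Fiber (σ v.1) ⟨σ u.1, realStr u.1 u.2⟩).2) v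

namespace RealBundle

attribute [instance] addCommGroup module topologicalSpaceFiber topologicalSpace fiberBundle
  vectorBundle holomorphic

variable {M : Type*} [TopologicalSpace M] [ChartedSpace ℂ M] {σ : M → M}

/-- The total space of a real bundle. -/
abbrev Total (E : RealBundle σ) : Type _ := TotalSpace (Fin E.rank → ℂ) E.Fiber

/-- A homomorphism of real bundles over `(M, σ)`: a homomorphism of holomorphic vector bundles over `M`
which commutes with the real structures. -/
@[ext]
structure Hom (E E' : RealBundle σ) where
  /-- the maps between the fibres -/
  toFun : ∀ x, E.Fiber x →ₗ[ℂ] E'.Fiber x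
  holomorphic : ContMDiff (𝓘(ℂ, ℂ).prod 𝓘(ℂ, Fin E.rank → ℂ)) (𝓘(ℂ, ℂ).prod 𝓘(ℂ, Fin E'.rank → ℂ)) ω
    (fun v : E.Total => (⟨v.1, toFun v.1 v.2⟩ : E'.Total))
  equivariant : ∀ x v, toFun (σ x) (E.realStr x v) = E'.realStr x (toFun x v)

/-- The category of real holomorphic vector bundles over `(M, σ)`. -/
instance : Category (RealBundle σ) where
  Hom E E' := Hom E E'
  id E := ⟨fun _ => LinearMap.id, contMDiff_id, fun _ _ => rfl⟩
  comp f g := ⟨fun x => (g.toFun x).comp (f.toFun x), g.holomorphic.comp f.holomorphic, fun x v => by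
    simp only [LinearMap.comp_apply, f.equivariant, g.equivariant]⟩

end RealBundle

/-! ## Pulling back along the complex cover -/

section Pullback

variable {S M : Type*} [TopologicalSpace S] [ChartedSpace ClosedHalfPlane S]
  [TopologicalSpace M] [ChartedSpace ℂ M]

/-- For a chart `φ` of `S`, the map `φ ∘ p` lifts along `a + i b ↦ a + i |b|` to the holomorphic
coordinate `z` on `p⁻¹` of the domain of `φ`. A point `y` not over the boundary of `S` is on the upper
sheet (that is, `Im z(y) > 0`) if and only if `φ ∘ p = z` near `y`, if and only if `φ ∘ p` is
holomorphic at `y`; on the lower sheet `φ ∘ p = conj z`. -/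
def UpperSheet (p : M → S) (φ : OpenPartialHomeomorph S ClosedHalfPlane) (y : M) : Prop :=
  MDifferentiableAt 𝓘(ℂ, ℂ) 𝓘(ℂ, ℂ) (fun y' => (φ (p y')).1) y

open Classical in
/-- A matrix on `S`, lifted to the point `y` of `M`: itself on the upper sheet of the chart `φ`, its
complex conjugate on the lower sheet. (Over the boundary of `S` the matrices to which this is applied
are real.) -/
def lift {r s : ℕ} (p : M → S) (φ : OpenPartialHomeomorph S ClosedHalfPlane)
    (k : S → Matrix (Fin s) (Fin r) ℂ) (y : M) : Matrix (Fin s) (Fin r) ℂ :=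
  if UpperSheet p φ y then k (p y) else (k (p y)).map conj

/-- The matrix of a family of fibre maps of dianalytic bundles in two local trivialisations: if the map
is `η ↦ k x • η` or `η ↦ k x • conj η` then the columns of `k x` are the images of the standard
basis. -/
def localMatrix (Q Q' : DianalyticBundle S) (f : ∀ x, Q.Fiber x →ₗ[ℝ] Q'.Fiber x)
    (ψ : Trivialization (Fin Q.rank → ℂ) (π (Fin Q.rank → ℂ) Q.Fiber))
    (ψ' : Trivialization (Fin Q'.rank → ℂ) (π (Fin Q'.rank → ℂ) Q'.Fiber)) (x : S) :
    Matrix (Fin Q'.rank) (Fin Q.rank) ℂ :=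
  Matrix.of fun i j => Q.localExpr Q' f ψ ψ' x (Pi.single j 1) i

/-- An identification of the real bundle `E` over `(M, σ)` with the pulled back bundle `p^* Q`: for each
local trivialisation `(U, ψ)` of the dianalytic bundle `Q`, a holomorphic trivialisation of `E` over
`p⁻¹ U` in which the real structure is `η ↦ conj η`, such that the transition maps are the lifts of
the transition matrices of `Q`. -/
structure PullbackFrames {σ : M → M} (p : M → S) (Q : DianalyticBundle S) (E : RealBundle σ) where
  /-- the fibre coordinate of the trivialisation (of no significance outside `p⁻¹ U`) -/
  coord : Q.atlas → ∀ y, E.Fiber y →ₗ[ℂ] (Fin Q.rank → ℂ)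
  bijective : ∀ a : Q.atlas, ∀ y, p y ∈ a.1.1.source → Function.Bijective (coord a y)
  holomorphic : ∀ a : Q.atlas,
    ContMDiffOn (𝓘(ℂ, ℂ).prod 𝓘(ℂ, Fin E.rank → ℂ)) 𝓘(ℂ, Fin Q.rank → ℂ) ω
      (fun v : E.Total => coord a v.1 v.2) {v | p v.1 ∈ a.1.1.source}
  real : ∀ a : Q.atlas, ∀ y, p y ∈ a.1.1.source → ∀ v,
    coord a (σ y) (E.realStr y v) = star (coord a y v)
  transition : ∀ a b : Q.atlas, ∀ y, p y ∈ a.1.1.source ∩ b.1.1.source → ∀ v,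
    coord b y v =
      (lift p b.1.1 (localMatrix Q Q (fun _ => LinearMap.id) a.1.2 b.1.2) y).mulVec (coord a y v)

/-- `F` is the pull-back functor `p^*` (which this determines up to a unique natural isomorphism
compatible with the identifications): `F Q` is identified with `p^* Q` for each dianalytic bundle `Q`,
and, for each homomorphism `f`, the matrix of `F f` in the resulting trivialisations is the lift of
the matrix of `f`. -/
def IsPullbackFunctor {σ : M → M} (p : M → S) (F : DianalyticBundle S ⥤ RealBundle σ) : Prop :=
  ∃ frames : ∀ Q, PullbackFrames p Q (F.obj Q),
    ∀ (Q Q' : DianalyticBundle S) (f : Q ⟶ Q') (a : Q.atlas) (b : Q'.atlas) (y : M),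
      p y ∈ a.1.1.source ∩ b.1.1.source → ∀ v,
        (frames Q').coord b y ((F.map f).toFun y v) =
          (lift p b.1.1 (localMatrix Q Q' f.toFun a.1.2 b.1.2) y).mulVec ((frames Q).coord a y v)

end Pullback

end Klein

end

noncomputable section

namespace Klein

/-! ## Reflection in the real axis -/

/-! Dianalytic data on `S` are the same thing as holomorphic data on `M` compatible with
conjugation. In suitable coordinates `p` is `fold`. A function on the closed half-plane that is
holomorphic inside and real on the axis extends by reflection to a holomorphic `G` with `G (conj z)
= conj (G z)`, and every such `G` restricts to such a function. `HoloAt.reflect` (through Morera's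
theorem) and `exists_reflected_changeOfCharts` show that every dianalytic chart of `S` lifts to a
holomorphic chart of `M` (`IsComplexCover.exists_lift`). Matrices then go up by
`IsComplexCover.contMDiffAt_lift` and come down by `IsComplexCover.dianalyticMapAt_of_equivariant`.

The conjugations in the transition maps of a dianalytic bundle follow the orientations of the
charts. Whether a change of charts is holomorphic is a cocycle with values in a group of two
elements (`holoRel_trans_iff`), and on `M` this cocycle is trivialised by `Positive`. If the
coordinates of `Q` are conjugated at the points where the chart is not positive, every dianalytic
map becomes complex linear, and its matrix is the lifted matrix (`IsComplexCover.lift_mulVec`).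
Hence lifting respects composition and identities. This gives the cocycle of the pulled back bundle,
its real structure, the functor, and faithfulness, since `p` is surjective.

For fullness, the matrix of a homomorphism of real bundles in the pull-back frames is holomorphic,
and its value at `σ y` is the conjugate of its value at `y`. The two points over a point of `S`
therefore define the same twisted map, which is dianalytic by descent.

For essential surjectivity it suffices to find local frames in which the real structure is
conjugation (`exists_realFrame`). Away from the fixed points of `σ`, a frame on a small open set is
transported by the real structure. At a fixed point a frame `e` is replaced by `c • e` plus its
conjugate, with `c` chosen so that the sum stays invertible. The transition matrices between such
frames descend to a dianalytic cocycle, and its bundle pulls back to the given one; pull-back frames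
determine a real bundle up to isomorphism (`PullbackFrames.isoOfFrames`). -/

/-- A continuous function on an open set which is complex differentiable off the real axis is
complex differentiable. -/
theorem differentiableOn_of_im_ne_zero {f : ℂ → ℂ} {U : Set ℂ} (hU : IsOpen U)
    (hc : ContinuousOn f U) (hd : ∀ z ∈ U, z.im ≠ 0 → DifferentiableAt ℂ f z) :
    DifferentiableOn ℂ f U := by
  intro c hcU
  obtain ⟨r, hr, hball⟩ := Metric.isOpen_iff.mp hU c hcU
  have hcons : Complex.IsConservativeOn f (Metric.ball c r) := by
    intro z w hzw
    rw [← add_eq_zero_iff_eq_neg, Complex.wedgeIntegral_add_wedgeIntegral_eq]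
    have hcr : ContinuousOn f (Set.uIcc z.re w.re ×ℂ Set.uIcc z.im w.im) :=
      hc.mono (hzw.trans hball)
    have hdr : ∀ u ∈ Set.uIcc z.re w.re ×ℂ Set.uIcc z.im w.im, u.im ≠ 0 →
        DifferentiableAt ℂ f u := fun u hu => hd u (hball (hzw hu))
    -- Cauchy's theorem for a rectangle needs differentiability only in the open interior, so a
    -- rectangle with an edge on the real axis is allowed.
    have half : ∀ z' w' : ℂ, z'.re = z.re → w'.re = w.re →
        Set.uIcc z'.im w'.im ⊆ Set.uIcc z.im w.im →
        (0 : ℝ) ∉ Set.Ioo (min z'.im w'.im) (max z'.im w'.im) →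
        (∫ x : ℝ in z'.re..w'.re, f (x + z'.im * Complex.I)) -
          (∫ x : ℝ in z'.re..w'.re, f (x + w'.im * Complex.I)) +
          Complex.I • (∫ y : ℝ in z'.im..w'.im, f (w'.re + y * Complex.I)) -
          Complex.I • (∫ y : ℝ in z'.im..w'.im, f (z'.re + y * Complex.I)) = 0 := by
      intro z' w' h1 h2 h3 h4
      refine Complex.integral_boundary_rect_eq_zero_of_continuousOn_of_differentiableOn f z' w'
        (hcr.mono ?_) fun u hu => (hdr u ?_ ?_).differentiableWithinAt
      · rintro u ⟨hu1, hu2⟩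
        rw [h1, h2] at hu1
        exact ⟨hu1, h3 hu2⟩
      · obtain ⟨hu1, hu2⟩ := hu
        rw [h1, h2] at hu1
        exact ⟨Set.Ioo_subset_Icc_self hu1, h3 (Set.Ioo_subset_Icc_self hu2)⟩
      · intro h0
        exact h4 (h0 ▸ hu.2)
    by_cases h0 : (0 : ℝ) ∈ Set.uIcc z.im w.im
    -- A rectangle that meets the axis is cut along it; the two integrals along the cut cancel.
    · have e1 := half z ⟨w.re, 0⟩ rfl rfl (Set.uIcc_subset_uIcc_left h0) (by
        simp only [Set.mem_Ioo, not_and, not_lt]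
        intro h; rcases min_lt_iff.mp h with h | h
        · simp [h.le]
        · exact absurd h (lt_irrefl _))
      have e2 := half ⟨z.re, 0⟩ w rfl rfl (Set.uIcc_subset_uIcc_right h0) (by
        simp only [Set.mem_Ioo, not_and, not_lt]
        intro h; rcases min_lt_iff.mp h with h | h
        · exact absurd h (lt_irrefl _)
        · simp [h.le])
      have hint : ∀ a ∈ Set.uIcc z.re w.re, ∀ b ∈ Set.uIcc z.im w.im, ∀ b' ∈ Set.uIcc z.im w.im,
          IntervalIntegrable (fun y : ℝ => f (a + y * Complex.I)) MeasureTheory.volume b b' := by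
        intro a ha b hb b' hb'
        refine ContinuousOn.intervalIntegrable (hcr.comp (by fun_prop) fun y hy => ⟨?_, ?_⟩)
        · simpa using ha
        · simpa using Set.uIcc_subset_uIcc hb hb' hy
      have i1 := intervalIntegral.integral_add_adjacent_intervals
        (hint w.re Set.right_mem_uIcc z.im Set.left_mem_uIcc 0 h0)
        (hint w.re Set.right_mem_uIcc 0 h0 w.im Set.right_mem_uIcc)
      have i2 := intervalIntegral.integral_add_adjacent_intervals
        (hint z.re Set.left_mem_uIcc z.im Set.left_mem_uIcc 0 h0)
        (hint z.re Set.left_mem_uIcc 0 h0 w.im Set.right_mem_uIcc)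
      rw [← i1, ← i2, smul_add, smul_add]
      simp only at e1 e2
      linear_combination e1 + e2
    · exact half z w rfl rfl subset_rfl fun h => h0 (Set.Ioo_subset_Icc_self h)
  -- Morera's theorem: there is a primitive on the ball, and the derivative of a holomorphic
  -- function is holomorphic.
  have hex := hcons.isExactOn_ball (hc.mono hball)
  exact ((hex.differentiableOn Metric.isOpen_ball).differentiableAt
    (Metric.ball_mem_nhds c hr)).differentiableWithinAt

open Classical in
/-- The extension of a function on the closed upper half-plane to `ℂ` by reflection. -/
def reflect (f : ClosedHalfPlane → ℂ) (z : ℂ) : ℂ :=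
  if 0 ≤ z.im then f (fold z) else conj (f (fold z))

theorem fold_conj (z : ℂ) : fold (conj z) = fold z := by
  apply Subtype.ext
  apply Complex.ext <;> simp [fold]

theorem fold_val_of_nonneg {z : ℂ} (h : 0 ≤ z.im) : (fold z).1 = z :=
  congrArg Subtype.val (fold_coe ⟨z, h⟩)

theorem fold_val_of_nonpos {z : ℂ} (h : z.im ≤ 0) : (fold z).1 = conj z := by
  rw [← fold_conj]
  exact fold_val_of_nonneg (by simpa using h)

theorem fold_im (z : ℂ) : (fold z).1.im = |z.im| := rfl

theorem fold_eq_fold {z w : ℂ} (h : fold z = fold w) : z = w ∨ z = conj w := by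
  have h1 : z.re = w.re := congrArg (fun v : ClosedHalfPlane => v.1.re) h
  have h2 : |z.im| = |w.im| := congrArg (fun v : ClosedHalfPlane => v.1.im) h
  rcases abs_eq_abs.mp h2 with h2 | h2
  · exact Or.inl (Complex.ext h1 h2)
  · exact Or.inr (Complex.ext (by simpa using h1) (by simpa using h2))

theorem im_pos_mem_nhds {z : ℂ} (h : 0 < z.im) : ∀ᶠ u in 𝓝 z, 0 < u.im :=
  (isOpen_lt continuous_const Complex.continuous_im).mem_nhds h

theorem im_neg_mem_nhds {z : ℂ} (h : z.im < 0) : ∀ᶠ u in 𝓝 z, u.im < 0 :=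
  (isOpen_lt Complex.continuous_im continuous_const).mem_nhds h

theorem reflect_eventuallyEq_of_pos (f : ClosedHalfPlane → ℂ) {z : ℂ} (h : 0 < z.im) :
    reflect f =ᶠ[𝓝 z] fun u => f (fold u) := by
  filter_upwards [im_pos_mem_nhds h] with u hu
  simp [reflect, hu.le]

theorem reflect_eventuallyEq_of_neg (f : ClosedHalfPlane → ℂ) {z : ℂ} (h : z.im < 0) :
    reflect f =ᶠ[𝓝 z] fun u => conj (f (fold u)) := by
  filter_upwards [im_neg_mem_nhds h] with u hu
  simp [reflect, hu]

/-- The Schwarz reflection principle. -/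
theorem HoloAt.reflect {f : ClosedHalfPlane → ℂ} {z : ℂ} (hf : HoloAt f (fold z)) :
    ∀ᶠ u in 𝓝 z, DifferentiableAt ℂ (reflect f) u := by
  obtain ⟨O, hO, hOo, hzO⟩ := eventually_nhds_iff.mp hf
  have hUo : IsOpen (fold ⁻¹' O) := hOo.preimage continuous_fold
  have hd : DifferentiableOn ℂ (Klein.reflect f) (fold ⁻¹' O) := by
    refine differentiableOn_of_im_ne_zero hUo (fun u hu => ContinuousAt.continuousWithinAt ?_)
      fun u hu h0 => ?_
    · have hc : ContinuousAt (fun u => f (fold u)) u :=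
        ContinuousAt.comp (hO _ hu).1 continuous_fold.continuousAt
      have hc' : ContinuousAt (fun u => conj (f (fold u))) u :=
        Complex.continuous_conj.continuousAt.comp hc
      rcases lt_trichotomy u.im 0 with h | h | h
      · exact hc'.congr (reflect_eventuallyEq_of_neg f h).symm
      · have hr : conj (f (fold u)) = f (fold u) :=
          Complex.conj_eq_iff_im.mpr ((hO _ hu).2.1 (by simp [fold_im, h]))
        have hv : Klein.reflect f u = f (fold u) := by simp [Klein.reflect, h]
        unfold ContinuousAt at hc hc' ⊢
        beta_reduce at hc hc'
        rw [hr] at hc'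
        rw [hv]
        -- At a real point both branches tend to the same limit, because `f` is real there.
        exact hc.if' hc'
      · exact hc.congr (reflect_eventuallyEq_of_pos f h).symm
    · rcases lt_or_gt_of_ne h0 with h | h
      · have h1 := (hO _ hu).2.2 (by rw [fold_im]; exact abs_pos.mpr h0)
        rw [fold_val_of_nonpos h.le] at h1
        have h2 := h1.conj_conj
        rw [Complex.conj_conj] at h2
        refine h2.congr_of_eventuallyEq ((reflect_eventuallyEq_of_neg f h).trans ?_)
        exact Eventually.of_forall fun u => by simp [fold_conj]
      · have h1 := (hO _ hu).2.2 (by rw [fold_im]; exact abs_pos.mpr h0)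
        rw [fold_val_of_nonneg h.le] at h1
        exact h1.congr_of_eventuallyEq (reflect_eventuallyEq_of_pos f h)
  filter_upwards [hUo.mem_nhds hzO] with u hu
  exact hd.differentiableAt (hUo.mem_nhds hu)

/-- The restriction of a holomorphic function to the closed upper half-plane. -/
theorem holoAt_of_differentiableAt {F : ℂ → ℂ} {w : ClosedHalfPlane}
    (hd : ∀ᶠ u in 𝓝 w.1, DifferentiableAt ℂ F u)
    (hr : ∀ᶠ v : ClosedHalfPlane in 𝓝 w, v.1.im = 0 → (F v.1).im = 0) :
    HoloAt (fun v => F v.1) w := by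
  filter_upwards [continuous_subtype_val.continuousAt.eventually hd, hr] with v h1 h2
  refine ⟨ContinuousAt.comp h1.continuousAt continuous_subtype_val.continuousAt, h2, fun h0 => ?_⟩
  refine h1.congr_of_eventuallyEq ?_
  filter_upwards [im_pos_mem_nhds h0] with u hu
  rw [fold_val_of_nonneg hu.le]

/-- The derivative along the real direction would force the complex derivative to be `1`, and along
the imaginary direction `-1`. -/
theorem not_differentiableAt_conj (z : ℂ) : ¬ DifferentiableAt ℂ (fun u : ℂ => conj u) z := by
  intro h
  have h1 : HasDerivAt (fun t : ℝ => conj (z + (t : ℂ))) (deriv (fun u : ℂ => conj u) z) 0 := by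
    have h2 : HasDerivAt (fun t : ℝ => z + (t : ℂ)) 1 0 := by
      simpa using (Complex.ofRealCLM.hasDerivAt (x := (0 : ℝ))).const_add z
    have h3 : HasDerivAt (fun u : ℂ => conj u) (deriv (fun u : ℂ => conj u) z) (z + ((0 : ℝ) : ℂ)) := by
      simpa using h.hasDerivAt
    simpa [Function.comp_def] using h3.scomp (0 : ℝ) h2
  have h1' : HasDerivAt (fun t : ℝ => conj (z + (t : ℂ))) 1 0 := by
    simp only [map_add, Complex.conj_ofReal]
    simpa using (Complex.ofRealCLM.hasDerivAt (x := (0 : ℝ))).const_add (conj z)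
  have h4 : HasDerivAt (fun t : ℝ => conj (z + (t : ℂ) * Complex.I))
      (Complex.I * deriv (fun u : ℂ => conj u) z) 0 := by
    have h2 : HasDerivAt (fun t : ℝ => z + (t : ℂ) * Complex.I) Complex.I 0 := by
      simpa using ((Complex.ofRealCLM.hasDerivAt (x := (0 : ℝ))).mul_const Complex.I).const_add z
    have h3 : HasDerivAt (fun u : ℂ => conj u) (deriv (fun u : ℂ => conj u) z)
        (z + ((0 : ℝ) : ℂ) * Complex.I) := by
      simpa using h.hasDerivAt
    simpa [Function.comp_def] using h3.scomp (0 : ℝ) h2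
  have h4' : HasDerivAt (fun t : ℝ => conj (z + (t : ℂ) * Complex.I)) (-Complex.I) 0 := by
    simp only [map_add, map_mul, Complex.conj_ofReal, Complex.conj_I]
    simpa using ((Complex.ofRealCLM.hasDerivAt (x := (0 : ℝ))).mul_const (-Complex.I)).const_add
      (conj z)
  have e1 := h1.unique h1'
  have e2 := h4.unique h4'
  rw [e1] at e2
  have := congrArg Complex.im e2
  norm_num at this

/-- Every neighbourhood of a point of the closed half-plane contains points off the real axis. -/
theorem frequently_im_pos (w : ClosedHalfPlane) : ∃ᶠ v : ClosedHalfPlane in 𝓝 w, 0 < v.1.im := by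
  intro h
  have hc : Tendsto (fun t : ℝ => fold (w.1 + (t : ℂ) * Complex.I)) (𝓝[>] 0) (𝓝 w) := by
    have h1 : Continuous (fun t : ℝ => fold (w.1 + (t : ℂ) * Complex.I)) :=
      continuous_fold.comp (by fun_prop)
    have h2 := h1.tendsto 0
    simp only [Complex.ofReal_zero, zero_mul, add_zero, fold_coe] at h2
    exact h2.mono_left nhdsWithin_le_nhds
  obtain ⟨t, ht, ht0⟩ := ((hc.eventually h).and self_mem_nhdsWithin).exists
  refine ht ?_
  change 0 < (fold _).1.im
  rw [fold_im]
  have : (0 : ℝ) < w.1.im + t := add_pos_of_nonneg_of_pos w.2 ht0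
  simpa using this.ne'

/-- Even a boundary point has interior points arbitrarily close, and there conjugation would be
complex differentiable. This makes the holomorphic and the anti-holomorphic case mutually exclusive
at the boundary too. -/
theorem not_antiAt_coe (w : ClosedHalfPlane) : ¬ AntiAt (fun v => v.1) w := by
  intro h
  obtain ⟨v, hv0, hv⟩ := ((frequently_im_pos w).and_eventually h).exists
  refine not_differentiableAt_conj v.1 ((hv.2.2 hv0).congr_of_eventuallyEq ?_)
  filter_upwards [im_pos_mem_nhds hv0] with u hu
  rw [fold_val_of_nonneg hu.le]

/-! ## Relative orientation of charts -/

section Charts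

variable {S : Type*} [TopologicalSpace S]

/-- The change of charts `φ' ∘ φ⁻¹` is holomorphic near `φ x`. -/
def HoloRel (φ φ' : OpenPartialHomeomorph S ClosedHalfPlane) (x : S) : Prop :=
  HoloAt (fun w => (φ' (φ.symm w)).1) (φ x)

/-- The change of charts `φ' ∘ φ⁻¹` is anti-holomorphic near `φ x`. -/
def AntiRel (φ φ' : OpenPartialHomeomorph S ClosedHalfPlane) (x : S) : Prop :=
  AntiAt (fun w => (φ' (φ.symm w)).1) (φ x)

variable {φ φ' φ'' : OpenPartialHomeomorph S ClosedHalfPlane} {x : S}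

theorem mem_changeOfCharts_source (hx : x ∈ φ.source) (hx' : x ∈ φ'.source) :
    φ x ∈ (φ.symm.trans φ').source := by
  simp [hx, hx']

theorem continuousAt_changeOfCharts (hx : x ∈ φ.source) (hx' : x ∈ φ'.source) :
    ContinuousAt (fun v => φ' (φ.symm v)) (φ x) :=
  (φ.symm.trans φ').continuousAt (mem_changeOfCharts_source hx hx')

theorem holoRel_refl (hx : x ∈ φ.source) : HoloRel φ φ x := by
  refine (holoAt_coe (φ x)).congr ?_
  filter_upwards [φ.open_target.mem_nhds (φ.map_source hx)] with v hv
  rw [φ.right_inv hv]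

theorem not_antiRel_refl (hx : x ∈ φ.source) : ¬ AntiRel φ φ x := by
  intro h
  refine not_antiAt_coe (φ x) (AntiAt.congr h ?_)
  filter_upwards [φ.open_target.mem_nhds (φ.map_source hx)] with v hv
  rw [φ.right_inv hv]

theorem HoloRel.eventually (hx : x ∈ φ.source) (h : HoloRel φ φ' x) :
    ∀ᶠ y in 𝓝 x, HoloRel φ φ' y :=
  (φ.continuousAt hx).eventually (HoloAt.eventually h)

theorem AntiRel.eventually (hx : x ∈ φ.source) (h : AntiRel φ φ' x) :
    ∀ᶠ y in 𝓝 x, AntiRel φ φ' y :=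
  (φ.continuousAt hx).eventually (HoloAt.eventually h)

variable [ChartedSpace ClosedHalfPlane S]

theorem bidianalytic_changeOfCharts (h : IsDianalyticChart φ) (h' : IsDianalyticChart φ') :
    Bidianalytic (φ.symm.trans φ') :=
  dianalyticGroupoid.compatible_of_mem_maximalAtlas h h'

theorem holoRel_or_antiRel (h : IsDianalyticChart φ) (h' : IsDianalyticChart φ')
    (hx : x ∈ φ.source) (hx' : x ∈ φ'.source) : HoloRel φ φ' x ∨ AntiRel φ φ' x :=
  (bidianalytic_changeOfCharts h h').1 _ (mem_changeOfCharts_source hx hx')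

theorem im_pos_changeOfCharts (h : IsDianalyticChart φ) (h' : IsDianalyticChart φ')
    (hx : x ∈ φ.source) (hx' : x ∈ φ'.source) :
    ∀ᶠ v in 𝓝 (φ x), 0 < v.1.im → 0 < (φ' (φ.symm v)).1.im :=
  (bidianalytic_changeOfCharts h h').im_pos (mem_changeOfCharts_source hx hx')

theorem im_pos_iff (h : IsDianalyticChart φ) (h' : IsDianalyticChart φ')
    (hx : x ∈ φ.source) (hx' : x ∈ φ'.source) : 0 < (φ x).1.im ↔ 0 < (φ' x).1.im := by
  constructor <;> intro h0
  · simpa [hx] using (im_pos_changeOfCharts h h' hx hx').self_of_nhds h0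
  · simpa [hx'] using (im_pos_changeOfCharts h' h hx' hx).self_of_nhds h0

/-- With `g` the coordinate of a third chart, or its conjugate, this and its anti-holomorphic
variant become the composition rules for `HoloRel` and `AntiRel`. -/
theorem HoloAt.changeOfCharts (h : IsDianalyticChart φ) (h' : IsDianalyticChart φ')
    (hx : x ∈ φ.source) (hx' : x ∈ φ'.source) (hr : HoloRel φ φ' x) {g : S → ℂ}
    (hg : HoloAt (fun w => g (φ'.symm w)) (φ' x)) : HoloAt (fun w => g (φ.symm w)) (φ x) := by
  have e : φ' (φ.symm (φ x)) = φ' x := by rw [φ.left_inv hx]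
  rw [← e] at hg
  refine (hg.comp (continuousAt_changeOfCharts hx hx') hr
    (im_pos_changeOfCharts h h' hx hx')).congr ?_
  filter_upwards [(φ.symm.trans φ').open_source.mem_nhds (mem_changeOfCharts_source hx hx')]
    with v hv
  rw [OpenPartialHomeomorph.trans_source] at hv
  rw [φ'.left_inv hv.2]

theorem HoloAt.changeOfCharts_anti (h : IsDianalyticChart φ) (h' : IsDianalyticChart φ')
    (hx : x ∈ φ.source) (hx' : x ∈ φ'.source) (hr : AntiRel φ φ' x) {g : S → ℂ}
    (hg : HoloAt (fun w => g (φ'.symm w)) (φ' x)) : AntiAt (fun w => g (φ.symm w)) (φ x) := by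
  have e : φ' (φ.symm (φ x)) = φ' x := by rw [φ.left_inv hx]
  rw [← e] at hg
  refine (hg.comp_anti (continuousAt_changeOfCharts hx hx') hr
    (im_pos_changeOfCharts h h' hx hx')).congr ?_
  filter_upwards [(φ.symm.trans φ').open_source.mem_nhds (mem_changeOfCharts_source hx hx')]
    with v hv
  rw [OpenPartialHomeomorph.trans_source] at hv
  rw [φ'.left_inv hv.2]

theorem HoloRel.trans (h : IsDianalyticChart φ) (h' : IsDianalyticChart φ')
    (hx : x ∈ φ.source) (hx' : x ∈ φ'.source) (h1 : HoloRel φ φ' x) (h2 : HoloRel φ' φ'' x) :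
    HoloRel φ φ'' x :=
  HoloAt.changeOfCharts h h' hx hx' h1 (g := fun y => (φ'' y).1) h2

theorem AntiRel.trans_holoRel (h : IsDianalyticChart φ) (h' : IsDianalyticChart φ')
    (hx : x ∈ φ.source) (hx' : x ∈ φ'.source) (h1 : AntiRel φ φ' x) (h2 : HoloRel φ' φ'' x) :
    AntiRel φ φ'' x :=
  HoloAt.changeOfCharts_anti h h' hx hx' h1 (g := fun y => (φ'' y).1) h2

theorem HoloRel.trans_antiRel (h : IsDianalyticChart φ) (h' : IsDianalyticChart φ')
    (hx : x ∈ φ.source) (hx' : x ∈ φ'.source) (h1 : HoloRel φ φ' x) (h2 : AntiRel φ' φ'' x) :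
    AntiRel φ φ'' x :=
  HoloAt.changeOfCharts h h' hx hx' h1 (g := fun y => conj (φ'' y).1) h2

theorem AntiRel.trans (h : IsDianalyticChart φ) (h' : IsDianalyticChart φ')
    (hx : x ∈ φ.source) (hx' : x ∈ φ'.source) (h1 : AntiRel φ φ' x) (h2 : AntiRel φ' φ'' x) :
    HoloRel φ φ'' x := by
  have := HoloAt.changeOfCharts_anti h h' hx hx' h1 (g := fun y => conj (φ'' y).1) h2
  simpa only [AntiAt, HoloRel, Complex.conj_conj] using this

/-- Whatever the type of the inverse change of charts, composing it with the change of the other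
type would make the identity anti-holomorphic. -/
theorem HoloRel.not_antiRel (h : IsDianalyticChart φ) (h' : IsDianalyticChart φ')
    (hx : x ∈ φ.source) (hx' : x ∈ φ'.source) (h1 : HoloRel φ φ' x) : ¬ AntiRel φ φ' x := by
  intro h2
  rcases holoRel_or_antiRel h' h hx' hx with h3 | h3
  · exact not_antiRel_refl hx (h2.trans_holoRel h h' hx hx' h3)
  · exact not_antiRel_refl hx (h1.trans_antiRel h h' hx hx' h3)

theorem not_holoRel_iff (h : IsDianalyticChart φ) (h' : IsDianalyticChart φ')
    (hx : x ∈ φ.source) (hx' : x ∈ φ'.source) : ¬ HoloRel φ φ' x ↔ AntiRel φ φ' x :=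
  ⟨(holoRel_or_antiRel h h' hx hx').resolve_left, fun h2 h1 => h1.not_antiRel h h' hx hx' h2⟩

/-- This is the cocycle rule for the relative orientation, with `↔` as the group law on two
elements. -/
theorem holoRel_trans_iff (h : IsDianalyticChart φ) (h' : IsDianalyticChart φ')
    (h'' : IsDianalyticChart φ'') (hx : x ∈ φ.source) (hx' : x ∈ φ'.source)
    (hx'' : x ∈ φ''.source) : HoloRel φ φ'' x ↔ (HoloRel φ φ' x ↔ HoloRel φ' φ'' x) := by
  by_cases h1 : HoloRel φ φ' x <;> by_cases h2 : HoloRel φ' φ'' x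
  · exact iff_of_true (h1.trans h h' hx hx' h2) (iff_of_true h1 h2)
  · have h2' := (not_holoRel_iff h' h'' hx' hx'').mp h2
    have := (not_holoRel_iff h h'' hx hx'').mpr (h1.trans_antiRel h h' hx hx' h2')
    simp [this, h1, h2]
  · have h1' := (not_holoRel_iff h h' hx hx').mp h1
    have := (not_holoRel_iff h h'' hx hx'').mpr (h1'.trans_holoRel h h' hx hx' h2)
    simp [this, h1, h2]
  · have h1' := (not_holoRel_iff h h' hx hx').mp h1
    have h2' := (not_holoRel_iff h' h'' hx' hx'').mp h2
    exact iff_of_true (h1'.trans h h' hx hx' h2') (iff_of_false h1 h2)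

theorem holoRel_comm (h : IsDianalyticChart φ) (h' : IsDianalyticChart φ')
    (hx : x ∈ φ.source) (hx' : x ∈ φ'.source) : HoloRel φ φ' x ↔ HoloRel φ' φ x := by
  have h1 := holoRel_trans_iff h h' h hx hx' hx
  have h2 := holoRel_refl (φ := φ) hx
  tauto

theorem isDianalyticChart_chartAt [KleinSurface S] (x : S) :
    IsDianalyticChart (chartAt ClosedHalfPlane x) :=
  dianalyticGroupoid.chart_mem_maximalAtlas x

end Charts

/-! ## Lifting charts to the complex cover -/

theorem fold_reflect {f : ClosedHalfPlane → ℂ} {z : ℂ} {v : ClosedHalfPlane}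
    (h : fold (f (fold z)) = v) : fold (reflect f z) = v := by
  unfold reflect
  split_ifs
  · exact h
  · rw [fold_conj, h]

theorem reflect_im_pos {f : ClosedHalfPlane → ℂ} {z : ℂ} (h : 0 < z.im) :
    (reflect f z).im = (f (fold z)).im := by
  simp [reflect, h.le]

theorem reflect_im_neg {f : ClosedHalfPlane → ℂ} {z : ℂ} (h : z.im < 0) :
    (reflect f z).im = -(f (fold z)).im := by
  simp [reflect, h.not_ge]

/-- Folding forgets only the sign of the imaginary part. -/
theorem eq_of_fold_eq {z w : ℂ} (h : fold z = fold w) (hp : 0 < w.im → 0 < z.im)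
    (hn : w.im < 0 → z.im < 0) : z = w := by
  rcases fold_eq_fold h with h | h
  · exact h
  · have him : z.im = -w.im := by rw [h]; simp
    have : w.im = 0 := by
      by_contra h0
      rcases lt_or_gt_of_ne h0 with h1 | h1
      · linarith [hn h1]
      · linarith [hp h1]
    rw [h]
    exact Complex.conj_eq_iff_im.mpr this

/-- Both a dianalytic change of charts and its inverse extend to the complex plane by reflection, as
holomorphic maps inverse to each other. -/
theorem exists_reflected_changeOfCharts {S : Type*} [TopologicalSpace S]
    [ChartedSpace ClosedHalfPlane S] {φ φ' : OpenPartialHomeomorph S ClosedHalfPlane}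
    (h : IsDianalyticChart φ) (h' : IsDianalyticChart φ') {x : S} (hx : x ∈ φ.source)
    (hx' : x ∈ φ'.source) :
    ∃ R : OpenPartialHomeomorph ℂ ℂ, DifferentiableOn ℂ R R.source ∧
      DifferentiableOn ℂ R.symm R.target ∧ (∀ z, fold z = φ x → z ∈ R.source) ∧
      ∀ z ∈ R.source, fold z ∈ φ.target ∧ φ.symm (fold z) ∈ φ'.source ∧
        fold (R z) = φ' (φ.symm (fold z)) := by
  -- A change of charts and its inverse have the same type, so a single `c`, the identity or
  -- conjugation, makes both holomorphic. Folding does not see `c`, which treats the two types at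
  -- once.
  obtain ⟨c, hc, hf0, hg0⟩ : ∃ c : ℂ → ℂ, (c = id ∨ c = conj) ∧
      HoloAt (fun w => c (φ' (φ.symm w)).1) (φ x) ∧
      HoloAt (fun w => c (φ (φ'.symm w)).1) (φ' x) := by
    rcases holoRel_or_antiRel h h' hx hx' with hr | hr
    · exact ⟨id, Or.inl rfl, hr, (holoRel_comm h h' hx hx').mp hr⟩
    · refine ⟨conj, Or.inr rfl, hr, ?_⟩
      have h1 := (not_holoRel_iff h h' hx hx').mpr hr
      rw [holoRel_comm h h' hx hx'] at h1
      exact (not_holoRel_iff h' h hx' hx).mp h1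
  set e := φ.symm.trans φ' with he
  have hbi := bidianalytic_changeOfCharts h h'
  have hxs : φ x ∈ e.source := mem_changeOfCharts_source hx hx'
  set f : ClosedHalfPlane → ℂ := fun w => c (e w).1 with hfdef
  set g : ClosedHalfPlane → ℂ := fun w => c (e.symm w).1 with hgdef
  have hcfold : ∀ w : ClosedHalfPlane, fold (c w.1) = w := by
    rcases hc with rfl | rfl <;> intro w
    · exact fold_coe w
    · rw [fold_conj, fold_coe]
  obtain ⟨O, hO, hOo, hxO⟩ := eventually_nhds_iff.mp
    (((hf0.eventually).and ((e.continuousAt hxs).eventually (by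
      have : e (φ x) = φ' x := by simp [he, hx]
      rw [this]; exact hg0.eventually))).and (e.open_source.mem_nhds hxs))
  have hfh : ∀ w ∈ O, HoloAt f w := fun w hw => (hO w hw).1.1
  have hgh : ∀ w ∈ O, HoloAt g (e w) := fun w hw => (hO w hw).1.2
  have hOs : O ⊆ e.source := fun w hw => (hO w hw).2
  have hT : IsOpen (e '' O) := e.isOpen_image_of_subset_source hOo hOs
  have hff : ∀ z, fold (reflect f z) = e (fold z) := fun z => fold_reflect (hcfold _)
  have hgf : ∀ z, fold (reflect g z) = e.symm (fold z) := fun z => fold_reflect (hcfold _)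
  -- signs of imaginary parts are preserved by a change of charts
  have hsign : ∀ e : OpenPartialHomeomorph ClosedHalfPlane ClosedHalfPlane, Bidianalytic e →
      ∀ w ∈ e.source, 0 < w.1.im → 0 < (e w).1.im := fun e he w hw h0 =>
    (he.im_pos hw).self_of_nhds h0
  have hposfold : ∀ {z : ℂ}, z.im ≠ 0 → 0 < (fold z).1.im := fun h0 => abs_pos.mpr h0
  -- The composite has the same fold as `z`, so only the half-plane must be checked. If `c` is the
  -- identity both reflected maps preserve the half-planes; if `c` is conjugation both exchange
  -- them.
  have key : ∀ e : OpenPartialHomeomorph ClosedHalfPlane ClosedHalfPlane, Bidianalytic e →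
      ∀ z, fold z ∈ e.source →
        reflect (fun w => c (e.symm w).1) (reflect (fun w => c (e w).1) z) = z := by
    intro e he z hz
    have h1 : fold (reflect (fun w => c (e w).1) z) = e (fold z) := fold_reflect (hcfold _)
    refine eq_of_fold_eq ?_ (fun h0 => ?_) (fun h0 => ?_)
    · rw [fold_reflect (v := e.symm (e (fold z))) (by rw [h1]; exact hcfold _), e.left_inv hz]
    · have h2 := hsign e he _ hz (hposfold h0.ne')
      have h3 := hsign e.symm he.symm _ (e.map_source hz) h2
      have h4 := reflect_im_pos (f := fun w => c (e w).1) h0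
      rcases hc with rfl | rfl
      · simp only [id] at h1 h4 ⊢
        rw [reflect_im_pos (by rw [h4]; exact h2), h1]
        exact h3
      · simp only [Complex.conj_im] at h1 h4 ⊢
        rw [reflect_im_neg (by rw [h4]; linarith), h1]
        simpa using h3
    · have h2 := hsign e he _ hz (hposfold h0.ne)
      have h3 := hsign e.symm he.symm _ (e.map_source hz) h2
      have h4 := reflect_im_neg (f := fun w => c (e w).1) h0
      rcases hc with rfl | rfl
      · simp only [id] at h1 h4 ⊢
        rw [reflect_im_neg (by rw [h4]; linarith), h1]
        linarith
      · simp only [Complex.conj_im] at h1 h4 ⊢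
        rw [reflect_im_pos (by rw [h4]; linarith), h1]
        simpa using h3
  have hdf : DifferentiableOn ℂ (reflect f) (fold ⁻¹' O) := fun z hz =>
    (hfh _ hz).reflect.self_of_nhds.differentiableWithinAt
  have hdg : DifferentiableOn ℂ (reflect g) (fold ⁻¹' (e '' O)) := by
    rintro z ⟨w, hw, hwz⟩
    have := hgh w hw
    rw [hwz] at this
    exact this.reflect.self_of_nhds.differentiableWithinAt
  let R : OpenPartialHomeomorph ℂ ℂ :=
    { toFun := reflect f
      invFun := reflect g
      source := fold ⁻¹' O
      target := fold ⁻¹' (e '' O)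
      map_source' := fun z hz => ⟨fold z, hz, (hff z).symm⟩
      map_target' := by
        rintro z ⟨w, hw, hwz⟩
        change fold (reflect g z) ∈ O
        rw [hgf, ← hwz, e.left_inv (hOs hw)]
        exact hw
      left_inv' := fun z hz => key e hbi z (hOs hz)
      right_inv' := by
        rintro z ⟨w, hw, hwz⟩
        have := key e.symm hbi.symm z (by rw [← hwz]; exact e.map_source (hOs hw))
        simpa using this
      open_source := hOo.preimage continuous_fold
      open_target := hT.preimage continuous_fold
      continuousOn_toFun := hdf.continuousOn
      continuousOn_invFun := hdg.continuousOn }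
  refine ⟨R, hdf, hdg, fun z hz => ?_, fun z hz => ?_⟩
  · change fold z ∈ O
    rw [hz]; exact hxO
  · have h1 := hOs hz
    rw [OpenPartialHomeomorph.trans_source] at h1
    exact ⟨h1.1, h1.2, hff z⟩

variable {S M : Type*} [TopologicalSpace S] [ChartedSpace ClosedHalfPlane S]
  [TopologicalSpace M] [ChartedSpace ℂ M] {σ : M → M} {p : M → S}

/-- The definition of a complex cover gives a holomorphic chart adapted to one dianalytic chart at
`p y`. Composing it with the reflected change of charts adapts it to any other. -/
theorem IsComplexCover.exists_lift [RiemannSurface M] (hp : IsComplexCover σ p)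
    {φ : OpenPartialHomeomorph S ClosedHalfPlane} (h : IsDianalyticChart φ) {y : M}
    (hy : p y ∈ φ.source) :
    ∃ z ∈ IsManifold.maximalAtlas 𝓘(ℂ, ℂ) ω M, y ∈ z.source ∧
      ∀ y' ∈ z.source, p y' ∈ φ.source ∧ φ (p y') = fold (z y') := by
  obtain ⟨z, hz, φ₀, h₀, hyz, hzp⟩ := hp.chart y
  obtain ⟨R, hR, hR', hRs, hRφ⟩ := exists_reflected_changeOfCharts h₀ h (hzp y hyz).1 hy
  have hcR : ContMDiffOn 𝓘(ℂ, ℂ) 𝓘(ℂ, ℂ) ω R R.source :=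
    contMDiffOn_iff_contDiffOn.mpr (hR.contDiffOn R.open_source)
  have hcR' : ContMDiffOn 𝓘(ℂ, ℂ) 𝓘(ℂ, ℂ) ω R.symm R.target :=
    contMDiffOn_iff_contDiffOn.mpr (hR'.contDiffOn R.open_target)
  refine ⟨z.trans R, OpenPartialHomeomorph.mem_maximalAtlas_of_contMDiffOn _ ?_ ?_, ?_, ?_⟩
  · rw [OpenPartialHomeomorph.trans_source]
    exact hcR.comp ((contMDiffOn_of_mem_maximalAtlas hz).mono Set.inter_subset_left)
      Set.inter_subset_right
  · rw [OpenPartialHomeomorph.trans_target]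
    exact (contMDiffOn_symm_of_mem_maximalAtlas hz).comp (hcR'.mono Set.inter_subset_left)
      Set.inter_subset_right
  · rw [OpenPartialHomeomorph.trans_source]
    exact ⟨hyz, hRs _ (hzp y hyz).2.symm⟩
  · intro y' hy'
    rw [OpenPartialHomeomorph.trans_source] at hy'
    obtain ⟨h1, h2⟩ := hzp y' hy'.1
    have h3 := hRφ _ hy'.2
    rw [← h2, φ₀.left_inv h1] at h3
    exact ⟨h3.2.1, h3.2.2.symm⟩

/-! ## Holomorphic functions on Riemann surfaces -/

theorem mdifferentiableAt_iff_of_chart {z : OpenPartialHomeomorph M ℂ}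
    (hz : z ∈ IsManifold.maximalAtlas 𝓘(ℂ, ℂ) ω M) {y : M} (hy : y ∈ z.source) {g : M → ℂ} :
    MDifferentiableAt 𝓘(ℂ, ℂ) 𝓘(ℂ, ℂ) g y ↔ DifferentiableAt ℂ (fun u => g (z.symm u)) (z y) := by
  have hz1 := IsManifold.maximalAtlas_subset_of_le (m := 1) le_top hz
  constructor <;> intro h
  · rw [← mdifferentiableAt_iff_differentiableAt]
    have h1 := mdifferentiableAt_symm_of_mem_maximalAtlas hz1 (z.map_source hy)
    exact MDifferentiableAt.comp (z y) (by rwa [z.left_inv hy]) h1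
  · rw [← mdifferentiableAt_iff_differentiableAt] at h
    have h1 := mdifferentiableAt_of_mem_maximalAtlas hz1 hy
    refine (MDifferentiableAt.comp y h h1).congr_of_eventuallyEq ?_
    filter_upwards [z.open_source.mem_nhds hy] with y' hy'
    simp [z.left_inv hy']

/-- With `z` a chart at `σ y`, the function is the composite of `conj ∘ g ∘ z.symm ∘ conj` and `conj
∘ z ∘ σ`, both holomorphic. -/
theorem mdifferentiableAt_conj_comp_antiholomorphic [RiemannSurface M] (hσ : IsAntiholomorphic σ)
    {g : M → ℂ} {y : M} (hg : MDifferentiableAt 𝓘(ℂ, ℂ) 𝓘(ℂ, ℂ) g (σ y)) :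
    MDifferentiableAt 𝓘(ℂ, ℂ) 𝓘(ℂ, ℂ) (fun y' => conj (g (σ y'))) y := by
  set z := chartAt ℂ (σ y)
  have hz : z ∈ IsManifold.maximalAtlas 𝓘(ℂ, ℂ) ω M := IsManifold.chart_mem_maximalAtlas _
  have h1 := ((mdifferentiableAt_iff_of_chart hz (mem_chart_source ℂ (σ y))).mp hg).conj_conj
  have h2 := (hσ.2 y).mdifferentiableAt (by simp)
  rw [← mdifferentiableAt_iff_differentiableAt] at h1
  refine (MDifferentiableAt.comp y h1 h2).congr_of_eventuallyEq ?_
  filter_upwards [hσ.1.continuousAt.eventually (z.open_source.mem_nhds (mem_chart_source ℂ (σ y)))]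
    with y' hy'
  simp [Function.comp_def, z, z.left_inv hy']

/-- Below the axis `fold` is conjugation, and across the axis its imaginary part is the absolute
value along a vertical line; neither is differentiable. -/
theorem differentiableAt_fold_iff {a : ℂ} :
    DifferentiableAt ℂ (fun u => (fold u).1) a ↔ 0 < a.im := by
  constructor
  · intro h
    rcases lt_trichotomy a.im 0 with h0 | h0 | h0
    · refine absurd (h.congr_of_eventuallyEq ?_) (not_differentiableAt_conj a)
      filter_upwards [im_neg_mem_nhds h0] with u hu
      exact (fold_val_of_nonpos hu.le).symm
    · refine absurd ?_ not_differentiableAt_abs_zero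
      have h1 : DifferentiableAt ℝ (fun u : ℂ => (fold u).1.im) a :=
        Complex.imCLM.differentiableAt.comp a (h.restrictScalars ℝ)
      have h2 : DifferentiableAt ℝ (fun t : ℝ => a + (t : ℂ) * Complex.I) 0 :=
        ((Complex.ofRealCLM.differentiableAt (x := (0 : ℝ))).mul_const _).const_add _
      have h3 : DifferentiableAt ℝ (fun u : ℂ => (fold u).1.im)
          ((fun t : ℝ => a + (t : ℂ) * Complex.I) 0) := by simpa using h1
      refine (h3.comp (0 : ℝ) h2).congr_of_eventuallyEq (Eventually.of_forall fun t => ?_)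
      simp [fold, h0]
    · exact h0
  · intro h
    refine differentiableAt_id.congr_of_eventuallyEq ?_
    filter_upwards [im_pos_mem_nhds h] with u hu
    exact fold_val_of_nonneg hu.le

/-- In an adapted chart `φ ∘ p` is `fold`, so the intrinsic definition of the upper sheet agrees
with the sign of the lifted coordinate. The boundary is never on the upper sheet. -/
theorem upperSheet_iff_im_pos {S : Type*} [TopologicalSpace S] {p : M → S}
    {φ : OpenPartialHomeomorph S ClosedHalfPlane}
    {z : OpenPartialHomeomorph M ℂ} (hz : z ∈ IsManifold.maximalAtlas 𝓘(ℂ, ℂ) ω M)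
    (hzp : ∀ y ∈ z.source, p y ∈ φ.source ∧ φ (p y) = fold (z y)) {y : M} (hy : y ∈ z.source) :
    UpperSheet p φ y ↔ 0 < (z y).im := by
  unfold UpperSheet
  rw [mdifferentiableAt_iff_of_chart hz hy, ← differentiableAt_fold_iff]
  refine Filter.EventuallyEq.differentiableAt_iff ?_
  filter_upwards [z.open_target.mem_nhds (z.map_source hy)] with u hu
  rw [(hzp _ (z.map_target hu)).2, z.right_inv hu]

/-! ## The sheets of the complex cover -/

theorem im_eq_zero_or_pos {S : Type*} [TopologicalSpace S]
    (φ : OpenPartialHomeomorph S ClosedHalfPlane) (x : S) :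
    (φ x).1.im = 0 ∨ 0 < (φ x).1.im := (φ x).2.eq_or_lt'

theorem map_conj_map_conj (A : Matrix (Fin s) (Fin r) ℂ) : (A.map conj).map conj = A := by
  ext i j
  simp

section Sheets

variable {S M : Type*} [TopologicalSpace S] [ChartedSpace ClosedHalfPlane S]
  [TopologicalSpace M] [ChartedSpace ℂ M] {σ : M → M} {p : M → S}
  {φ φ' : OpenPartialHomeomorph S ClosedHalfPlane} {y : M}

namespace IsComplexCover

theorem apply_involution (hp : IsComplexCover σ p) (y : M) : p (σ y) = p y :=
  (hp.fiber _ _).mpr (Or.inr rfl)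

theorem continuous (hp : IsComplexCover σ p) : Continuous p := hp.isQuotientMap.continuous

theorem surjective (hp : IsComplexCover σ p) : Function.Surjective p := hp.isQuotientMap.surjective

theorem continuous_involution (hp : IsComplexCover σ p) : Continuous σ := hp.antiholomorphic.1

theorem isOpenMap (hp : IsComplexCover σ p) : IsOpenMap p := by
  intro U hU
  rw [← hp.isQuotientMap.isOpen_preimage]
  have : p ⁻¹' (p '' U) = U ∪ σ ⁻¹' U := by
    ext y
    constructor
    · rintro ⟨u, hu, huy⟩
      rcases (hp.fiber _ _).mp huy with rfl | rfl
      · exact Or.inl hu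
      · exact Or.inr hu
    · rintro (hu | hu)
      · exact ⟨y, hu, rfl⟩
      · exact ⟨σ y, hu, hp.apply_involution y⟩
  rw [this]
  exact hU.union (hU.preimage hp.continuous_involution)

theorem upperSheet_im_pos [RiemannSurface M] (hp : IsComplexCover σ p) (h : IsDianalyticChart φ)
    (hy : p y ∈ φ.source) (hu : UpperSheet p φ y) : 0 < (φ (p y)).1.im := by
  obtain ⟨z, hz, hyz, hzp⟩ := hp.exists_lift h hy
  rw [upperSheet_iff_im_pos hz hzp hyz] at hu
  rw [(hzp y hyz).2, fold_im]
  exact abs_pos.mpr hu.ne'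

/-- If both points were upper, pulling back by `σ` would make the conjugate of `φ ∘ p` holomorphic
where `φ ∘ p` is itself a coordinate. If both were lower, the conjugate of `φ ∘ p` is holomorphic at
`σ y`, so `φ ∘ p` would be holomorphic at `y`. -/
theorem upperSheet_involution_iff [RiemannSurface M] (hp : IsComplexCover σ p)
    (h : IsDianalyticChart φ) (hy : p y ∈ φ.source) (h0 : 0 < (φ (p y)).1.im) :
    UpperSheet p φ (σ y) ↔ ¬ UpperSheet p φ y := by
  have hcomp : (fun y' => conj (φ (p (σ y'))).1) = fun y' => conj (φ (p y')).1 := by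
    funext y'
    rw [hp.apply_involution]
  constructor
  · intro h1 h2
    have h3 := mdifferentiableAt_conj_comp_antiholomorphic hp.antiholomorphic h1
    rw [hcomp] at h3
    obtain ⟨z, hz, hyz, hzp⟩ := hp.exists_lift h hy
    rw [upperSheet_iff_im_pos hz hzp hyz] at h2
    rw [mdifferentiableAt_iff_of_chart hz hyz] at h3
    refine not_differentiableAt_conj (z y) (h3.congr_of_eventuallyEq ?_)
    filter_upwards [z.open_target.mem_nhds (z.map_source hyz), im_pos_mem_nhds h2] with u hu hu0
    rw [(hzp _ (z.map_target hu)).2, z.right_inv hu, fold_val_of_nonneg hu0.le]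
  · intro h2
    by_contra h1
    refine h2 ?_
    have hy' : p (σ y) ∈ φ.source := by rwa [hp.apply_involution]
    obtain ⟨z, hz, hyz, hzp⟩ := hp.exists_lift h hy'
    rw [upperSheet_iff_im_pos hz hzp hyz] at h1
    have h3 : (z (σ y)).im < 0 := by
      refine lt_of_le_of_ne (not_lt.mp h1) fun h3 => h0.ne' ?_
      rw [← hp.apply_involution, (hzp _ hyz).2, fold_im, h3, abs_zero]
    have h4 : MDifferentiableAt 𝓘(ℂ, ℂ) 𝓘(ℂ, ℂ) (fun y' => conj (φ (p y')).1) (σ y) := by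
      rw [mdifferentiableAt_iff_of_chart hz hyz]
      refine differentiableAt_id.congr_of_eventuallyEq ?_
      filter_upwards [z.open_target.mem_nhds (z.map_source hyz), im_neg_mem_nhds h3] with u hu hu0
      rw [(hzp _ (z.map_target hu)).2, z.right_inv hu, fold_val_of_nonpos hu0.le, Complex.conj_conj]
      rfl
    have h5 := mdifferentiableAt_conj_comp_antiholomorphic hp.antiholomorphic h4
    simpa only [hp.apply_involution, Complex.conj_conj, UpperSheet] using h5

/-- Near a boundary point, the points with coordinates `u` and `conj u` have the same image under
`p`, so for `u` off the axis `σ` exchanges them. If `σ y` differed from `y`, disjoint neighbourhoods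
of the two would contradict this as `u` approaches the axis. -/
theorem involution_eq_self [RiemannSurface M] (hp : IsComplexCover σ p) (h : IsDianalyticChart φ)
    (hy : p y ∈ φ.source) (h0 : (φ (p y)).1.im = 0) : σ y = y := by
  by_contra hne
  obtain ⟨z, hz, hyz, hzp⟩ := hp.exists_lift h hy
  have hzr : conj (z y) = z y := by
    rw [(hzp y hyz).2, fold_im, abs_eq_zero] at h0
    exact Complex.conj_eq_iff_im.mpr h0
  obtain ⟨D, D', hD, hD', hyD, hyD', hdisj⟩ := t2_separation hne
  have hN : D' ∩ σ ⁻¹' D ∈ 𝓝 y :=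
    (hD'.inter (hD.preimage hp.continuous_involution)).mem_nhds ⟨hyD', hyD⟩
  have hN1 : ∀ᶠ u in 𝓝 (z y), u ∈ z.target ∧ z.symm u ∈ D' ∩ σ ⁻¹' D :=
    (z.open_target.eventually_mem (z.map_source hyz)).and
      ((z.symm.continuousAt (z.map_source hyz)).eventually (by rwa [z.left_inv hyz]))
  have hN2 : ∀ᶠ u in 𝓝 (z y), conj u ∈ z.target ∧ z.symm (conj u) ∈ D' ∩ σ ⁻¹' D :=
    Complex.continuous_conj.continuousAt.eventually (by rwa [hzr])
  obtain ⟨v, hv0, hv1, hv2⟩ := ((frequently_im_pos ⟨z y, (Complex.conj_eq_iff_im.mp hzr).ge⟩).and_eventually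
    (continuous_subtype_val.continuousAt.eventually (hN1.and hN2))).exists
  have e1 := hzp _ (z.map_target hv1.1)
  have e2 := hzp _ (z.map_target hv2.1)
  rw [z.right_inv hv1.1] at e1
  rw [z.right_inv hv2.1, fold_conj] at e2
  have e3 := φ.injOn e1.1 e2.1 (e1.2.trans e2.2.symm)
  rcases (hp.fiber _ _).mp e3 with e4 | e4
  · have e5 := z.symm.injOn hv1.1 hv2.1 e4
    have e6 : v.1.im = 0 := Complex.conj_eq_iff_im.mp e5.symm
    exact hv0.ne' e6
  · have e5 : z.symm v.1 ∈ D := by rw [e4]; exact hv2.2.2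
    exact Set.disjoint_left.mp hdisj e5 hv1.2.1

/-- The relation between the sheets of two charts with holomorphic change of charts. -/
theorem upperSheet_of_holoRel [RiemannSurface M] (hp : IsComplexCover σ p)
    (h : IsDianalyticChart φ) (hy : p y ∈ φ.source) (hr : HoloRel φ φ' (p y)) (hu : UpperSheet p φ y) :
    UpperSheet p φ' y := by
  obtain ⟨z, hz, hyz, hzp⟩ := hp.exists_lift h hy
  have hu' := (upperSheet_iff_im_pos hz hzp hyz).mp hu
  have h1 : φ (p y) = ⟨z y, hu'.le⟩ := by
    rw [(hzp y hyz).2]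
    exact fold_coe ⟨z y, hu'.le⟩
  have h2 := hr.self_of_nhds.2.2 (hp.upperSheet_im_pos h hy hu)
  rw [h1] at h2
  unfold UpperSheet
  rw [mdifferentiableAt_iff_of_chart hz hyz]
  refine h2.congr_of_eventuallyEq ?_
  filter_upwards [z.open_target.mem_nhds (z.map_source hyz)] with u hu
  obtain ⟨h3, h4⟩ := hzp _ (z.map_target hu)
  rw [z.right_inv hu] at h4
  rw [← h4, φ.left_inv h3]

theorem upperSheet_iff_of_holoRel [RiemannSurface M] (hp : IsComplexCover σ p)
    (h : IsDianalyticChart φ) (h' : IsDianalyticChart φ') (hy : p y ∈ φ.source)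
    (hy' : p y ∈ φ'.source) (hr : HoloRel φ φ' (p y)) :
    UpperSheet p φ y ↔ UpperSheet p φ' y :=
  ⟨hp.upperSheet_of_holoRel h hy hr,
    hp.upperSheet_of_holoRel h' hy' ((holoRel_comm h h' hy hy').mp hr)⟩

/-- On the upper sheet of `φ` the conjugate of `φ' ∘ p` is holomorphic, while on the upper sheet of
`φ'` the map `φ' ∘ p` is a coordinate. -/
theorem not_upperSheet_of_antiRel [RiemannSurface M] (hp : IsComplexCover σ p)
    (h : IsDianalyticChart φ) (h' : IsDianalyticChart φ') (hy : p y ∈ φ.source)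
    (hy' : p y ∈ φ'.source) (hr : AntiRel φ φ' (p y)) (hu : UpperSheet p φ y) :
    ¬ UpperSheet p φ' y := by
  intro hu'
  obtain ⟨z, hz, hyz, hzp⟩ := hp.exists_lift h hy
  obtain ⟨z', hz', hyz', hzp'⟩ := hp.exists_lift h' hy'
  have h0 := hp.upperSheet_im_pos h hy hu
  have hu1 := (upperSheet_iff_im_pos hz hzp hyz).mp hu
  have hu2 := (upperSheet_iff_im_pos hz' hzp' hyz').mp hu'
  have h1 : φ (p y) = ⟨z y, hu1.le⟩ := by
    rw [(hzp y hyz).2]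
    exact fold_coe ⟨z y, hu1.le⟩
  have h2 := hr.self_of_nhds.2.2 h0
  rw [h1] at h2
  have h3 : MDifferentiableAt 𝓘(ℂ, ℂ) 𝓘(ℂ, ℂ) (fun y => conj (φ' (p y)).1) y := by
    rw [mdifferentiableAt_iff_of_chart hz hyz]
    refine h2.congr_of_eventuallyEq ?_
    filter_upwards [z.open_target.mem_nhds (z.map_source hyz)] with u hu
    obtain ⟨h3, h4⟩ := hzp _ (z.map_target hu)
    rw [z.right_inv hu] at h4
    rw [← h4, φ.left_inv h3]
  rw [mdifferentiableAt_iff_of_chart hz' hyz'] at h3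
  refine not_differentiableAt_conj (z' y) (h3.congr_of_eventuallyEq ?_)
  filter_upwards [z'.open_target.mem_nhds (z'.map_source hyz'), im_pos_mem_nhds hu2] with u hu hu0
  rw [(hzp' _ (z'.map_target hu)).2, z'.right_inv hu, fold_val_of_nonneg hu0.le]

/-- If `y` were on the lower sheet of both charts, `σ y` would be on the upper sheet of both. Over
the boundary the equivalence fails, as neither chart has an upper sheet there. -/
theorem upperSheet_iff_of_antiRel [RiemannSurface M] (hp : IsComplexCover σ p)
    (h : IsDianalyticChart φ) (h' : IsDianalyticChart φ') (hy : p y ∈ φ.source)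
    (hy' : p y ∈ φ'.source) (hr : AntiRel φ φ' (p y)) (h0 : 0 < (φ (p y)).1.im) :
    UpperSheet p φ y ↔ ¬ UpperSheet p φ' y := by
  refine ⟨hp.not_upperSheet_of_antiRel h h' hy hy' hr, fun hu' => ?_⟩
  by_contra hu
  have h0' : 0 < (φ' (p y)).1.im := (im_pos_iff h h' hy hy').mp h0
  rw [← hp.upperSheet_involution_iff h' hy' h0'] at hu'
  rw [← hp.upperSheet_involution_iff h hy h0] at hu
  refine hp.not_upperSheet_of_antiRel h h' (y := σ y) ?_ ?_ ?_ hu hu' <;>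
    rwa [hp.apply_involution]

end IsComplexCover

section

namespace IsComplexCover

variable [RiemannSurface M]

/-! ## Lifting functions and matrices -/

/-- In the adapted coordinate the lifted entry is the reflection of the entry read in `φ`. -/
theorem contMDiffAt_lift_of_holoAt (hp : IsComplexCover σ p) (h : IsDianalyticChart φ)
    (hy : p y ∈ φ.source) {r s : ℕ} {k : S → Matrix (Fin s) (Fin r) ℂ} {i : Fin s} {j : Fin r}
    (hk : HoloAt (fun w => k (φ.symm w) i j) (φ (p y))) :
    ContMDiffAt 𝓘(ℂ, ℂ) 𝓘(ℂ, ℂ) ω (fun y' => lift p φ k y' i j) y := by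
  obtain ⟨z, hz, hyz, hzp⟩ := hp.exists_lift h hy
  have hk' : HoloAt (fun w => k (φ.symm w) i j) (fold (z y)) := by rwa [← (hzp y hyz).2]
  have h1 : ContMDiffAt 𝓘(ℂ, ℂ) 𝓘(ℂ, ℂ) ω (reflect fun w => k (φ.symm w) i j) (z y) :=
    (Complex.analyticAt_iff_eventually_differentiableAt.mpr hk'.reflect).contDiffAt.contMDiffAt
  refine (h1.comp y (contMDiffAt_of_mem_maximalAtlas hz hyz)).congr_of_eventuallyEq ?_
  filter_upwards [z.open_source.mem_nhds hyz,
    (continuous_fold.continuousAt.comp (z.continuousAt hyz)).eventually hk'] with y' hy' hk1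
  obtain ⟨h2, h3⟩ := hzp y' hy'
  have h4 : φ.symm (fold (z y')) = p y' := by rw [← h3, φ.left_inv h2]
  have hr := hk1.2.1
  simp only [lift, Function.comp_def, reflect, upperSheet_iff_im_pos hz hzp hy', h4, fold_im,
    abs_eq_zero] at hr ⊢
  rcases lt_trichotomy (z y').im 0 with h0 | h0 | h0
  · simp [h0.not_ge, h0.not_gt]
  -- On the axis `lift` takes the conjugated branch and `reflect` the other one; they agree because
  -- the entry is real.
  · simpa [h0] using Complex.conj_eq_iff_im.mpr (hr h0)
  · simp [h0, h0.le]

/-- The matrix is holomorphic or anti-holomorphic in the source chart but is lifted along the target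
chart. When the change of charts is anti-holomorphic the sheets are exchanged, and the lift along
`φ'` is the lift along `φ` of the conjugate matrix, which is holomorphic in `φ`. -/
theorem contMDiffAt_lift (hp : IsComplexCover σ p) (h : IsDianalyticChart φ)
    (h' : IsDianalyticChart φ') (hy : p y ∈ φ.source) (hy' : p y ∈ φ'.source) {r s : ℕ}
    {T : S → (Fin r → ℂ) → (Fin s → ℂ)} (hT : DianalyticMapAt φ φ' T (p y)) (i : Fin s)
    (j : Fin r) :
    ContMDiffAt 𝓘(ℂ, ℂ) 𝓘(ℂ, ℂ) ω
      (fun y' => lift p φ' (fun x => Matrix.of fun i j => T x (Pi.single j 1) i) y' i j) y := by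
  have hsrc : ∀ᶠ y' in 𝓝 y, p y' ∈ φ.source ∧ p y' ∈ φ'.source :=
    hp.continuous.continuousAt.eventually
      ((φ.open_source.eventually_mem hy).and (φ'.open_source.eventually_mem hy'))
  obtain ⟨k, ⟨hr, hk, hTk⟩ | ⟨hr, hk, hTk⟩⟩ := hT
  · refine (hp.contMDiffAt_lift_of_holoAt h hy (hk i j)).congr_of_eventuallyEq ?_
    filter_upwards [hsrc, hp.continuous.continuousAt.eventually hTk,
      hp.continuous.continuousAt.eventually (HoloRel.eventually hy hr)] with y' hy1 hy2 hy3
    have h1 := hp.upperSheet_iff_of_holoRel h h' hy1.1 hy1.2 hy3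
    simp only [lift, hy2]
    split_ifs <;> first | (exfalso; tauto) | simp
  · refine (hp.contMDiffAt_lift_of_holoAt h hy (k := fun x => (k x).map conj)
      (hk i j)).congr_of_eventuallyEq ?_
    have hreal := (φ.continuousAt hy).eventually (hk i j)
    filter_upwards [hsrc, hp.continuous.continuousAt.eventually hTk,
      hp.continuous.continuousAt.eventually (AntiRel.eventually hy hr),
      hp.continuous.continuousAt.eventually hreal] with y' hy1 hy2 hy3 hy4
    rcases im_eq_zero_or_pos φ (p y') with h0 | h0
    · have h1 := hy4.2.1 h0
      rw [φ.left_inv hy1.1] at h1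
      have h2 : conj (k (p y') i j) = k (p y') i j := by
        rw [Complex.conj_im, neg_eq_zero] at h1
        exact Complex.conj_eq_iff_im.mpr h1
      simp only [lift, hy2]
      split_ifs <;> simp [h2]
    · have h1 := hp.upperSheet_iff_of_antiRel h h' hy1.1 hy1.2 hy3 h0
      simp only [lift, hy2]
      split_ifs <;> first | (exfalso; tauto) | simp

/-- Over the interior `σ` exchanges the sheets; over the boundary `σ` fixes the point and the matrix
is real. -/
theorem lift_real (hp : IsComplexCover σ p) (h : IsDianalyticChart φ)
    (h' : IsDianalyticChart φ') (hy : p y ∈ φ.source) (hy' : p y ∈ φ'.source)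
    {T : S → (Fin r → ℂ) → (Fin s → ℂ)} (hT : DianalyticMapAt φ φ' T (p y)) :
    lift p φ' (fun x => Matrix.of fun i j => T x (Pi.single j 1) i) (σ y) =
      (lift p φ' (fun x => Matrix.of fun i j => T x (Pi.single j 1) i) y).map conj := by
  rcases im_eq_zero_or_pos φ' (p y) with h0 | h0
  · have h1 := hp.involution_eq_self h' hy' h0
    rw [h1]
    have h2 : ¬ UpperSheet p φ' y := fun hu => (hp.upperSheet_im_pos h' hy' hu).ne' h0
    obtain ⟨k, hk⟩ := hT
    have h0' : (φ (p y)).1.im = 0 := by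
      have := im_pos_iff h h' hy hy'
      rw [h0, lt_self_iff_false, iff_false, not_lt] at this
      exact le_antisymm this (φ (p y)).2
    ext i j
    simp only [lift, h2, if_false, Matrix.map_apply, Matrix.of_apply]
    rw [Complex.conj_conj]
    rcases hk with ⟨-, hk, hTk⟩ | ⟨-, hk, hTk⟩ <;>
    · have := (hk i j).self_of_nhds.2.1 h0'
      simp only [φ.left_inv hy, Complex.conj_im, neg_eq_zero] at this
      rw [hTk.self_of_nhds]
      simpa using Complex.conj_eq_iff_im.mpr this
  · have h1 := hp.upperSheet_involution_iff h' hy' h0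
    simp only [lift, hp.apply_involution]
    split_ifs <;> first | (exfalso; tauto) | simp only [map_conj_map_conj]

end IsComplexCover

end

/-! ## Orientations -/

/-- The chart `φ` of `S` at `p y` is positively oriented with respect to `y`. For a point `y` which
does not lie over the boundary of `S` this says that `y` is on the upper sheet of `φ`; over the
boundary the orientations are measured against the preferred chart of `S` at `p y`. -/
def Positive (p : M → S) (φ : OpenPartialHomeomorph S ClosedHalfPlane) (y : M) : Prop :=
  HoloRel (chartAt ClosedHalfPlane (p y)) φ (p y) ↔
    UpperSheet p (chartAt ClosedHalfPlane (p y)) y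

/-- `UpperSheet` is false for every chart over the boundary, so it cannot follow changes of
orientation there. `Positive` obeys the orientation rule at every point, which removes the boundary
case from most later arguments. -/
theorem positive_iff_of_holoRel [KleinSurface S] (h : IsDianalyticChart φ)
    (h' : IsDianalyticChart φ') (hy : p y ∈ φ.source) (hy' : p y ∈ φ'.source)
    (hr : HoloRel φ φ' (p y)) : Positive p φ' y ↔ Positive p φ y := by
  have h1 := holoRel_trans_iff (isDianalyticChart_chartAt (p y)) h h' (mem_chart_source _ _) hy hy'
  unfold Positive
  tauto

theorem positive_iff_of_antiRel [KleinSurface S] (h : IsDianalyticChart φ)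
    (h' : IsDianalyticChart φ') (hy : p y ∈ φ.source) (hy' : p y ∈ φ'.source)
    (hr : AntiRel φ φ' (p y)) : Positive p φ' y ↔ ¬ Positive p φ y := by
  have h1 := holoRel_trans_iff (isDianalyticChart_chartAt (p y)) h h' (mem_chart_source _ _) hy hy'
  have h2 := (not_holoRel_iff h h' hy hy').mpr hr
  unfold Positive
  tauto

variable [KleinSurface S] [RiemannSurface M]

namespace IsComplexCover

theorem positive_iff_upperSheet (hp : IsComplexCover σ p) (h : IsDianalyticChart φ)
    (hy : p y ∈ φ.source) (h0 : 0 < (φ (p y)).1.im) : Positive p φ y ↔ UpperSheet p φ y := by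
  have hr := isDianalyticChart_chartAt (p y)
  have hs := mem_chart_source ClosedHalfPlane (p y)
  unfold Positive
  by_cases h1 : HoloRel (chartAt ClosedHalfPlane (p y)) φ (p y)
  · rw [← hp.upperSheet_iff_of_holoRel hr h hs hy h1]
    tauto
  · have h2 := (not_holoRel_iff hr h hs hy).mp h1
    have := hp.upperSheet_iff_of_antiRel hr h hs hy h2 ((im_pos_iff h hr hy hs).mp h0)
    tauto

theorem positive_involution_iff (hp : IsComplexCover σ p) (h : IsDianalyticChart φ)
    (hy : p y ∈ φ.source) (h0 : 0 < (φ (p y)).1.im) : Positive p φ (σ y) ↔ ¬ Positive p φ y := by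
  rw [hp.positive_iff_upperSheet h hy h0, ← hp.upperSheet_involution_iff h hy h0]
  refine hp.positive_iff_upperSheet h ?_ ?_ <;> rwa [hp.apply_involution]

end IsComplexCover

open Classical in
/-- The identity if `P` holds, complex conjugation otherwise. -/
def twist (P : Prop) {r : ℕ} : (Fin r → ℂ) ≃L[ℝ] (Fin r → ℂ) :=
  if P then ContinuousLinearEquiv.refl ℝ _ else starL' ℝ

theorem twist_of_true {P : Prop} (hP : P) {r : ℕ} (η : Fin r → ℂ) : twist P η = η := by
  simp [twist, hP]

theorem twist_of_false {P : Prop} (hP : ¬ P) {r : ℕ} (η : Fin r → ℂ) : twist P η = star η := by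
  simp [twist, hP]

@[simp]
theorem twist_twist (P : Prop) {r : ℕ} (η : Fin r → ℂ) : twist P (twist P η) = η := by
  by_cases hP : P
  · simp only [twist_of_true hP]
  · simp only [twist_of_false hP, star_star]

end Sheets

/-! ### Descent of equivariant functions and matrices to the Klein surface -/

section Descent

variable {S M : Type*} [TopologicalSpace S] [ChartedSpace ClosedHalfPlane S] [KleinSurface S]
  [TopologicalSpace M] [ChartedSpace ℂ M] [RiemannSurface M] {σ : M → M} {p : M → S}
  {φ φ' : OpenPartialHomeomorph S ClosedHalfPlane} {y : M} {r s : ℕ}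

theorem star_single (j : Fin r) : star (Pi.single j 1 : Fin r → ℂ) = Pi.single j 1 := by
  rw [← Pi.single_star, star_one]

theorem twist_not (P : Prop) (η : Fin r → ℂ) : twist (¬ P) η = star (twist P η) := by
  by_cases hP : P
  · rw [twist_of_true hP, twist_of_false (not_not.mpr hP)]
  · rw [twist_of_false hP, twist_of_true hP, star_star]

theorem twist_star (P : Prop) (η : Fin r → ℂ) : twist P (star η) = star (twist P η) := by
  by_cases hP : P
  · simp only [twist_of_true hP]
  · simp only [twist_of_false hP]

theorem map_conj_mulVec' (A : Matrix (Fin s) (Fin r) ℂ) (η : Fin r → ℂ) :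
    (A.map conj).mulVec η = star (A.mulVec (star η)) := by
  rw [← map_conj_mulVec, star_star]

theorem mulVec_eq_of_columns {A : Matrix (Fin s) (Fin r) ℂ} (B : Matrix (Fin s) (Fin r) ℂ)
    (h : ∀ j, A.mulVec (Pi.single j 1) = B.mulVec (Pi.single j 1)) : A = B := by
  ext i j
  simpa using congrFun (h j) i

open Classical in
/-- A dianalytic map, read on the complex cover, is complex linear; its matrix is the lift of the
matrix of the map. -/
theorem IsComplexCover.lift_mulVec (hp : IsComplexCover σ p) (h : IsDianalyticChart φ)
    (h' : IsDianalyticChart φ') (hy : p y ∈ φ.source) (hy' : p y ∈ φ'.source)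
    {T : S → (Fin r → ℂ) → (Fin s → ℂ)} (hT : DianalyticMapAt φ φ' T (p y)) (η : Fin r → ℂ) :
    (lift p φ' (fun x => Matrix.of fun i j => T x (Pi.single j 1) i) y).mulVec η =
      twist (Positive p φ' y) (T (p y) (twist (Positive p φ y) η)) := by
  obtain ⟨k, hk⟩ := hT
  have hmat : Matrix.of (fun i j => T (p y) (Pi.single j 1) i) = k (p y) := by
    ext i j
    rcases hk with ⟨-, -, hTk⟩ | ⟨-, -, hTk⟩ <;>
    · rw [Matrix.of_apply, hTk.self_of_nhds]
      simp
  have hreal : (φ (p y)).1.im = 0 → (k (p y)).map conj = k (p y) := by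
    intro h0
    ext i j
    rw [Matrix.map_apply]
    rcases hk with ⟨-, hk, -⟩ | ⟨-, hk, -⟩
    · have := (hk i j).self_of_nhds.2.1 h0
      simp only [φ.left_inv hy] at this
      exact Complex.conj_eq_iff_im.mpr this
    · have := (hk i j).self_of_nhds.2.1 h0
      simp only [φ.left_inv hy, Complex.conj_im, neg_eq_zero] at this
      exact Complex.conj_eq_iff_im.mpr this
  -- `Positive` may replace `UpperSheet` in the lift: they agree over the interior, and over the
  -- boundary the matrix is real and both branches coincide.
  have hlift : lift p φ' (fun x => Matrix.of fun i j => T x (Pi.single j 1) i) y =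
      if Positive p φ' y then k (p y) else (k (p y)).map conj := by
    rcases im_eq_zero_or_pos φ (p y) with h0 | h0
    · simp only [lift, hmat, hreal h0, ite_self]
    · simp only [lift, hmat, hp.positive_iff_upperSheet h' hy' ((im_pos_iff h h' hy hy').mp h0)]
  rw [hlift]
  rcases hk with ⟨hr, -, hTk⟩ | ⟨hr, -, hTk⟩
  · have h1 := positive_iff_of_holoRel h h' hy hy' hr
    rw [hTk.self_of_nhds, h1]
    by_cases h2 : Positive p φ y
    · simp [h2, twist_of_true]
    · simp [h2, twist_of_false, map_conj_mulVec']
  · have h1 := positive_iff_of_antiRel h h' hy hy' hr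
    rw [hTk.self_of_nhds, h1]
    by_cases h2 : Positive p φ y
    · simp [h2, twist_of_false, twist_of_true, map_conj_mulVec']
    · simp [h2, twist_of_false, twist_of_true]

/-- Descent of holomorphic functions from the complex cover to the Klein surface. -/
theorem IsComplexCover.holoAt_of_equivariant (hp : IsComplexCover σ p) (h : IsDianalyticChart φ)
    {x : S} (hx : x ∈ φ.source) {G : M → ℂ} {k : S → ℂ}
    (hG : ∀ᶠ x' in 𝓝 x, ∀ y, p y = x' → MDifferentiableAt 𝓘(ℂ, ℂ) 𝓘(ℂ, ℂ) G y ∧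
      G (σ y) = conj (G y) ∧ (Positive p φ y → k x' = G y) ∧
      (¬ Positive p φ y → k x' = conj (G y))) :
    HoloAt (fun w => k (φ.symm w)) (φ x) := by
  obtain ⟨y, rfl⟩ : ∃ y, p y = x := hp.surjective x
  -- With the point taken on the boundary or the upper sheet, the lifted coordinate satisfies `z y =
  -- φ (p y)`, so `k` in the chart `φ` is a restriction of `G` in the chart `z`.
  wlog hu : (φ (p y)).1.im = 0 ∨ UpperSheet p φ y generalizing y
  · have h0 := (im_eq_zero_or_pos φ (p y)).resolve_left fun h0 => hu (Or.inl h0)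
    have h1 := (hp.upperSheet_involution_iff h hx h0).mpr fun h1 => hu (Or.inr h1)
    have h2 := this (σ y) (by rwa [hp.apply_involution]) (by rwa [hp.apply_involution]) (Or.inr h1)
    rwa [hp.apply_involution] at h2
  obtain ⟨z, hz, hyz, hzp⟩ := hp.exists_lift h hx
  have hz0 : 0 ≤ (z y).im := by
    rcases hu with hu | hu
    · rw [(hzp y hyz).2, fold_im, abs_eq_zero] at hu
      exact hu.ge
    · exact ((upperSheet_iff_im_pos hz hzp hyz).mp hu).le
  have hw : (φ (p y)).1 = z y := by rw [(hzp y hyz).2, fold_val_of_nonneg hz0]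
  have hev : ∀ᶠ u in 𝓝 (z y), u ∈ z.target ∧ ∀ y', p y' = p (z.symm u) →
      MDifferentiableAt 𝓘(ℂ, ℂ) 𝓘(ℂ, ℂ) G y' ∧
      G (σ y') = conj (G y') ∧ (Positive p φ y' → k (p (z.symm u)) = G y') ∧
      (¬ Positive p φ y' → k (p (z.symm u)) = conj (G y')) := by
    refine (z.open_target.eventually_mem (z.map_source hyz)).and ?_
    have h1 : ContinuousAt (fun u => p (z.symm u)) (z y) :=
      hp.continuous.continuousAt.comp (z.symm.continuousAt (z.map_source hyz))
    rw [← z.left_inv hyz] at hG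
    exact h1.eventually hG
  have hd : ∀ᶠ u in 𝓝 (φ (p y)).1, DifferentiableAt ℂ (fun u => G (z.symm u)) u := by
    rw [hw]
    filter_upwards [hev] with u hu
    have := (mdifferentiableAt_iff_of_chart hz (z.map_target hu.1)).mp (hu.2 _ rfl).1
    rwa [z.right_inv hu.1] at this
  rw [← hw] at hev
  have hev' := continuous_subtype_val.continuousAt.eventually hev
  -- Points on the axis are fixed by `σ`, so equivariance makes `G` real there.
  have hreal : ∀ u ∈ z.target, u.im = 0 → σ (z.symm u) = z.symm u := by
    intro u hu h0
    obtain ⟨h1, h2⟩ := hzp _ (z.map_target hu)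
    refine hp.involution_eq_self h h1 ?_
    rw [h2, z.right_inv hu, fold_im, h0, abs_zero]
  refine (holoAt_of_differentiableAt hd ?_).congr ?_
  · filter_upwards [hev'] with v hv h0
    have h1 := (hv.2 _ rfl).2.1
    rw [hreal v.1 hv.1 h0] at h1
    exact Complex.conj_eq_iff_im.mp h1.symm
  · filter_upwards [hev'] with v hv
    obtain ⟨h1, h2⟩ := hzp _ (z.map_target hv.1)
    rw [z.right_inv hv.1, fold_coe] at h2
    have h3 : φ.symm v = p (z.symm v.1) := (congrArg φ.symm h2).symm.trans (φ.left_inv h1)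
    obtain ⟨-, h4, h5, h6⟩ := hv.2 _ rfl
    rw [h3]
    rcases v.2.eq_or_lt' with h0 | h0
    · rw [hreal v.1 hv.1 h0] at h4
      by_cases hP : Positive p φ (z.symm v.1)
      · exact (h5 hP).symm
      · exact h4.trans (h6 hP).symm
    · refine (h5 ?_).symm
      rw [hp.positive_iff_upperSheet h h1 (by rwa [h2]),
        upperSheet_iff_im_pos hz hzp (z.map_target hv.1), z.right_inv hv.1]
      exact h0

/-- The map between trivial bundles over `S` defined by an equivariant matrix function on the complex
cover does not depend on the point chosen over a point of `S`. -/
theorem IsComplexCover.twist_mulVec_twist_eq (hp : IsComplexCover σ p) (h : IsDianalyticChart φ)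
    (h' : IsDianalyticChart φ') {y y' : M} (hy : p y ∈ φ.source) (hy' : p y ∈ φ'.source)
    (hyy' : p y = p y') {G : M → Matrix (Fin s) (Fin r) ℂ} (hG : G (σ y) = (G y).map conj)
    (η : Fin r → ℂ) :
    twist (Positive p φ' y') ((G y').mulVec (twist (Positive p φ y') η)) =
      twist (Positive p φ' y) ((G y).mulVec (twist (Positive p φ y) η)) := by
  rcases (hp.fiber _ _).mp hyy'.symm with rfl | rfl
  · rfl
  · rcases im_eq_zero_or_pos φ (p y) with h0 | h0
    · rw [hp.involution_eq_self h hy h0]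
    · rw [hp.positive_involution_iff h hy h0,
        hp.positive_involution_iff h' hy' ((im_pos_iff h h' hy hy').mp h0), twist_not, twist_not, hG,
        map_conj_mulVec, twist_star, star_star]

/-- Descent of holomorphic matrix functions from the complex cover to the Klein surface. -/
theorem IsComplexCover.dianalyticMapAt_of_equivariant (hp : IsComplexCover σ p)
    (h : IsDianalyticChart φ) (h' : IsDianalyticChart φ') {x : S} (hx : x ∈ φ.source)
    (hx' : x ∈ φ'.source) {G : M → Matrix (Fin s) (Fin r) ℂ}
    {T : S → (Fin r → ℂ) → (Fin s → ℂ)}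
    (hG : ∀ᶠ x' in 𝓝 x, ∀ y, p y = x' → (∀ i j, MDifferentiableAt 𝓘(ℂ, ℂ) 𝓘(ℂ, ℂ)
      (fun y' => G y' i j) y) ∧ G (σ y) = (G y).map conj ∧
      ∀ η, T x' η = twist (Positive p φ' y) ((G y).mulVec (twist (Positive p φ y) η))) :
    DianalyticMapAt φ φ' T x := by
  have hsrc : ∀ᶠ x' in 𝓝 x, x' ∈ φ.source ∧ x' ∈ φ'.source :=
    (φ.open_source.eventually_mem hx).and (φ'.open_source.eventually_mem hx')
  rcases holoRel_or_antiRel h h' hx hx' with hr | hr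
  -- The two charts have equal signs, so both twists conjugate or neither does, and `T` is linear.
  · have hTG : ∀ᶠ x' in 𝓝 x, ∀ y, p y = x' → ∀ η, (Positive p φ y → T x' η = (G y).mulVec η) ∧
        (¬ Positive p φ y → T x' η = ((G y).map conj).mulVec η) := by
      filter_upwards [hG, hsrc, HoloRel.eventually hx hr] with x' h1 h2 h3 y hy η
      subst hy
      rw [(h1 y rfl).2.2, positive_iff_of_holoRel h h' h2.1 h2.2 h3]
      refine ⟨fun hP => ?_, fun hP => ?_⟩
      · simp only [twist_of_true hP]
      · simp only [twist_of_false hP, map_conj_mulVec']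
    refine ⟨fun x => Matrix.of fun i j => T x (Pi.single j 1) i, Or.inl ⟨hr, fun i j => ?_, ?_⟩⟩
    · refine hp.holoAt_of_equivariant h hx (G := fun y => G y i j)
        (k := fun x => T x (Pi.single j 1) i) ?_
      filter_upwards [hG, hTG] with x' h1 h2 y hy
      refine ⟨(h1 y hy).1 i j, by rw [(h1 y hy).2.1, Matrix.map_apply], fun hP => ?_, fun hP => ?_⟩
      · rw [(h2 y hy _).1 hP]; simp
      · rw [(h2 y hy _).2 hP]; simp
    · filter_upwards [hTG] with x' h2 η
      obtain ⟨y, hy⟩ := hp.surjective x'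
      by_cases hP : Positive p φ y
      · rw [(h2 y hy η).1 hP]
        congr 1
        ext i j
        rw [Matrix.of_apply, (h2 y hy _).1 hP]; simp
      · rw [(h2 y hy η).2 hP]
        congr 1
        ext i j
        rw [Matrix.of_apply, (h2 y hy _).2 hP]; simp
  -- The signs are opposite, so exactly one twist conjugates and `T` is antilinear.
  · have hTG : ∀ᶠ x' in 𝓝 x, ∀ y, p y = x' → ∀ η,
        (Positive p φ y → T x' η = ((G y).map conj).mulVec (star η)) ∧
        (¬ Positive p φ y → T x' η = (G y).mulVec (star η)) := by
      filter_upwards [hG, hsrc, AntiRel.eventually hx hr] with x' h1 h2 h3 y hy η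
      subst hy
      rw [(h1 y rfl).2.2, positive_iff_of_antiRel h h' h2.1 h2.2 h3]
      refine ⟨fun hP => ?_, fun hP => ?_⟩
      · simp only [twist_of_true hP, twist_not, map_conj_mulVec]
      · simp only [twist_of_false hP, twist_not, star_star]
    refine ⟨fun x => Matrix.of fun i j => T x (Pi.single j 1) i, Or.inr ⟨hr, fun i j => ?_, ?_⟩⟩
    · refine hp.holoAt_of_equivariant h hx (G := fun y => G y i j)
        (k := fun x => conj (T x (Pi.single j 1) i)) ?_
      filter_upwards [hG, hTG] with x' h1 h2 y hy
      refine ⟨(h1 y hy).1 i j, by rw [(h1 y hy).2.1, Matrix.map_apply], fun hP => ?_, fun hP => ?_⟩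
      · rw [(h2 y hy _).1 hP]; simp
      · rw [(h2 y hy _).2 hP]; simp
    · filter_upwards [hTG] with x' h2 η
      obtain ⟨y, hy⟩ := hp.surjective x'
      by_cases hP : Positive p φ y
      · rw [(h2 y hy η).1 hP]
        congr 1
        ext i j
        rw [Matrix.of_apply, (h2 y hy _).1 hP]; simp
      · rw [(h2 y hy η).2 hP]
        congr 1
        ext i j
        rw [Matrix.of_apply, (h2 y hy _).2 hP]; simp

end Descent

/-! ## Holomorphic frames -/

section ContMDiff

variable {H X : Type*} [TopologicalSpace H] {V : Type*} [NormedAddCommGroup V] [NormedSpace ℂ V]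
  {I : ModelWithCorners ℂ V H} [TopologicalSpace X] [ChartedSpace H X] {r s : ℕ} {x : X}

/-- A function with values in the continuous linear maps from `ℂ^r` is smooth if it is so on the
standard basis. -/
theorem contMDiffAt_clm_of_single {A : X → (Fin r → ℂ) →L[ℂ] (Fin s → ℂ)}
    (hA : ∀ j, ContMDiffAt I 𝓘(ℂ, Fin s → ℂ) ω (fun y => A y (Pi.single j 1)) x) :
    ContMDiffAt I 𝓘(ℂ, (Fin r → ℂ) →L[ℂ] (Fin s → ℂ)) ω A x := by
  -- Assembling a linear map from its columns is linear between finite-dimensional spaces, hence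
  -- holomorphic.
  let Φ : (Fin r → Fin s → ℂ) →L[ℂ] ((Fin r → ℂ) →L[ℂ] (Fin s → ℂ)) :=
    LinearMap.toContinuousLinearMap
      (((Pi.basisFun ℂ (Fin r)).constr ℂ).trans LinearMap.toContinuousLinearMap).toLinearMap
  have h1 : ContMDiffAt I 𝓘(ℂ, Fin r → Fin s → ℂ) ω (fun y j => A y (Pi.single j 1)) x :=
    contMDiffAt_pi_space.mpr hA
  have h2 : A = fun y => Φ fun j => A y (Pi.single j 1) := by
    funext y
    have h3 : ((Pi.basisFun ℂ (Fin r)).constr ℂ fun j => A y (Pi.single j 1)) = (A y).toLinearMap :=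
      (Pi.basisFun ℂ (Fin r)).ext fun j => by simp [Module.Basis.constr_apply_fintype]
    have h4 : Φ (fun j => A y (Pi.single j 1)) = LinearMap.toContinuousLinearMap
        ((Pi.basisFun ℂ (Fin r)).constr ℂ fun j => A y (Pi.single j 1)) := rfl
    rw [h4, h3]
    rfl
  rw [h2]
  exact Φ.contMDiff.contMDiffAt.comp x h1

theorem contMDiffAt_mulVecCLM {G : X → Matrix (Fin s) (Fin r) ℂ}
    (hG : ∀ i j, ContMDiffAt I 𝓘(ℂ, ℂ) ω (fun y => G y i j) x) :
    ContMDiffAt I 𝓘(ℂ, (Fin r → ℂ) →L[ℂ] (Fin s → ℂ)) ω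
      (fun y => LinearMap.toContinuousLinearMap (G y).mulVecLin) x :=
  contMDiffAt_clm_of_single fun j => contMDiffAt_pi_space.mpr fun i => by simpa using hG i j

theorem contMDiffAt_mulVec {G : X → Matrix (Fin s) (Fin r) ℂ} {η : X → Fin r → ℂ}
    (hG : ∀ i j, ContMDiffAt I 𝓘(ℂ, ℂ) ω (fun y => G y i j) x)
    (hη : ContMDiffAt I 𝓘(ℂ, Fin r → ℂ) ω η x) :
    ContMDiffAt I 𝓘(ℂ, Fin s → ℂ) ω (fun y => (G y).mulVec (η y)) x :=
  (contMDiffAt_mulVecCLM hG).clm_apply hη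

end ContMDiff

section Frames

variable {M : Type*} [TopologicalSpace M] [ChartedSpace ℂ M] {σ : M → M}

/-- Holomorphy of a fibrewise linear function on (part of) a bundle. -/
def HolOn (E : RealBundle σ) {n : ℕ} (coord : ∀ y, E.Fiber y →ₗ[ℂ] (Fin n → ℂ)) (W : Set M) : Prop :=
  ContMDiffOn (𝓘(ℂ, ℂ).prod 𝓘(ℂ, Fin E.rank → ℂ)) 𝓘(ℂ, Fin n → ℂ) ω
    (fun v : E.Total => coord v.1 v.2) {v | v.1 ∈ W}

open Classical in
/-- The inverse of a fibrewise bijective family of linear coordinates. -/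
def frameInv {E : RealBundle σ} {n : ℕ} (coord : ∀ y, E.Fiber y →ₗ[ℂ] (Fin n → ℂ)) (y : M) :
    (Fin n → ℂ) →ₗ[ℂ] E.Fiber y :=
  if h : Function.Bijective (coord y) then (LinearEquiv.ofBijective (coord y) h).symm.toLinearMap
  else 0

variable {E E' : RealBundle σ} {n n' : ℕ} {coord : ∀ y, E.Fiber y →ₗ[ℂ] (Fin n → ℂ)}
  {coord' : ∀ y, E'.Fiber y →ₗ[ℂ] (Fin n' → ℂ)} {W : Set M}

theorem coord_frameInv {y : M} (h : Function.Bijective (coord y)) (η : Fin n → ℂ) :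
    coord y (frameInv coord y η) = η := by
  rw [frameInv, dif_pos h]
  exact (LinearEquiv.ofBijective (coord y) h).apply_symm_apply η

theorem frameInv_coord {y : M} (h : Function.Bijective (coord y)) (v : E.Fiber y) :
    frameInv coord y (coord y v) = v :=
  h.1 (coord_frameInv h _)

theorem HolOn.contMDiffAt (hc : HolOn E coord W) (hW : IsOpen W) {v : E.Total} (hv : v.1 ∈ W) :
    ContMDiffAt (𝓘(ℂ, ℂ).prod 𝓘(ℂ, Fin E.rank → ℂ)) 𝓘(ℂ, Fin n → ℂ) ω
      (fun v : E.Total => coord v.1 v.2) v :=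
  ContMDiffOn.contMDiffAt hc ((hW.preimage (FiberBundle.continuous_proj _ _)).mem_nhds hv)

/-- Evaluation on a local section. -/
theorem contMDiffAt_symm_section [IsManifold 𝓘(ℂ, ℂ) ω M] {y : M}
    {T : Trivialization (Fin E.rank → ℂ) (π (Fin E.rank → ℂ) E.Fiber)} [MemTrivializationAtlas T]
    (hy : y ∈ T.baseSet) (η : Fin E.rank → ℂ) :
    ContMDiffAt 𝓘(ℂ, ℂ) (𝓘(ℂ, ℂ).prod 𝓘(ℂ, Fin E.rank → ℂ)) ω
      (fun y' => (⟨y', T.symm y' η⟩ : E.Total)) y := by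
  have h1 : ContMDiffAt (𝓘(ℂ, ℂ).prod 𝓘(ℂ, Fin E.rank → ℂ)) (𝓘(ℂ, ℂ).prod 𝓘(ℂ, Fin E.rank → ℂ)) ω
      T.toOpenPartialHomeomorph.symm (y, η) :=
    T.contMDiffOn_symm.contMDiffAt (T.open_target.mem_nhds (T.mem_target.mpr hy))
  have h2 : ContMDiffAt 𝓘(ℂ, ℂ) (𝓘(ℂ, ℂ).prod 𝓘(ℂ, Fin E.rank → ℂ)) ω (fun y' => (y', η)) y :=
    contMDiffAt_id.prodMk contMDiffAt_const
  refine (h1.comp y h2).congr_of_eventuallyEq ?_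
  filter_upwards [T.open_baseSet.mem_nhds hy] with y' hy'
  exact T.mk_symm hy' η

/-- The inverse of a holomorphic frame is holomorphic. -/
theorem contMDiffAt_frameInv [IsManifold 𝓘(ℂ, ℂ) ω M] (hW : IsOpen W) (hc : HolOn E coord W)
    (hb : ∀ y ∈ W, Function.Bijective (coord y)) {q : M × (Fin n → ℂ)} (hq : q.1 ∈ W) :
    ContMDiffAt (𝓘(ℂ, ℂ).prod 𝓘(ℂ, Fin n → ℂ)) (𝓘(ℂ, ℂ).prod 𝓘(ℂ, Fin E.rank → ℂ)) ω
      (fun q : M × (Fin n → ℂ) => (⟨q.1, frameInv coord q.1 q.2⟩ : E.Total)) q := by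
  obtain ⟨y, η⟩ := q
  set T := trivializationAt (Fin E.rank → ℂ) E.Fiber y
  have hyT : y ∈ T.baseSet := mem_baseSet_trivializationAt _ _ y
  let A : M → (Fin E.rank → ℂ) →L[ℂ] (Fin n → ℂ) := fun y' =>
    LinearMap.toContinuousLinearMap (coord y' ∘ₗ T.symmₗ ℂ y')
  have hA : ContMDiffAt 𝓘(ℂ, ℂ) 𝓘(ℂ, (Fin E.rank → ℂ) →L[ℂ] (Fin n → ℂ)) ω A y := by
    refine contMDiffAt_clm_of_single fun j => ?_
    have h1 := contMDiffAt_symm_section (E := E) hyT (Pi.single j 1)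
    have h2 := hc.contMDiffAt hW (v := ⟨y, T.symm y (Pi.single j 1)⟩) hq
    refine (ContMDiffAt.comp y h2 h1).congr_of_eventuallyEq ?_
    filter_upwards [T.open_baseSet.mem_nhds hyT] with y' hy'
    simp [A, Trivialization.symmₗ_apply _ hy']
  let e : ∀ y' ∈ W, y' ∈ T.baseSet → (Fin E.rank → ℂ) ≃L[ℂ] (Fin n → ℂ) := fun y' hy' hy'' =>
    ((T.linearEquivAt ℂ y' hy'').symm.trans
      (LinearEquiv.ofBijective (coord y') (hb y' hy'))).toContinuousLinearEquiv
  have hAe : ∀ y' (h : y' ∈ W) (h' : y' ∈ T.baseSet), A y' = e y' h h' := by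
    intro y' h h'
    ext1 η
    simp [A, e, Trivialization.symmₗ_apply _ h']
  -- Inversion is analytic near an invertible operator.
  have hinv : ContMDiffAt 𝓘(ℂ, ℂ) 𝓘(ℂ, (Fin n → ℂ) →L[ℂ] (Fin E.rank → ℂ)) ω
      (fun y' => ContinuousLinearMap.inverse (A y')) y := by
    have h1 : ContDiffAt ℂ ω ContinuousLinearMap.inverse (A y) := by
      rw [hAe y hq hyT]
      exact contDiffAt_map_inverse _
    exact h1.comp_contMDiffAt hA
  rw [Trivialization.contMDiffAt_iff (e := T) (T.mem_source.mpr hyT)]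
  refine ⟨contMDiffAt_fst, ?_⟩
  have h2 : ContMDiffAt (𝓘(ℂ, ℂ).prod 𝓘(ℂ, Fin n → ℂ)) 𝓘(ℂ, Fin E.rank → ℂ) ω
      (fun q : M × (Fin n → ℂ) => ContinuousLinearMap.inverse (A q.1) q.2) (y, η) :=
    (ContMDiffAt.comp (y, η) (g := fun y' => ContinuousLinearMap.inverse (A y')) hinv
      contMDiffAt_fst).clm_apply contMDiffAt_snd
  refine h2.congr_of_eventuallyEq ?_
  filter_upwards [continuous_fst.continuousAt.eventually
    ((hW.eventually_mem hq).and (T.open_baseSet.eventually_mem hyT))] with q' hq'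
  rw [hAe q'.1 hq'.1 hq'.2, ContinuousLinearMap.inverse_equiv]
  simp only [frameInv, dif_pos (hb q'.1 hq'.1)]
  rfl

/-- The matrix of a fibrewise linear map in two frames. -/
def frameMatrix (coord : ∀ y, E.Fiber y →ₗ[ℂ] (Fin n → ℂ))
    (coord' : ∀ y, E'.Fiber y →ₗ[ℂ] (Fin n' → ℂ)) (f : ∀ y, E.Fiber y →ₗ[ℂ] E'.Fiber y) (y : M) :
    Matrix (Fin n') (Fin n) ℂ :=
  LinearMap.toMatrix' (coord' y ∘ₗ f y ∘ₗ frameInv coord y)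

theorem frameMatrix_mulVec {f : ∀ y, E.Fiber y →ₗ[ℂ] E'.Fiber y} {y : M} (η : Fin n → ℂ) :
    (frameMatrix coord coord' f y).mulVec η = coord' y (f y (frameInv coord y η)) := by
  rw [frameMatrix, LinearMap.toMatrix'_mulVec]
  rfl

theorem frameMatrix_mulVec_coord {f : ∀ y, E.Fiber y →ₗ[ℂ] E'.Fiber y} {y : M}
    (h : Function.Bijective (coord y)) (v : E.Fiber y) :
    (frameMatrix coord coord' f y).mulVec (coord y v) = coord' y (f y v) := by
  rw [frameMatrix_mulVec, frameInv_coord h]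

theorem contMDiffAt_frameMatrix [IsManifold 𝓘(ℂ, ℂ) ω M] (hW : IsOpen W) (hc : HolOn E coord W)
    (hb : ∀ y ∈ W, Function.Bijective (coord y)) (hc' : HolOn E' coord' W)
    {f : ∀ y, E.Fiber y →ₗ[ℂ] E'.Fiber y}
    (hf : ContMDiff (𝓘(ℂ, ℂ).prod 𝓘(ℂ, Fin E.rank → ℂ)) (𝓘(ℂ, ℂ).prod 𝓘(ℂ, Fin E'.rank → ℂ)) ω
      (fun v : E.Total => (⟨v.1, f v.1 v.2⟩ : E'.Total))) {y : M} (hy : y ∈ W) (i : Fin n')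
    (j : Fin n) :
    ContMDiffAt 𝓘(ℂ, ℂ) 𝓘(ℂ, ℂ) ω (fun y => frameMatrix coord coord' f y i j) y := by
  have h1 := contMDiffAt_frameInv hW hc hb (q := (y, Pi.single j 1)) hy
  have h0 : ContMDiffAt 𝓘(ℂ, ℂ) (𝓘(ℂ, ℂ).prod 𝓘(ℂ, Fin n → ℂ)) ω
      (fun y' : M => (y', (Pi.single j 1 : Fin n → ℂ))) y :=
    contMDiffAt_id.prodMk contMDiffAt_const
  have h2 := ContMDiffAt.comp y h1 h0
  have h3 := hf.contMDiffAt.comp y h2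
  have h4 := hc'.contMDiffAt hW (v := ⟨y, f y (frameInv coord y (Pi.single j 1))⟩) hy
  have h5 := ContMDiffAt.comp y h4 h3
  have h6 := contMDiffAt_pi_space.mp h5 i
  refine h6.congr_of_eventuallyEq (Eventually.of_forall fun y' => ?_)
  simp [frameMatrix, LinearMap.toMatrix'_apply]

/-- A fibrewise linear map given by a holomorphic matrix in holomorphic frames is holomorphic. -/
theorem contMDiffAt_of_matrix [IsManifold 𝓘(ℂ, ℂ) ω M] (hW : IsOpen W) (hc : HolOn E coord W)
    (hc' : HolOn E' coord' W) (hb' : ∀ y ∈ W, Function.Bijective (coord' y))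
    {f : ∀ y, E.Fiber y →ₗ[ℂ] E'.Fiber y} {G : M → Matrix (Fin n') (Fin n) ℂ}
    (hf : ∀ y ∈ W, ∀ v, coord' y (f y v) = (G y).mulVec (coord y v)) {v : E.Total} (hv : v.1 ∈ W)
    (hG : ∀ i j, ContMDiffAt 𝓘(ℂ, ℂ) 𝓘(ℂ, ℂ) ω (fun y => G y i j) v.1) :
    ContMDiffAt (𝓘(ℂ, ℂ).prod 𝓘(ℂ, Fin E.rank → ℂ)) (𝓘(ℂ, ℂ).prod 𝓘(ℂ, Fin E'.rank → ℂ)) ω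
      (fun v : E.Total => (⟨v.1, f v.1 v.2⟩ : E'.Total)) v := by
  have hpr : ContMDiffAt (𝓘(ℂ, ℂ).prod 𝓘(ℂ, Fin E.rank → ℂ)) 𝓘(ℂ, ℂ) ω
      (fun v : E.Total => v.1) v := contMDiffAt_proj E.Fiber
  have h1 : ContMDiffAt (𝓘(ℂ, ℂ).prod 𝓘(ℂ, Fin E.rank → ℂ)) 𝓘(ℂ, Fin n' → ℂ) ω
      (fun v : E.Total => (G v.1).mulVec (coord v.1 v.2)) v :=
    contMDiffAt_mulVec (fun i j => ContMDiffAt.comp v (hG i j) hpr) (hc.contMDiffAt hW hv)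
  have h2 := contMDiffAt_frameInv hW hc' hb' (q := (v.1, (G v.1).mulVec (coord v.1 v.2))) hv
  refine (ContMDiffAt.comp v h2 (hpr.prodMk h1)).congr_of_eventuallyEq ?_
  filter_upwards [(hW.preimage (FiberBundle.continuous_proj _ _)).mem_nhds hv] with u hu
  simp only [Function.comp_def, ← hf u.1 hu, frameInv_coord (hb' u.1 hu)]

end Frames

/-! ## Lifts of homomorphisms of dianalytic bundles -/

section Lifts

variable {S M : Type*} [TopologicalSpace S] [ChartedSpace ClosedHalfPlane S]
  [TopologicalSpace M] [ChartedSpace ℂ M] {σ : M → M} {p : M → S}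
  {Q Q' Q'' : DianalyticBundle S} {y : M}

namespace DianalyticBundle

theorem mem_baseSet (a : Q.atlas) {x : S} (hx : x ∈ a.1.1.source) : x ∈ a.1.2.baseSet := by
  rw [Q.baseSet_eq a.1 a.2]
  exact hx

theorem isDianalyticChart' (a : Q.atlas) : IsDianalyticChart a.1.1 := Q.isDianalyticChart a.1 a.2

/-- A member of the atlas at a given point. -/
def indexAt (Q : DianalyticBundle S) (x : S) : Q.atlas :=
  ⟨(Q.exists_mem x).choose, (Q.exists_mem x).choose_spec.1⟩

theorem mem_indexAt (Q : DianalyticBundle S) (x : S) : x ∈ (Q.indexAt x).1.1.source :=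
  (Q.exists_mem x).choose_spec.2

/-- A local trivialisation as a linear equivalence on a fibre. -/
def fiberEquiv (a : Q.atlas) {x : S} (hx : x ∈ a.1.1.source) :
    Q.Fiber x ≃ₗ[ℝ] (Fin Q.rank → ℂ) :=
  haveI := Q.isLinear a.1 a.2
  a.1.2.linearEquivAt ℝ x (mem_baseSet a hx)

end DianalyticBundle

open DianalyticBundle

/-- The matrix of a homomorphism of dianalytic bundles, lifted to the complex cover. -/
abbrev liftMatrix (p : M → S) (f : Q ⟶ Q') (a : Q.atlas) (b : Q'.atlas) (y : M) :
    Matrix (Fin Q'.rank) (Fin Q.rank) ℂ :=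
  lift p b.1.1 (localMatrix Q Q' f.toFun a.1.2 b.1.2) y

/-! ## Homomorphisms between bundles with pull-back frames -/

namespace PullbackFrames

variable {E E' : RealBundle σ}

theorem holOn (P : PullbackFrames p Q E) (a : Q.atlas) :
    HolOn E (P.coord a) (p ⁻¹' a.1.1.source) := P.holomorphic a

theorem coord_injective (P : PullbackFrames p Q E) (a : Q.atlas) (ha : p y ∈ a.1.1.source) :
    Function.Injective (P.coord a y) := (P.bijective a y ha).1

theorem transition' (P : PullbackFrames p Q E) (a b : Q.atlas) (ha : p y ∈ a.1.1.source)
    (hb : p y ∈ b.1.1.source) (v : E.Fiber y) :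
    P.coord b y v = (liftMatrix p (𝟙 Q) a b y).mulVec (P.coord a y v) :=
  P.transition a b y ⟨ha, hb⟩ v

/-- `g` is the lift of the homomorphism `f` of dianalytic bundles. -/
def IsLift (P : PullbackFrames p Q E) (P' : PullbackFrames p Q' E') (f : Q ⟶ Q')
    (g : ∀ y, E.Fiber y →ₗ[ℂ] E'.Fiber y) : Prop :=
  ∀ (a : Q.atlas) (b : Q'.atlas) (y : M), p y ∈ a.1.1.source → p y ∈ b.1.1.source →
    ∀ v, P'.coord b y (g y v) = (liftMatrix p f a b y).mulVec (P.coord a y v)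

theorem IsLift.unique {P : PullbackFrames p Q E} {P' : PullbackFrames p Q' E'} {f : Q ⟶ Q'}
    {g g' : E ⟶ E'} (h : P.IsLift P' f g.toFun) (h' : P.IsLift P' f g'.toFun) : g = g' := by
  refine RealBundle.Hom.ext (funext fun y => LinearMap.ext fun v => ?_)
  have ha := Q.mem_indexAt (p y)
  have hb := Q'.mem_indexAt (p y)
  refine P'.coord_injective _ hb ?_
  rw [h _ _ y ha hb, h' _ _ y ha hb]

theorem IsLift.id (P : PullbackFrames p Q E) :
    P.IsLift P (𝟙 Q) (𝟙 E : E ⟶ E).toFun := fun a b _ ha hb v => P.transition' a b ha hb v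

/-- Standard basis vectors are fixed by conjugation, so the real structure carries the frame at `y`
to the frame at `σ y`, and `g` commutes with it. -/
theorem frameMatrix_involution (hp : IsComplexCover σ p) (P : PullbackFrames p Q E)
    (P' : PullbackFrames p Q' E') (g : E ⟶ E') (a : Q.atlas) (b : Q'.atlas)
    (ha : p y ∈ a.1.1.source) (hb : p y ∈ b.1.1.source) :
    frameMatrix (P.coord a) (P'.coord b) g.toFun (σ y) =
      (frameMatrix (P.coord a) (P'.coord b) g.toFun y).map conj := by
  refine mulVec_eq_of_columns _ fun j => ?_
  obtain ⟨u, hu⟩ := (P.bijective a y ha).2 (Pi.single j 1)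
  have h1 : (Pi.single j 1 : Fin Q.rank → ℂ) = P.coord a (σ y) (E.realStr y u) := by
    rw [P.real a y ha, hu, star_single]
  have h2 : Function.Bijective (P.coord a (σ y)) :=
    P.bijective a (σ y) (by rwa [hp.apply_involution])
  rw [map_conj_mulVec', star_single, ← hu, frameMatrix_mulVec_coord (P.bijective a y ha), hu, h1,
    frameMatrix_mulVec_coord h2, g.equivariant, P'.real b y hb]

theorem frameMatrix_change (P : PullbackFrames p Q E)
    (P' : PullbackFrames p Q' E') (g : E ⟶ E') (a a' : Q.atlas) (b b' : Q'.atlas)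
    (ha : p y ∈ a.1.1.source) (ha' : p y ∈ a'.1.1.source) (hb : p y ∈ b.1.1.source)
    (hb' : p y ∈ b'.1.1.source) (η : Fin Q.rank → ℂ) :
    (frameMatrix (P.coord a') (P'.coord b') g.toFun y).mulVec η =
      (liftMatrix p (𝟙 Q') b b' y).mulVec ((frameMatrix (P.coord a) (P'.coord b) g.toFun y).mulVec
        ((liftMatrix p (𝟙 Q) a' a y).mulVec η)) := by
  obtain ⟨u, rfl⟩ := (P.bijective a' y ha').2 η
  rw [frameMatrix_mulVec_coord (P.bijective a' y ha'), ← P.transition' a' a ha' ha,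
    frameMatrix_mulVec_coord (P.bijective a y ha), ← P'.transition' b b' hb hb']

end PullbackFrames

variable [RiemannSurface M]

theorem liftMatrix_involution (hp : IsComplexCover σ p) (f : Q ⟶ Q') (a : Q.atlas) (b : Q'.atlas)
    (ha : p y ∈ a.1.1.source) (hb : p y ∈ b.1.1.source) :
    liftMatrix p f a b (σ y) = (liftMatrix p f a b y).map conj :=
  hp.lift_real (isDianalyticChart' a) (isDianalyticChart' b) ha hb
    (f.dianalytic a.1 a.2 b.1 b.2 _ ⟨ha, hb⟩)

theorem contMDiffAt_liftMatrix (hp : IsComplexCover σ p) (f : Q ⟶ Q') (a : Q.atlas) (b : Q'.atlas)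
    (ha : p y ∈ a.1.1.source) (hb : p y ∈ b.1.1.source) (i : Fin Q'.rank) (j : Fin Q.rank) :
    ContMDiffAt 𝓘(ℂ, ℂ) 𝓘(ℂ, ℂ) ω (fun y => liftMatrix p f a b y i j) y :=
  hp.contMDiffAt_lift (isDianalyticChart' a) (isDianalyticChart' b) ha hb
    (f.dianalytic a.1 a.2 b.1 b.2 _ ⟨ha, hb⟩) i j

variable [KleinSurface S]

/-- In fibre coordinates twisted by orientation, the lifted matrix is `f` itself. Compatibility with
composition and identities is then mere cancellation of twists and trivialisations. -/
theorem liftMatrix_mulVec (hp : IsComplexCover σ p)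
    (f : Q ⟶ Q') (a : Q.atlas) (b : Q'.atlas)
    (ha : p y ∈ a.1.1.source) (hb : p y ∈ b.1.1.source) (η : Fin Q.rank → ℂ) :
    (liftMatrix p f a b y).mulVec η = twist (Positive p b.1.1 y)
      (fiberEquiv b hb (f.toFun (p y) ((fiberEquiv a ha).symm (twist (Positive p a.1.1 y) η)))) :=
  hp.lift_mulVec (isDianalyticChart' a) (isDianalyticChart' b) ha hb
    (f.dianalytic a.1 a.2 b.1 b.2 _ ⟨ha, hb⟩) η

theorem liftMatrix_comp (hp : IsComplexCover σ p)
    (f : Q ⟶ Q') (g : Q' ⟶ Q'') (a : Q.atlas) (b : Q'.atlas) (c : Q''.atlas)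
    (ha : p y ∈ a.1.1.source) (hb : p y ∈ b.1.1.source) (hc : p y ∈ c.1.1.source)
    (η : Fin Q.rank → ℂ) :
    (liftMatrix p g b c y).mulVec ((liftMatrix p f a b y).mulVec η) =
      (liftMatrix p (f ≫ g) a c y).mulVec η := by
  rw [liftMatrix_mulVec hp f a b ha hb, liftMatrix_mulVec hp g b c hb hc,
    liftMatrix_mulVec hp (f ≫ g) a c ha hc, twist_twist, LinearEquiv.symm_apply_apply]
  rfl

theorem liftMatrix_id (hp : IsComplexCover σ p) (a : Q.atlas) (ha : p y ∈ a.1.1.source)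
    (η : Fin Q.rank → ℂ) :
    (liftMatrix p (𝟙 Q) a a y).mulVec η = η := by
  rw [liftMatrix_mulVec hp (𝟙 Q) a a ha ha]
  change twist _ (fiberEquiv a ha ((fiberEquiv a ha).symm _)) = η
  rw [LinearEquiv.apply_symm_apply, twist_twist]

namespace PullbackFrames

variable {E E' E'' : RealBundle σ}

/-- On each fibre the map is defined in chosen frames; multiplicativity of lifts makes the same
formula valid in all frames. Holomorphy and equivariance are then properties of the lifted matrix.
-/
theorem exists_isLift (hp : IsComplexCover σ p) (P : PullbackFrames p Q E)
    (P' : PullbackFrames p Q' E') (f : Q ⟶ Q') :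
    ∃ g : E ⟶ E', P.IsLift P' f g.toFun := by
  let g : ∀ y, E.Fiber y →ₗ[ℂ] E'.Fiber y := fun y =>
    frameInv (P'.coord (Q'.indexAt (p y))) y ∘ₗ
      (liftMatrix p f (Q.indexAt (p y)) (Q'.indexAt (p y)) y).mulVecLin ∘ₗ
        P.coord (Q.indexAt (p y)) y
  have hg : P.IsLift P' f g := by
    intro a b y ha hb v
    have ha₀ := Q.mem_indexAt (p y)
    have hb₀ := Q'.mem_indexAt (p y)
    rw [P'.transition' _ b hb₀ hb]
    simp only [g, LinearMap.comp_apply, Matrix.mulVecLin_apply]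
    rw [coord_frameInv (P'.bijective _ y hb₀), P.transition' a _ ha ha₀,
      liftMatrix_comp hp _ _ _ _ _ ha ha₀ hb₀, liftMatrix_comp hp _ _ _ _ _ ha hb₀ hb]
    simp
  refine ⟨⟨g, fun v => ?_, fun y v => ?_⟩, hg⟩
  · set a := Q.indexAt (p v.1)
    set b := Q'.indexAt (p v.1)
    have ha : p v.1 ∈ a.1.1.source := Q.mem_indexAt _
    have hb : p v.1 ∈ b.1.1.source := Q'.mem_indexAt _
    refine contMDiffAt_of_matrix (W := p ⁻¹' (a.1.1.source ∩ b.1.1.source)) (coord := P.coord a)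
      (coord' := P'.coord b) (G := liftMatrix p f a b)
      ((a.1.1.open_source.inter b.1.1.open_source).preimage hp.continuous)
      ((P.holOn a).mono fun u hu => hu.1) ((P'.holOn b).mono fun u hu => hu.2)
      (fun y hy => P'.bijective b y hy.2) (fun y hy => hg a b y hy.1 hy.2) ⟨ha, hb⟩
      (contMDiffAt_liftMatrix hp f a b ha hb)
  · have ha := Q.mem_indexAt (p y)
    have hb := Q'.mem_indexAt (p y)
    have ha' := ha
    have hb' := hb
    rw [← hp.apply_involution y] at ha' hb'
    rw [hp.apply_involution y] at ha' hb'
    refine P'.coord_injective (y := σ y) (Q'.indexAt (p y)) (by rwa [hp.apply_involution]) ?_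
    rw [P'.real _ y hb, hg (Q.indexAt (p y)) (Q'.indexAt (p y)) y ha hb,
      hg (Q.indexAt (p y)) (Q'.indexAt (p y)) (σ y) (by rwa [hp.apply_involution])
        (by rwa [hp.apply_involution]), P.real _ y ha, liftMatrix_involution hp f _ _ ha hb,
      map_conj_mulVec]

theorem IsLift.comp (hp : IsComplexCover σ p) {P : PullbackFrames p Q E}
    {P' : PullbackFrames p Q' E'} {P'' : PullbackFrames p Q'' E''} {f : Q ⟶ Q'} {f' : Q' ⟶ Q''}
    {g : E ⟶ E'} {g' : E' ⟶ E''} (h : P.IsLift P' f g.toFun) (h' : P'.IsLift P'' f' g'.toFun) :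
    P.IsLift P'' (f ≫ f') (g ≫ g').toFun := by
  intro a c y ha hc v
  have hb := Q'.mem_indexAt (p y)
  rw [← liftMatrix_comp hp f f' a (Q'.indexAt (p y)) c ha hb hc, ← h a _ y ha hb, ← h' _ c y hb hc]
  rfl

/-- Two bundles identified with the same pulled back bundle are isomorphic. -/
def isoOfFrames (hp : IsComplexCover σ p) (P : PullbackFrames p Q E) (P' : PullbackFrames p Q E') :
    E ≅ E' where
  hom := (exists_isLift hp P P' (𝟙 Q)).choose
  inv := (exists_isLift hp P' P (𝟙 Q)).choose
  hom_inv_id := by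
    refine IsLift.unique (P := P) (P' := P) (f := 𝟙 Q) ?_ (IsLift.id P)
    have := IsLift.comp hp (exists_isLift hp P P' (𝟙 Q)).choose_spec
      (exists_isLift hp P' P (𝟙 Q)).choose_spec
    rwa [Category.comp_id] at this
  inv_hom_id := by
    refine IsLift.unique (P := P') (P' := P') (f := 𝟙 Q) ?_ (IsLift.id P')
    have := IsLift.comp hp (exists_isLift hp P' P (𝟙 Q)).choose_spec
      (exists_isLift hp P P' (𝟙 Q)).choose_spec
    rwa [Category.comp_id] at this

/-- Every fibre of `Q` is seen at some point of `M`, where the lifted matrix determines `f` through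
the twisted coordinates. -/
theorem IsLift.injective (hp : IsComplexCover σ p) {P : PullbackFrames p Q E}
    {P' : PullbackFrames p Q' E'} {f f' : Q ⟶ Q'} {g : ∀ y, E.Fiber y →ₗ[ℂ] E'.Fiber y}
    (h : P.IsLift P' f g) (h' : P.IsLift P' f' g) : f = f' := by
  refine DianalyticBundle.Hom.ext (funext fun x => LinearMap.ext fun v => ?_)
  obtain ⟨y, rfl⟩ := hp.surjective x
  have ha := Q.mem_indexAt (p y)
  have hb := Q'.mem_indexAt (p y)
  set a := Q.indexAt (p y)
  set b := Q'.indexAt (p y)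
  obtain ⟨u, hu⟩ := (P.bijective a y ha).2 (twist (Positive p a.1.1 y) (fiberEquiv a ha v))
  have h1 := (h a b y ha hb u).symm.trans (h' a b y ha hb u)
  rw [hu, liftMatrix_mulVec hp f a b ha hb, liftMatrix_mulVec hp f' a b ha hb, twist_twist,
    LinearEquiv.symm_apply_apply] at h1
  exact (fiberEquiv b hb).injective ((twist _).injective h1)

/-- Every homomorphism of pulled back bundles is the lift of a homomorphism of dianalytic bundles. -/
theorem exists_isLift_eq (hp : IsComplexCover σ p) (P : PullbackFrames p Q E)
    (P' : PullbackFrames p Q' E') (g : E ⟶ E') : ∃ f : Q ⟶ Q', P.IsLift P' f g.toFun := by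
  -- No continuity of this section is needed, since the descended map does not depend on the point
  -- chosen over `x`.
  let s : S → M := fun x => (hp.surjective x).choose
  have hs : ∀ x, p (s x) = x := fun x => (hp.surjective x).choose_spec
  let G : Q.atlas → Q'.atlas → M → Matrix (Fin Q'.rank) (Fin Q.rank) ℂ := fun a b =>
    frameMatrix (P.coord a) (P'.coord b) g.toFun
  let f : ∀ x, Q.Fiber x →ₗ[ℝ] Q'.Fiber x := fun x =>
    (fiberEquiv (Q'.indexAt x) (Q'.mem_indexAt x)).symm.toLinearMap ∘ₗ
      (twist (Positive p (Q'.indexAt x).1.1 (s x))).toLinearMap ∘ₗ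
        ((G (Q.indexAt x) (Q'.indexAt x) (s x)).mulVecLin.restrictScalars ℝ) ∘ₗ
          (twist (Positive p (Q.indexAt x).1.1 (s x))).toLinearMap ∘ₗ
            (fiberEquiv (Q.indexAt x) (Q.mem_indexAt x)).toLinearMap
  have hfv : ∀ x v, f x v = (fiberEquiv (Q'.indexAt x) (Q'.mem_indexAt x)).symm
      (twist (Positive p (Q'.indexAt x).1.1 (s x))
        ((G (Q.indexAt x) (Q'.indexAt x) (s x)).mulVec
          (twist (Positive p (Q.indexAt x).1.1 (s x))
            (fiberEquiv (Q.indexAt x) (Q.mem_indexAt x) v)))) := fun x v => rfl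
  -- The formula defining `f` holds in every pair of trivialisations and at every point of the fibre
  -- of `p`, not only at the chosen ones.
  have hloc : ∀ (a : Q.atlas) (b : Q'.atlas) (y : M) (ha : p y ∈ a.1.1.source)
      (hb : p y ∈ b.1.1.source) (η : Fin Q.rank → ℂ),
      fiberEquiv b hb (f (p y) ((fiberEquiv a ha).symm η)) =
        twist (Positive p b.1.1 y) ((G a b y).mulVec (twist (Positive p a.1.1 y) η)) := by
    intro a b y ha hb η
    have hyy := hs (p y)
    rw [hp.twist_mulVec_twist_eq (isDianalyticChart' a) (isDianalyticChart' b) (y := s (p y))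
      (by rwa [hyy]) (by rwa [hyy]) hyy
      (frameMatrix_involution hp P P' g a b (by rwa [hyy]) (by rwa [hyy]))]
    -- The fibres depend on the base point; it is made literally `p y'`, so that no transport along
    -- `p (s x) = x` is needed.
    generalize hx : p y = x at *
    generalize hy' : s x = y' at *
    subst hyy
    have ha₀ := Q.mem_indexAt (p y')
    have hb₀ := Q'.mem_indexAt (p y')
    rw [hfv, hy', frameMatrix_change P P' g (Q.indexAt (p y')) a (Q'.indexAt (p y')) b ha₀ ha hb₀ hb,
      liftMatrix_mulVec hp _ _ _ ha ha₀, liftMatrix_mulVec hp _ _ _ hb₀ hb, twist_twist, twist_twist]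
    rfl
  have hd : ∀ a ∈ Q.atlas, ∀ b ∈ Q'.atlas, ∀ x ∈ a.1.source ∩ b.1.source,
      DianalyticMapAt a.1 b.1 (Q.localExpr Q' f a.2 b.2) x := by
    intro a ha b hb x hx
    refine hp.dianalyticMapAt_of_equivariant (Q.isDianalyticChart a ha) (Q'.isDianalyticChart b hb)
      hx.1 hx.2 (G := G ⟨a, ha⟩ ⟨b, hb⟩) ?_
    filter_upwards [a.1.open_source.mem_nhds hx.1, b.1.open_source.mem_nhds hx.2] with x' h1 h2 y hy
    subst hy
    refine ⟨fun i j => ?_, frameMatrix_involution hp P P' g ⟨a, ha⟩ ⟨b, hb⟩ h1 h2,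
      hloc ⟨a, ha⟩ ⟨b, hb⟩ y h1 h2⟩
    refine ContMDiffAt.mdifferentiableAt (n := ω) ?_ (by simp)
    exact contMDiffAt_frameMatrix (W := p ⁻¹' (a.1.source ∩ b.1.source))
      ((a.1.open_source.inter b.1.open_source).preimage hp.continuous)
      ((P.holOn ⟨a, ha⟩).mono fun u hu => hu.1) (fun y hy => P.bijective ⟨a, ha⟩ y hy.1)
      ((P'.holOn ⟨b, hb⟩).mono fun u hu => hu.2) g.holomorphic ⟨h1, h2⟩ i j
  refine ⟨⟨f, hd⟩, fun a b y ha hb v => ?_⟩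
  rw [liftMatrix_mulVec hp _ a b ha hb]
  change _ = twist _ (fiberEquiv b hb (f (p y) ((fiberEquiv a ha).symm _)))
  rw [hloc, twist_twist, twist_twist, frameMatrix_mulVec_coord (P.bijective a y ha)]

end PullbackFrames

end Lifts

/-! ## The pulled back bundle -/

section PullbackBundle

open DianalyticBundle

variable {S M : Type*} [TopologicalSpace S] [ChartedSpace ClosedHalfPlane S] [KleinSurface S]
  [TopologicalSpace M] [ChartedSpace ℂ M] [RiemannSurface M] {σ : M → M} {p : M → S}

/-- The transition functions of the pulled back bundle. -/
def pullbackCore (hp : IsComplexCover σ p) (Q : DianalyticBundle S) :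
    VectorBundleCore ℂ M (Fin Q.rank → ℂ) Q.atlas where
  baseSet a := p ⁻¹' a.1.1.source
  isOpen_baseSet a := a.1.1.open_source.preimage hp.continuous
  indexAt y := Q.indexAt (p y)
  mem_baseSet_at y := Q.mem_indexAt (p y)
  coordChange a b y := LinearMap.toContinuousLinearMap (liftMatrix p (𝟙 Q) a b y).mulVecLin
  coordChange_self a y hy v := liftMatrix_id hp a hy v
  continuousOn_coordChange a b := fun y hy =>
    (contMDiffAt_mulVecCLM (contMDiffAt_liftMatrix hp (𝟙 Q) a b hy.1 hy.2)).continuousAt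
      |>.continuousWithinAt
  coordChange_comp a b c y hy v := by
    have := liftMatrix_comp hp (𝟙 Q) (𝟙 Q) a b c hy.1.1 hy.1.2 hy.2 v
    rwa [Category.comp_id] at this

instance (hp : IsComplexCover σ p) (Q : DianalyticBundle S) :
    (pullbackCore hp Q).IsContMDiff 𝓘(ℂ, ℂ) ω where
  contMDiffOn_coordChange a b := fun _ hy =>
    (contMDiffAt_mulVecCLM (contMDiffAt_liftMatrix hp (𝟙 Q) a b hy.1 hy.2)).contMDiffWithinAt

variable (hp : IsComplexCover σ p) (Q : DianalyticBundle S)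

/-- The coordinates of the pulled back bundle in the trivialisation `a`. -/
def pullbackCoord (a : Q.atlas) (y : M) : (pullbackCore hp Q).Fiber y →ₗ[ℂ] (Fin Q.rank → ℂ) :=
  ((pullbackCore hp Q).coordChange ((pullbackCore hp Q).indexAt y) a y).toLinearMap

variable {hp Q}

theorem pullbackCoord_transition (a b : Q.atlas) {y : M} (ha : p y ∈ a.1.1.source)
    (hb : p y ∈ b.1.1.source) (v : (pullbackCore hp Q).Fiber y) :
    pullbackCoord hp Q b y v = (liftMatrix p (𝟙 Q) a b y).mulVec (pullbackCoord hp Q a y v) :=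
  ((pullbackCore hp Q).coordChange_comp _ a b y ⟨⟨Q.mem_indexAt (p y), ha⟩, hb⟩ v).symm

theorem pullbackCoord_bijective (a : Q.atlas) {y : M} (ha : p y ∈ a.1.1.source) :
    Function.Bijective (pullbackCoord hp Q a y) := by
  have h0 : y ∈ (pullbackCore hp Q).baseSet ((pullbackCore hp Q).indexAt y) := Q.mem_indexAt (p y)
  have h1 : y ∈ (pullbackCore hp Q).baseSet a := ha
  refine Function.bijective_iff_has_inverse.mpr
    ⟨fun η => (pullbackCore hp Q).coordChange a ((pullbackCore hp Q).indexAt y) y η, fun v => ?_,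
      fun η => ?_⟩
  · exact ((pullbackCore hp Q).coordChange_comp _ a _ y ⟨⟨h0, h1⟩, h0⟩ v).trans
      ((pullbackCore hp Q).coordChange_self _ y h0 v)
  · exact ((pullbackCore hp Q).coordChange_comp a _ a y ⟨⟨h1, h0⟩, h1⟩ η).trans
      ((pullbackCore hp Q).coordChange_self _ y h1 η)

theorem contMDiffOn_pullbackCoord (a : Q.atlas) :
    ContMDiffOn (𝓘(ℂ, ℂ).prod 𝓘(ℂ, Fin Q.rank → ℂ)) 𝓘(ℂ, Fin Q.rank → ℂ) ω
      (fun v : TotalSpace (Fin Q.rank → ℂ) (pullbackCore hp Q).Fiber => pullbackCoord hp Q a v.1 v.2)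
      {v | p v.1 ∈ a.1.1.source} :=
  haveI : MemTrivializationAtlas ((pullbackCore hp Q).localTriv a) := ⟨⟨a, rfl⟩⟩
  contMDiff_snd.comp_contMDiffOn ((pullbackCore hp Q).localTriv a).contMDiffOn

variable (hp Q)

/-- The real structure of the pulled back bundle. -/
def pullbackRealStr (y : M) :
    (pullbackCore hp Q).Fiber y →ₛₗ[starRingEnd ℂ] (pullbackCore hp Q).Fiber (σ y) :=
  -- Conjugation is taken in the trivialisation preferred at `y`, then expressed in the one
  -- preferred at `σ y`. The two indices agree only through the propositional equality `p (σ y) = p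
  -- y`.
  (((pullbackCore hp Q).coordChange ((pullbackCore hp Q).indexAt y)
    ((pullbackCore hp Q).indexAt (σ y)) (σ y)).toLinearMap.comp
      (starL ℂ : (Fin Q.rank → ℂ) ≃L⋆[ℂ] (Fin Q.rank → ℂ)).toLinearEquiv.toLinearMap :
    (Fin Q.rank → ℂ) →ₛₗ[starRingEnd ℂ] (Fin Q.rank → ℂ))

variable {hp Q}

/-- The real structure is conjugation in one trivialisation by definition. Equivariance of the
transition matrices makes it conjugation in all of them. -/
theorem pullbackCoord_realStr (a : Q.atlas) {y : M} (ha : p y ∈ a.1.1.source)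
    (v : (pullbackCore hp Q).Fiber y) :
    pullbackCoord hp Q a (σ y) (pullbackRealStr hp Q y v) = star (pullbackCoord hp Q a y v) := by
  have h0 : p (σ y) ∈ (Q.indexAt (p y)).1.1.source := by
    rw [hp.apply_involution]; exact Q.mem_indexAt (p y)
  have h1 : p (σ y) ∈ a.1.1.source := by rwa [hp.apply_involution]
  refine ((pullbackCore hp Q).coordChange_comp ((pullbackCore hp Q).indexAt y)
    ((pullbackCore hp Q).indexAt (σ y)) a (σ y) ⟨⟨h0, Q.mem_indexAt (p (σ y))⟩, h1⟩ _).trans ?_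
  change (liftMatrix p (𝟙 Q) (Q.indexAt (p y)) a (σ y)).mulVec _ = star (_)
  rw [liftMatrix_involution hp (𝟙 Q) _ a (Q.mem_indexAt (p y)) ha]
  exact map_conj_mulVec _ _

variable (hp Q)

/-- The pulled back bundle `p^* Q`. -/
def pullbackBundle : RealBundle σ where
  rank := Q.rank
  Fiber := (pullbackCore hp Q).Fiber
  realStr := pullbackRealStr hp Q
  involutive := by
    rintro ⟨y, v⟩
    have ha := Q.mem_indexAt (p y)
    have ha' : p (σ y) ∈ (Q.indexAt (p y)).1.1.source := by rwa [hp.apply_involution]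
    have ha'' : p (σ (σ y)) ∈ (Q.indexAt (p y)).1.1.source := by
      rwa [hp.apply_involution, hp.apply_involution]
    -- The two vectors lie over `σ (σ y)` and `y`, so they are compared through a trivialisation of
    -- the total space.
    refine ((pullbackCore hp Q).localTriv (Q.indexAt (p y))).injOn ?_ ?_ ?_
    · exact ha''
    · exact ha
    · refine Prod.ext (hp.involutive y) ?_
      change pullbackCoord hp Q (Q.indexAt (p y)) (σ (σ y)) _ = pullbackCoord hp Q _ y v
      rw [pullbackCoord_realStr _ ha', pullbackCoord_realStr _ ha, star_star]
  antiholomorphic := by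
    intro v
    have ha : p v.1 ∈ (Q.indexAt (p (σ v.1))).1.1.source := by
      rw [hp.apply_involution]; exact Q.mem_indexAt (p v.1)
    have hU : {u : TotalSpace (Fin Q.rank → ℂ) (pullbackCore hp Q).Fiber |
        p u.1 ∈ (Q.indexAt (p (σ v.1))).1.1.source} ∈ 𝓝 v :=
      (((Q.indexAt (p (σ v.1))).1.1.open_source.preimage hp.continuous).preimage
        (FiberBundle.continuous_proj _ _)).mem_nhds ha
    -- In these coordinates the real structure is conjugation, so the conjugated function is the
    -- holomorphic coordinate itself.
    refine ((contMDiffOn_pullbackCoord (Q.indexAt (p (σ v.1)))).contMDiffAt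
      hU).congr_of_eventuallyEq ?_
    filter_upwards [hU] with u hu
    change star (pullbackCoord hp Q (Q.indexAt (p (σ v.1))) (σ u.1) _) = _
    rw [pullbackCoord_realStr _ hu, star_star]

/-- The tautological frames of the pulled back bundle. -/
def pullbackBundleFrames : PullbackFrames p Q (pullbackBundle hp Q) where
  coord := pullbackCoord hp Q
  bijective a _ ha := pullbackCoord_bijective a ha
  holomorphic a := contMDiffOn_pullbackCoord a
  real a _ ha v := pullbackCoord_realStr a ha v
  transition a b _ hy v := pullbackCoord_transition a b hy.1 hy.2 v

open PullbackFrames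

/-- The pull-back functor. -/
def pullbackFunctor : DianalyticBundle S ⥤ RealBundle σ where
  obj Q := pullbackBundle hp Q
  map f := (exists_isLift hp (pullbackBundleFrames hp _) (pullbackBundleFrames hp _) f).choose
  map_id Q := IsLift.unique (exists_isLift hp _ _ (𝟙 Q)).choose_spec
    (IsLift.id (pullbackBundleFrames hp Q))
  map_comp f g := IsLift.unique (exists_isLift hp _ _ (f ≫ g)).choose_spec
    (IsLift.comp hp (exists_isLift hp _ _ f).choose_spec (exists_isLift hp _ _ g).choose_spec)

theorem isPullbackFunctor_pullbackFunctor : IsPullbackFunctor p (pullbackFunctor hp) :=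
  ⟨pullbackBundleFrames hp, fun Q Q' f a b y hy v =>
    (exists_isLift hp (pullbackBundleFrames hp Q) (pullbackBundleFrames hp Q') f).choose_spec a b y
      hy.1 hy.2 v⟩

variable {hp}

/-- Only the frames enter, so the argument applies to any functor identified with the pull-back. -/
theorem IsPullbackFunctor.faithful (hp : IsComplexCover σ p)
    {F : DianalyticBundle S ⥤ RealBundle σ} (hF : IsPullbackFunctor p F) : F.Faithful := by
  obtain ⟨P, hP⟩ := hF
  refine ⟨fun {Q Q'} f f' h => IsLift.injective hp (P := P Q) (P' := P Q') (g := (F.map f).toFun)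
    (fun a b y ha hb => hP Q Q' f a b y ⟨ha, hb⟩) fun a b y ha hb => ?_⟩
  rw [h]
  exact hP Q Q' f' a b y ⟨ha, hb⟩

theorem IsPullbackFunctor.full (hp : IsComplexCover σ p)
    {F : DianalyticBundle S ⥤ RealBundle σ} (hF : IsPullbackFunctor p F) : F.Full := by
  obtain ⟨P, hP⟩ := hF
  refine ⟨fun {Q Q'} g => ?_⟩
  obtain ⟨f, hf⟩ := exists_isLift_eq hp (P Q) (P Q') g
  exact ⟨f, IsLift.unique (fun a b y ha hb => hP Q Q' f a b y ⟨ha, hb⟩) hf⟩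

end PullbackBundle

/-! ## Real frames -/

section RealFrames

variable {M : Type*} [TopologicalSpace M] [ChartedSpace ℂ M] {σ : M → M} {n : ℕ}

/-- The complex conjugate of a family of linear coordinates with respect to the real structure. -/
def conjCoord (E : RealBundle σ) (coord : ∀ y, E.Fiber y →ₗ[ℂ] (Fin n → ℂ)) (y : M) :
    E.Fiber y →ₗ[ℂ] (Fin n → ℂ) :=
  (starL ℂ : (Fin n → ℂ) ≃L⋆[ℂ] (Fin n → ℂ)).toLinearEquiv.toLinearMap.comp
    ((coord (σ y)).comp (E.realStr y))

variable {E : RealBundle σ} {coord : ∀ y, E.Fiber y →ₗ[ℂ] (Fin n → ℂ)} {y : M}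

theorem conjCoord_apply (v : E.Fiber y) :
    conjCoord E coord y v = star (coord (σ y) (E.realStr y v)) := rfl

/-- The involution is applied in the total space, because the fibres at `σ (σ y)` and `y` are not
definitionally equal. -/
theorem conjCoord_realStr (v : E.Fiber y) :
    conjCoord E coord (σ y) (E.realStr y v) = star (coord y v) :=
  congrArg (fun u : E.Total => star (coord u.1 u.2)) (E.involutive ⟨y, v⟩)

theorem RealBundle.realStr_injective (y : M) : Function.Injective (E.realStr y) := by
  intro v w h
  have h1 : (⟨y, v⟩ : E.Total) = ⟨y, w⟩ := E.involutive.injective <| by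
    change (⟨σ y, E.realStr y v⟩ : E.Total) = ⟨σ y, E.realStr y w⟩
    rw [h]
  simpa using h1

theorem conjCoord_injective (h : Function.Injective (coord (σ y))) :
    Function.Injective (conjCoord E coord y) := fun _ _ hvw =>
  E.realStr_injective y (h (star_injective hvw))

theorem bijective_of_injective {coord : ∀ y, E.Fiber y →ₗ[ℂ] (Fin E.rank → ℂ)}
    (h : Function.Injective (coord y)) : Function.Bijective (coord y) := by
  have e := (trivializationAt (Fin E.rank → ℂ) E.Fiber y).linearEquivAt ℂ y
    (mem_baseSet_trivializationAt _ _ y)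
  have := FiniteDimensional.of_injective e.toLinearMap e.injective
  exact ⟨h, (LinearMap.injective_iff_surjective_of_finrank_eq_finrank e.finrank_eq).mp h⟩

/-- The fibre coordinates of the preferred trivialisation at `y₀`. -/
def trivCoord (E : RealBundle σ) (y₀ y : M) : E.Fiber y →ₗ[ℂ] (Fin E.rank → ℂ) :=
  (trivializationAt (Fin E.rank → ℂ) E.Fiber y₀).linearMapAt ℂ y

theorem trivCoord_apply {y₀ : M} (h : y ∈ (trivializationAt (Fin E.rank → ℂ) E.Fiber y₀).baseSet)
    (v : E.Fiber y) :
    trivCoord E y₀ y v = (trivializationAt (Fin E.rank → ℂ) E.Fiber y₀ ⟨y, v⟩).2 := by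
  rw [trivCoord, Trivialization.linearMapAt_apply, if_pos h]

theorem trivCoord_injective {y₀ : M}
    (h : y ∈ (trivializationAt (Fin E.rank → ℂ) E.Fiber y₀).baseSet) :
    Function.Injective (trivCoord E y₀ y) := by
  rw [trivCoord, Trivialization.linearMapAt_def_of_mem _ h]
  exact LinearEquiv.injective _

theorem holOn_trivCoord [IsManifold 𝓘(ℂ, ℂ) ω M] (y₀ : M) :
    HolOn E (trivCoord E y₀) (trivializationAt (Fin E.rank → ℂ) E.Fiber y₀).baseSet := by
  have h1 := contMDiff_snd.comp_contMDiffOn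
    (Trivialization.contMDiffOn (n := ω) (IB := 𝓘(ℂ, ℂ))
      (trivializationAt (Fin E.rank → ℂ) E.Fiber y₀))
  refine (h1.mono fun v hv => ?_).congr fun v hv => ?_
  · exact (Trivialization.mem_source _).mpr hv
  · exact trivCoord_apply hv v.2

theorem HolOn.mono {W W' : Set M} (hc : HolOn E coord W) (h : W' ⊆ W) : HolOn E coord W' :=
  ContMDiffOn.mono hc fun _ hv => h hv

/-- Near `y₀`, the conjugate of the coordinates at `σ y₀` is given by a holomorphic matrix in the
coordinates at `y₀`. -/
theorem exists_conjCoord_eq [IsManifold 𝓘(ℂ, ℂ) ω M] (hσ : Continuous σ) (y₀ : M) :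
    ∃ B : M → (Fin E.rank → ℂ) →L[ℂ] (Fin E.rank → ℂ),
      (∀ᶠ y in 𝓝 y₀, ContMDiffAt 𝓘(ℂ, ℂ) 𝓘(ℂ, (Fin E.rank → ℂ) →L[ℂ] (Fin E.rank → ℂ)) ω B y) ∧
        ∀ᶠ y in 𝓝 y₀, ∀ v, conjCoord E (trivCoord E (σ y₀)) y v = B y (trivCoord E y₀ y v) := by
  set T := trivializationAt (Fin E.rank → ℂ) E.Fiber y₀
  set T' := trivializationAt (Fin E.rank → ℂ) E.Fiber (σ y₀)
  have hT : ∀ᶠ y in 𝓝 y₀, y ∈ T.baseSet :=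
    T.open_baseSet.eventually_mem (mem_baseSet_trivializationAt _ _ y₀)
  have hT' : ∀ᶠ y in 𝓝 y₀, σ y ∈ T'.baseSet :=
    hσ.continuousAt.eventually
      (T'.open_baseSet.eventually_mem (mem_baseSet_trivializationAt _ _ (σ y₀)))
  let B : M → (Fin E.rank → ℂ) →L[ℂ] (Fin E.rank → ℂ) := fun y =>
    LinearMap.toContinuousLinearMap (conjCoord E (trivCoord E (σ y₀)) y ∘ₗ T.symmₗ ℂ y)
  have hB : ContMDiffAt 𝓘(ℂ, ℂ) 𝓘(ℂ, (Fin E.rank → ℂ) →L[ℂ] (Fin E.rank → ℂ)) ω B y₀ := by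
    refine contMDiffAt_clm_of_single fun j => ?_
    -- A column of `B` is the conjugated function of `RealBundle.antiholomorphic` evaluated on a
    -- local holomorphic section.
    have h1 := contMDiffAt_symm_section (E := E) (mem_baseSet_trivializationAt _ _ y₀)
      (Pi.single j 1)
    have h2 := E.antiholomorphic ⟨y₀, T.symm y₀ (Pi.single j 1)⟩
    refine (ContMDiffAt.comp y₀ h2 h1).congr_of_eventuallyEq ?_
    filter_upwards [hT, hT'] with y hy hy'
    simp only [B, LinearMap.coe_toContinuousLinearMap', LinearMap.comp_apply,
      Trivialization.symmₗ_apply _ hy, conjCoord_apply, trivCoord_apply hy', Function.comp_apply]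
    rfl
  refine ⟨B, (contMDiffAt_iff_contMDiffAt_nhds (by simp)).mp hB, ?_⟩
  filter_upwards [hT] with y hy v
  change _ = conjCoord E (trivCoord E (σ y₀)) y (T.symmₗ ℂ y (T.linearMapAt ℂ y v))
  rw [Trivialization.symmₗ_linearMapAt _ hy]

/-- Coordinates given by a holomorphic matrix in holomorphic coordinates are holomorphic. -/
theorem HolOn.clm_apply {m : ℕ} {coord' : ∀ y, E.Fiber y →ₗ[ℂ] (Fin m → ℂ)} {W : Set M}
    (hW : IsOpen W) (hc : HolOn E coord W) {B : M → (Fin n → ℂ) →L[ℂ] (Fin m → ℂ)}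
    (hB : ∀ y ∈ W, ContMDiffAt 𝓘(ℂ, ℂ) 𝓘(ℂ, (Fin n → ℂ) →L[ℂ] (Fin m → ℂ)) ω B y)
    (h : ∀ y ∈ W, ∀ v, coord' y v = B y (coord y v)) : HolOn E coord' W := by
  intro v hv
  have hpr : ContMDiffAt (𝓘(ℂ, ℂ).prod 𝓘(ℂ, Fin E.rank → ℂ)) 𝓘(ℂ, ℂ) ω
      (fun v : E.Total => v.1) v := contMDiffAt_proj E.Fiber
  refine (((ContMDiffAt.comp v (hB v.1 hv) hpr).clm_apply
    (hc.contMDiffAt hW hv)).congr_of_eventuallyEq ?_).contMDiffWithinAt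
  filter_upwards [(hW.preimage (FiberBundle.continuous_proj _ _)).mem_nhds hv] with u hu
  exact h u.1 hu u.2

/-- The operator is invertible unless `-c / conj c` is an eigenvalue of `B`. For `c = 1 + t * I`
these quotients are distinct for distinct real `t`, while the spectrum is finite. -/
theorem exists_isUnit_smul_add {V : Type*} [NormedAddCommGroup V] [NormedSpace ℂ V]
    [FiniteDimensional ℂ V] (B : V →L[ℂ] V) :
    ∃ c : ℂ, IsUnit (c • (1 : V →L[ℂ] V) + conj c • B) := by
  let f : ℝ → ℂ := fun t => -((1 + t * Complex.I) / (1 - t * Complex.I))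
  have hne : ∀ t : ℝ, (1 - t * Complex.I : ℂ) ≠ 0 := fun t h => by
    simpa using congrArg Complex.re h
  have hf : Function.Injective f := by
    intro s t h
    have h1 := neg_injective h
    rw [div_eq_div_iff (hne s) (hne t)] at h1
    have h2 := congrArg Complex.im h1
    simp at h2
    linarith
  have hfin : (spectrum ℂ (B : V →ₗ[ℂ] V)).Finite := Module.End.finite_spectrum _
  obtain ⟨t, ht⟩ : ∃ t, f t ∉ spectrum ℂ (B : V →ₗ[ℂ] V) := by
    by_contra! h
    exact Set.infinite_univ ((hfin.preimage hf.injOn).subset fun t _ => h t)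
  refine ⟨1 + t * Complex.I, ?_⟩
  rw [← ContinuousLinearMap.spectrum_eq, spectrum.notMem_iff] at ht
  have h1 : IsUnit (-(1 - t * Complex.I : ℂ)) := (neg_ne_zero.mpr (hne t)).isUnit
  convert! (h1.map (algebraMap ℂ (V →L[ℂ] V))).mul ht using 1
  have h2 : (1 + t * Complex.I : ℂ) = -(1 - t * Complex.I) * f t := by
    simp only [f]
    field_simp [hne t]
  have h3 : conj (1 + t * Complex.I : ℂ) = 1 - t * Complex.I := by simp [sub_eq_add_neg]
  rw [h3, h2, Algebra.algebraMap_eq_smul_one, Algebra.algebraMap_eq_smul_one, smul_mul_assoc, one_mul]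
  module

/-- Every point has an invariant neighbourhood with a real holomorphic frame. -/
theorem exists_realFrame [RiemannSurface M] (hσ : Continuous σ) (hi : Function.Involutive σ)
    (E : RealBundle σ) (y₀ : M) :
    ∃ (W : Set M) (coord : ∀ y, E.Fiber y →ₗ[ℂ] (Fin E.rank → ℂ)), IsOpen W ∧ y₀ ∈ W ∧
      (∀ y ∈ W, σ y ∈ W) ∧ (∀ y ∈ W, Function.Bijective (coord y)) ∧ HolOn E coord W ∧
        ∀ y ∈ W, ∀ v, coord (σ y) (E.realStr y v) = star (coord y v) := by
  have hT₀ := (trivializationAt (Fin E.rank → ℂ) E.Fiber y₀).open_baseSet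
  have hyT₀ := mem_baseSet_trivializationAt (Fin E.rank → ℂ) E.Fiber y₀
  by_cases hfix : σ y₀ = y₀
  · obtain ⟨B, hB, hBT⟩ := exists_conjCoord_eq (E := E) hσ y₀
    rw [hfix] at hBT
    obtain ⟨c, hc⟩ := exists_isUnit_smul_add (B y₀)
    let A : M → (Fin E.rank → ℂ) →L[ℂ] (Fin E.rank → ℂ) := fun y => c • 1 + conj c • B y
    have hA : ∀ᶠ y in 𝓝 y₀, IsUnit (A y) := by
      have h0 := hB.self_of_nhds.continuousAt
      have h1 : ContinuousAt A y₀ := by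
        change ContinuousAt (fun y => c • 1 + conj c • B y) y₀
        fun_prop
      exact h1.eventually (Units.isOpen.eventually_mem hc)
    obtain ⟨W, hW, hWo, hyW⟩ := eventually_nhds_iff.mp
      (((hB.and hBT).and hA).and (hT₀.eventually_mem hyT₀))
    -- These coordinates are real for every `c`; the choice of `c` makes them invertible at `y₀`,
    -- and openness of the units extends this to a neighbourhood.
    let coord : ∀ y, E.Fiber y →ₗ[ℂ] (Fin E.rank → ℂ) := fun y =>
      c • trivCoord E y₀ y + conj c • conjCoord E (trivCoord E y₀) y
    have hcoord : ∀ y ∈ W, ∀ v, coord y v = A y (trivCoord E y₀ y v) := by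
      intro y hy v
      simp [coord, A, (hW y hy).1.1.2 v]
    refine ⟨W ∩ σ ⁻¹' W, coord, hWo.inter (hWo.preimage hσ), ⟨hyW, by rwa [Set.mem_preimage, hfix]⟩,
      fun y hy => ⟨hy.2, by rw [Set.mem_preimage, hi y]; exact hy.1⟩, fun y hy => ?_, ?_,
      fun y _ v => ?_⟩
    · refine bijective_of_injective fun v w h => ?_
      rw [hcoord y hy.1, hcoord y hy.1] at h
      exact trivCoord_injective (hW y hy.1).2
        ((ContinuousLinearMap.isUnit_iff_bijective.mp (hW y hy.1).1.2).1 h)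
    · refine HolOn.mono (W := W) ?_ Set.inter_subset_left
      refine HolOn.clm_apply hWo ((holOn_trivCoord y₀).mono fun y hy => (hW y hy).2)
        (B := A) (fun y hy => ?_) hcoord
      have h1 : ContMDiffAt 𝓘(ℂ, ℂ) 𝓘(ℂ, ℂ) ω (fun _ : M => conj c) y := contMDiffAt_const
      exact contMDiffAt_const.add (h1.smul (hW y hy).1.1.1)
    -- The real structure exchanges the two summands, each becoming the conjugate of the other.
    · simp only [coord, LinearMap.add_apply, LinearMap.smul_apply, conjCoord_realStr, star_add,
        star_smul, RCLike.star_def, Complex.conj_conj]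
      rw [conjCoord_apply, star_star, add_comm]
  -- At a point moved by `σ`, a neighbourhood `D` is taken disjoint from its image. Coordinates may
  -- be chosen freely on `D` and are then forced on the image.
  · obtain ⟨U, V, hU, hV, hyU, hyV, hUV⟩ := t2_separation (Ne.symm hfix)
    obtain ⟨B, hB, hBT⟩ := exists_conjCoord_eq (E := E) hσ (σ y₀)
    rw [hi y₀] at hBT
    obtain ⟨N, hN, hNo, hyN⟩ := eventually_nhds_iff.mp ((hB.and hBT).and
      ((trivializationAt (Fin E.rank → ℂ) E.Fiber (σ y₀)).open_baseSet.eventually_mem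
        (mem_baseSet_trivializationAt _ _ (σ y₀))))
    obtain ⟨D, hD, hDo, hyD⟩ := eventually_nhds_iff.mp (((hU.eventually_mem hyU).and
      (hT₀.eventually_mem hyT₀)).and (hσ.continuousAt.eventually
        ((hV.eventually_mem hyV).and (hNo.eventually_mem hyN))))
    have hσD : ∀ y ∈ D, σ y ∉ D := fun y hy hy' =>
      Set.disjoint_left.mp hUV (hD _ hy').1.1 (hD y hy).2.1
    have hσD' : ∀ y, σ y ∈ D → y ∉ D := fun y hy hy' => hσD y hy' hy
    classical
    let coord : ∀ y, E.Fiber y →ₗ[ℂ] (Fin E.rank → ℂ) := fun y =>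
      if y ∈ D then trivCoord E y₀ y else conjCoord E (trivCoord E y₀) y
    have h1 : ∀ y ∈ D, coord y = trivCoord E y₀ y := fun y hy => if_pos hy
    have h2 : ∀ y, y ∉ D → coord y = conjCoord E (trivCoord E y₀) y := fun y hy => if_neg hy
    refine ⟨D ∪ σ ⁻¹' D, coord, hDo.union (hDo.preimage hσ), Or.inl hyD, ?_, ?_, ?_, ?_⟩
    · rintro y (hy | hy)
      · exact Or.inr (by rwa [Set.mem_preimage, hi y])
      · exact Or.inl hy
    · rintro y (hy | hy) <;> refine bijective_of_injective ?_
      · rw [h1 y hy]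
        exact trivCoord_injective (hD y hy).1.2
      · rw [h2 y (hσD' y hy)]
        exact conjCoord_injective (trivCoord_injective (hD _ hy).1.2)
    · have h3 : HolOn E coord D := by
        refine ((holOn_trivCoord y₀).mono fun y hy => (hD y hy).1.2).congr fun v hv => ?_
        rw [h1 v.1 hv]
      -- Holomorphy of the conjugated coordinates is read in the trivialisation at `σ y₀`, where
      -- they are given by a holomorphic matrix.
      have h4 : HolOn E coord (σ ⁻¹' D) := by
        have hsub : σ ⁻¹' D ⊆ N := fun y hy => by
          have := (hD _ hy).2.2
          rwa [hi y] at this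
        have h5 : HolOn E (conjCoord E (trivCoord E y₀)) N :=
          HolOn.clm_apply hNo ((holOn_trivCoord (σ y₀)).mono fun y hy => (hN y hy).2)
            (fun y hy => (hN y hy).1.1) fun y hy => (hN y hy).1.2
        refine (h5.mono hsub).congr fun v hv => ?_
        rw [h2 v.1 (hσD' v.1 hv)]
      exact ContMDiffOn.union_of_isOpen h3 h4
        (hDo.preimage (FiberBundle.continuous_proj _ _))
        ((hDo.preimage hσ).preimage (FiberBundle.continuous_proj _ _))
    · rintro y (hy | hy) v
      · rw [h2 (σ y) (hσD y hy), h1 y hy, conjCoord_realStr]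
      · rw [h1 (σ y) hy, h2 y (hσD' y hy), conjCoord_apply, star_star]

end RealFrames

/-! ## Descent of real bundles -/

section Descent

instance : ClosedUnderRestriction dianalyticGroupoid where
  closedUnderRestriction {e} he s hs := by
    refine ⟨fun w hw => he.1 w ?_, fun w hw => he.2 w ?_⟩
    · rw [OpenPartialHomeomorph.restr_source] at hw
      exact hw.1
    · rw [OpenPartialHomeomorph.restr_target] at hw
      exact hw.1

/-- This supplies the continuity of the transition functions required of the descended topological
bundle. -/
theorem DianalyticMapAt.continuousAt {S : Type*} [TopologicalSpace S] {r s : ℕ} {φ φ' : OpenPartialHomeomorph S ClosedHalfPlane}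
    {T : S → (Fin r → ℂ) → (Fin s → ℂ)} {x : S} (hT : DianalyticMapAt φ φ' T x)
    (hx : x ∈ φ.source) (η : Fin r → ℂ) : ContinuousAt (fun y => T y η) x := by
  obtain ⟨k, hk⟩ := hT
  have key : (∀ i j, ContinuousAt (fun w => k (φ.symm w) i j) (φ x)) → ContinuousAt k x := by
    intro h
    refine continuousAt_pi.mpr fun i => continuousAt_pi.mpr fun j => ?_
    refine (ContinuousAt.comp (h i j) (φ.continuousAt hx)).congr ?_
    filter_upwards [φ.open_source.mem_nhds hx] with y hy
    simp [φ.left_inv hy]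
  rcases hk with ⟨-, h, hk⟩ | ⟨-, h, hk⟩
  · have h1 := key fun i j => (h i j).self_of_nhds.1
    refine ContinuousAt.congr (f := fun y => (k y).mulVec η) (by fun_prop) ?_
    exact hk.mono fun y hy => (hy η).symm
  · have h1 := key fun i j => by
      simpa [Function.comp_def] using
        Complex.continuous_conj.continuousAt.comp (h i j).self_of_nhds.1
    refine ContinuousAt.congr (f := fun y => (k y).mulVec (star η)) (by fun_prop) ?_
    exact hk.mono fun y hy => (hy η).symm

variable {S M : Type*} [TopologicalSpace S] [ChartedSpace ClosedHalfPlane S]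
  [TopologicalSpace M] [ChartedSpace ℂ M] {σ : M → M} {p : M → S}

/-- A real holomorphic frame of `E` over the preimage of the domain of a dianalytic chart. -/
structure RealFrame (p : M → S) (E : RealBundle σ) where
  /-- the chart -/
  chart : OpenPartialHomeomorph S ClosedHalfPlane
  isDianalyticChart : IsDianalyticChart chart
  /-- the coordinates -/
  coord : ∀ y, E.Fiber y →ₗ[ℂ] (Fin E.rank → ℂ)
  bijective : ∀ y, p y ∈ chart.source → Function.Bijective (coord y)
  holOn : HolOn E coord (p ⁻¹' chart.source)
  real : ∀ y, p y ∈ chart.source → ∀ v, coord (σ y) (E.realStr y v) = star (coord y v)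

namespace RealFrame

variable {E : RealBundle σ} {y : M}

/-- The transition matrix between two frames. -/
def transition (i j : RealFrame p E) : M → Matrix (Fin E.rank) (Fin E.rank) ℂ :=
  frameMatrix i.coord j.coord fun _ => LinearMap.id

theorem transition_mulVec_coord (i j : RealFrame p E) (hi : p y ∈ i.chart.source) (v : E.Fiber y) :
    (i.transition j y).mulVec (i.coord y v) = j.coord y v :=
  frameMatrix_mulVec_coord (f := fun _ => LinearMap.id) (i.bijective y hi) v

theorem transition_involution (hp : IsComplexCover σ p) (i j : RealFrame p E)
    (hi : p y ∈ i.chart.source) (hj : p y ∈ j.chart.source) :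
    i.transition j (σ y) = (i.transition j y).map conj := by
  refine mulVec_eq_of_columns _ fun l => ?_
  obtain ⟨u, hu⟩ := (i.bijective y hi).2 (Pi.single l 1)
  have h1 : (Pi.single l 1 : Fin E.rank → ℂ) = i.coord (σ y) (E.realStr y u) := by
    rw [i.real y hi, hu, star_single]
  rw [map_conj_mulVec', star_single, ← hu, i.transition_mulVec_coord j hi, hu, h1,
    i.transition_mulVec_coord j (by rwa [hp.apply_involution]), j.real y hj]

/-- Identities between changes of frames can thus be tested on vectors of `E`. -/
theorem exists_twist_coord_eq (i : RealFrame p E) (hi : p y ∈ i.chart.source)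
    (η : Fin E.rank → ℂ) : ∃ v, twist (Positive p i.chart y) (i.coord y v) = η := by
  obtain ⟨v, hv⟩ := (i.bijective y hi).2 (twist (Positive p i.chart y) η)
  exact ⟨v, by rw [hv, twist_twist]⟩

variable [RiemannSurface M]

theorem contMDiffAt_transition (hp : IsComplexCover σ p) (i j : RealFrame p E)
    (hi : p y ∈ i.chart.source) (hj : p y ∈ j.chart.source) (k l : Fin E.rank) :
    ContMDiffAt 𝓘(ℂ, ℂ) 𝓘(ℂ, ℂ) ω (fun y => i.transition j y k l) y :=
  contMDiffAt_frameMatrix (W := p ⁻¹' (i.chart.source ∩ j.chart.source))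
    ((i.chart.open_source.inter j.chart.open_source).preimage hp.continuous)
    (i.holOn.mono fun _ hu => hu.1) (fun y hy => i.bijective y hy.1)
    (j.holOn.mono fun _ hu => hu.2) contMDiff_id ⟨hi, hj⟩ k l

variable [KleinSurface S]

/-- The change of frames, read on `S`. -/
def coordChange (hp : IsComplexCover σ p) (i j : RealFrame p E) (x : S) :
    (Fin E.rank → ℂ) →L[ℝ] (Fin E.rank → ℂ) :=
  (twist (Positive p j.chart (hp.surjective x).choose)).toContinuousLinearMap ∘L
    ((LinearMap.toContinuousLinearMap
      (i.transition j (hp.surjective x).choose).mulVecLin).restrictScalars ℝ) ∘L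
    (twist (Positive p i.chart (hp.surjective x).choose)).toContinuousLinearMap

theorem coordChange_apply (hp : IsComplexCover σ p) (i j : RealFrame p E)
    (hi : p y ∈ i.chart.source) (hj : p y ∈ j.chart.source) (η : Fin E.rank → ℂ) :
    coordChange hp i j (p y) η = twist (Positive p j.chart y)
      ((i.transition j y).mulVec (twist (Positive p i.chart y) η)) :=
  hp.twist_mulVec_twist_eq i.isDianalyticChart j.isDianalyticChart hi hj
    (hp.surjective (p y)).choose_spec.symm (transition_involution hp i j hi hj) η

/-- The descended transition maps compare twisted coordinates of one and the same vector of `E`, so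
they satisfy the cocycle conditions automatically. -/
theorem coordChange_twist_coord (hp : IsComplexCover σ p) (i j : RealFrame p E)
    (hi : p y ∈ i.chart.source) (hj : p y ∈ j.chart.source) (v : E.Fiber y) :
    coordChange hp i j (p y) (twist (Positive p i.chart y) (i.coord y v)) =
      twist (Positive p j.chart y) (j.coord y v) := by
  rw [coordChange_apply hp i j hi hj, twist_twist, i.transition_mulVec_coord j hi]

theorem dianalyticMapAt_coordChange (hp : IsComplexCover σ p) (i j : RealFrame p E) {x : S}
    (hi : x ∈ i.chart.source) (hj : x ∈ j.chart.source) :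
    DianalyticMapAt i.chart j.chart (fun x η => coordChange hp i j x η) x := by
  refine hp.dianalyticMapAt_of_equivariant i.isDianalyticChart j.isDianalyticChart hi hj
    (G := i.transition j) ?_
  filter_upwards [i.chart.open_source.mem_nhds hi, j.chart.open_source.mem_nhds hj] with x' h1 h2 y hy
  subst hy
  exact ⟨fun k l => (contMDiffAt_transition hp i j h1 h2 k l).mdifferentiableAt (by simp),
    transition_involution hp i j h1 h2, coordChange_apply hp i j h1 h2⟩

end RealFrame

variable [KleinSurface S] [RiemannSurface M]

theorem exists_realFrame_chart (hp : IsComplexCover σ p) (E : RealBundle σ) (x : S) :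
    ∃ i : RealFrame p E, x ∈ i.chart.source := by
  obtain ⟨y₀, rfl⟩ := hp.surjective x
  obtain ⟨W, coord, hW, hy₀, hσW, hb, hc, hr⟩ :=
    exists_realFrame hp.continuous_involution hp.involutive E y₀
  have hU := hp.isOpenMap W hW
  -- Since `W` is invariant under `σ`, it is the full preimage of its image.
  have hsub : ∀ y, p y ∈ ((chartAt ClosedHalfPlane (p y₀)).restr (p '' W)).source → y ∈ W := by
    intro y hy
    rw [OpenPartialHomeomorph.restr_source' _ _ hU] at hy
    obtain ⟨y', hy', h⟩ := hy.2
    rcases (hp.fiber _ _).mp h.symm with rfl | rfl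
    · exact hy'
    · exact hσW _ hy'
  refine ⟨⟨(chartAt ClosedHalfPlane (p y₀)).restr (p '' W),
    restr_mem_maximalAtlas _ (isDianalyticChart_chartAt _) hU, coord, fun y hy => hb y (hsub y hy),
    hc.mono hsub, fun y hy => hr y (hsub y hy)⟩, ?_⟩
  rw [OpenPartialHomeomorph.restr_source' _ _ hU]
  exact ⟨mem_chart_source _ _, y₀, hy₀, rfl⟩

open RealFrame

/-- The transition functions of the descended bundle. -/
def descentCore (hp : IsComplexCover σ p) (E : RealBundle σ) :
    VectorBundleCore ℝ S (Fin E.rank → ℂ) (RealFrame p E) where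
  baseSet i := i.chart.source
  isOpen_baseSet i := i.chart.open_source
  indexAt x := (exists_realFrame_chart hp E x).choose
  mem_baseSet_at x := (exists_realFrame_chart hp E x).choose_spec
  coordChange := coordChange hp
  coordChange_self i x hx v := by
    obtain ⟨y, rfl⟩ := hp.surjective x
    obtain ⟨u, rfl⟩ := i.exists_twist_coord_eq hx v
    exact coordChange_twist_coord hp i i hx hx u
  continuousOn_coordChange i j := continuousOn_clm_apply.mpr fun η _ hx =>
    ((dianalyticMapAt_coordChange hp i j hx.1 hx.2).continuousAt hx.1 η).continuousWithinAt
  coordChange_comp i j k x hx v := by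
    obtain ⟨y, rfl⟩ := hp.surjective x
    obtain ⟨u, rfl⟩ := i.exists_twist_coord_eq hx.1.1 v
    rw [coordChange_twist_coord hp i j hx.1.1 hx.1.2, coordChange_twist_coord hp j k hx.1.2 hx.2,
      coordChange_twist_coord hp i k hx.1.1 hx.2]

theorem descentCore_localExpr (hp : IsComplexCover σ p) (E : RealBundle σ) (i j : RealFrame p E)
    {x : S} (hi : x ∈ i.chart.source) (hj : x ∈ j.chart.source) (η : Fin E.rank → ℂ) :
    ((descentCore hp E).localTriv j ⟨x, ((descentCore hp E).localTriv i).symm x η⟩).2 =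
      coordChange hp i j x η := by
  rw [← Trivialization.coordChangeL_apply (R := ℝ) _ _ ⟨hi, hj⟩]
  exact (descentCore hp E).localTriv_coordChange_eq i j ⟨hi, hj⟩ η

/-- A member of the atlas of the descended bundle records only a chart and a trivialisation, not the
frame they came from; hence the hypotheses `hia` and `hjb`, valid for any frame giving that pair. -/
theorem descentCore_transition (hp : IsComplexCover σ p) (E : RealBundle σ) {i j : RealFrame p E}
    {a b : OpenPartialHomeomorph S ClosedHalfPlane ×
      Trivialization (Fin E.rank → ℂ) (π (Fin E.rank → ℂ) (descentCore hp E).Fiber)}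
    (hia : (i.chart, (descentCore hp E).localTriv i) = a)
    (hjb : (j.chart, (descentCore hp E).localTriv j) = b) {y : M} (ha : p y ∈ a.1.source)
    (hb : p y ∈ b.1.source) (v : E.Fiber y) :
    j.coord y v = twist (Positive p b.1 y)
      (b.2 ⟨p y, a.2.symm (p y) (twist (Positive p a.1 y) (i.coord y v))⟩).2 := by
  subst hia hjb
  rw [descentCore_localExpr hp E i j ha hb, coordChange_twist_coord hp i j ha hb, twist_twist]

/-- The dianalytic bundle whose pull-back is the real bundle `E`. -/
def descent (hp : IsComplexCover σ p) (E : RealBundle σ) : DianalyticBundle S where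
  rank := E.rank
  Fiber := (descentCore hp E).Fiber
  atlas := Set.range fun i : RealFrame p E => (i.chart, (descentCore hp E).localTriv i)
  isDianalyticChart := by
    rintro _ ⟨i, rfl⟩
    exact i.isDianalyticChart
  baseSet_eq := by
    rintro _ ⟨i, rfl⟩
    rfl
  isLinear := by
    rintro _ ⟨i, rfl⟩
    infer_instance
  exists_mem x := by
    obtain ⟨i, hi⟩ := exists_realFrame_chart hp E x
    exact ⟨_, ⟨i, rfl⟩, hi⟩
  dianalytic := by
    rintro _ ⟨i, rfl⟩ _ ⟨j, rfl⟩ x ⟨hi, hj⟩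
    refine (dianalyticMapAt_coordChange hp i j hi hj).congr ?_
    filter_upwards [i.chart.open_source.mem_nhds hi, j.chart.open_source.mem_nhds hj] with x' h1 h2
    funext η
    exact (descentCore_localExpr hp E i j h1 h2 η).symm

/-- A real frame giving a member of the atlas of the descended bundle. -/
def descentFrame (hp : IsComplexCover σ p) (E : RealBundle σ) (a : (descent hp E).atlas) :
    RealFrame p E := a.2.choose

theorem descentFrame_spec (hp : IsComplexCover σ p) (E : RealBundle σ) (a : (descent hp E).atlas) :
    ((descentFrame hp E a).chart, (descentCore hp E).localTriv (descentFrame hp E a)) = a.1 :=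
  a.2.choose_spec

theorem descentFrame_chart (hp : IsComplexCover σ p) (E : RealBundle σ) (a : (descent hp E).atlas) :
    (descentFrame hp E a).chart = a.1.1 := congrArg Prod.fst (descentFrame_spec hp E a)

/-- The real bundle `E` is the pull-back of the descended bundle. -/
def descentFrames (hp : IsComplexCover σ p) (E : RealBundle σ) :
    PullbackFrames p (descent hp E) E where
  coord a := (descentFrame hp E a).coord
  bijective a y ha := (descentFrame hp E a).bijective y (by rwa [descentFrame_chart])
  holomorphic a := by
    rw [← descentFrame_chart hp E a]
    exact (descentFrame hp E a).holOn
  real a y ha := (descentFrame hp E a).real y (by rwa [descentFrame_chart])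
  transition a b y hy v := by
    refine Eq.trans ?_ (hp.lift_mulVec ((descent hp E).isDianalyticChart a.1 a.2)
      ((descent hp E).isDianalyticChart b.1 b.2) hy.1 hy.2
      ((descent hp E).dianalytic a.1 a.2 b.1 b.2 _ hy) _).symm
    exact descentCore_transition hp E (descentFrame_spec hp E a) (descentFrame_spec hp E b)
      hy.1 hy.2 v

/-- Both `E` and the value of `F` at the descended bundle carry pull-back frames for that same
bundle, hence are isomorphic. -/
theorem IsPullbackFunctor.essSurj (hp : IsComplexCover σ p)
    {F : DianalyticBundle S ⥤ RealBundle σ} (hF : IsPullbackFunctor p F) : F.EssSurj := by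
  obtain ⟨P, -⟩ := hF
  exact ⟨fun E => ⟨descent hp E, ⟨PullbackFrames.isoOfFrames hp (P _) (descentFrames hp E)⟩⟩⟩

end Descent

end Klein

theorem mainTheorem5 {S M : Type*} [TopologicalSpace S] [ChartedSpace Klein.ClosedHalfPlane S]
    [Klein.KleinSurface S] [TopologicalSpace M] [ChartedSpace ℂ M] [Klein.RiemannSurface M]
    (σ : M → M) (p : M → S) (hp : Klein.IsComplexCover σ p) :
    (∃ F : Klein.DianalyticBundle S ⥤ Klein.RealBundle σ, Klein.IsPullbackFunctor p F) ∧
      ∀ F : Klein.DianalyticBundle S ⥤ Klein.RealBundle σ,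
        Klein.IsPullbackFunctor p F → F.IsEquivalence := by
  refine ⟨⟨Klein.pullbackFunctor hp, Klein.isPullbackFunctor_pullbackFunctor hp⟩, fun F hF => ?_⟩
  exact { faithful := hF.faithful hp, full := hF.full hp, essSurj := hF.essSurj hp }

end
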